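/- Let $n\ge 1$. An $n$th-order chromatic diagram is a finite graph (loops, multiple edges, $0$-valent vertices and closed curves without vertices are allowed) embedded without crossings in a rectangle, considered up to isotopy of the rectangle, such that $n$ marked points on the top edge and $n$ marked points on the bottom edge of the rectangle are $1$-valent vertices of the graph and the rest of the graph lies in the interior of the rectangle. A vertex other than a marked point is called inner, and an edge is called inner if both of its ends are inner vertices. Let $\mathcal F_n$ be the algebra over the field $\mathbb C((Q))$ of complex Laurent series which has the $n$th-order chromatic diagrams as a basis and whose product $A\cdot B$ of diagrams is obtained by stacking $A$ on top of $B$, connecting the edges which meet at the bottom marked points of $A$ and the top marked points of $B$, and deleting these marked points. Let $I_n\subset\mathcal F_n$ be the two-sided ideal generated by the following relations between diagrams: 1. $G = G/e - G\setminus e$ if $e$ is an inner edge of $G$ which is not a loop, where $G/e$ and $G\setminus e$ arise from $G$ by contraction and deletion of $e$; 2. $G=(Q-1)\,G\setminus e$ if $e$ is an inner edge of $G$ which is a loop; 3. $G=G'$ if $G'$ arises from $G$ by removing an inner $2$-valent vertex and merging the edges (or the two ends of the loop) at it. Let $\mathcal C_n=\mathcal F_n/I_n$ be the $n$th-order chromatic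 algebra. Let the Riordan numbers be given by $R_0=1$, $R_1=0$ and $(m+1)R_m=(m-1)(2R_{m-1}+3R_{m-2})$ for $m\ge 2$. Then $\mathcal C_n$ is finite-dimensional over $\mathbb C((Q))$, and $\dim_{\mathbb C((Q))}\mathcal C_n=R_{2n}$. -/

import Mathlib

noncomputable section

/-- The `2n` marked points of the rectangle: `top i` and `bot i` are the `i`-th points from the left
on its top and its bottom edge. -/
inductive Mark (n : ℕ) : Type
  | top (i : Fin n) : Mark n
  | bot (i : Fin n) : Mark n

/-- A finite graph drawn without crossings in the rectangle with `2n` marked points, recorded as a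
combinatorial map (rotation system with faces).

* `V`: the points of the drawing inside the rectangle. Those with `smooth v` are not vertices of the
  graph but auxiliary points in the interior of an edge or on a closed curve without vertices; the
  other ones are the inner vertices.
* `H`: the half-edges; `src h` is the point where `h` starts and `rev h` is the other half of its edge.
* `next h`: the half-edge which follows `h` counterclockwise around their common starting point.
* `F`: the faces, i.e. the regions of the rectangle cut out by the drawing. `face h` is the face to
  the left of `h` for someone who walks along `h` away from `src h`, so `face (rev h)` is the one to
  the right. A face may have several boundary curves (disconnected graphs).
* `mark m`: the only half-edge at the marked point `m`; marked points are 1-valent.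
* `gapT j`, `gapB j`: the face along the top (bottom) edge of the rectangle between the marked points
  `j - 1` and `j`; the first and the last ones lie along the left and the right side.
* `inc v f`: the point `v` is incident to the face `f`. This is determined by `face` if `v` has a
  half-edge; for a 0-valent vertex it says in which face the vertex lies. -/
structure Drawing (n : ℕ) : Type 1 where
  V : Type
  H : Type
  F : Type
  finV : Finite V
  finH : Finite H
  finF : Finite F
  src : H → V ⊕ Mark n
  rev : H → H
  next : H → H
  face : H → F
  mark : Mark n → H
  gapT : Fin (n + 1) → F
  gapB : Fin (n + 1) → F
  inc : V → F → Prop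
  smooth : V → Prop
  rev_rev : ∀ h, rev (rev h) = h
  rev_ne : ∀ h, rev h ≠ h
  /-- The half-edges at a point form one cycle of `next`. -/
  orbit : ∀ x y, src x = src y ↔ ∃ k : ℕ, next^[k] x = y
  src_mark : ∀ h m, src h = Sum.inr m ↔ h = mark m
  smooth_two : ∀ v, smooth v → {h | src h = Sum.inl v}.ncard = 2
  /-- The corner between `h` and `next h` lies left of `h` and right of `next h`. -/
  corner : ∀ h v, src h = Sum.inl v → face (rev (next h)) = face h
  face_top : ∀ i, face (mark (Mark.top i)) = gapT i.succ
  face_rev_top : ∀ i, face (rev (mark (Mark.top i))) = gapT i.castSucc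
  face_bot : ∀ i, face (mark (Mark.bot i)) = gapB i.castSucc
  face_rev_bot : ∀ i, face (rev (mark (Mark.bot i))) = gapB i.succ
  gap_left : gapT 0 = gapB 0
  gap_right : gapT (Fin.last n) = gapB (Fin.last n)
  inc_iff : ∀ h v, src h = Sum.inl v → ∀ f, inc v f ↔ ∃ h', src h' = Sum.inl v ∧ face h' = f
  inc_unique : ∀ v, (∀ h, src h ≠ Sum.inl v) → ∃! f, inc v f
  /-- Planarity, first half (Jordan property): every set of edges which meets each inner point an even
  number of times (the frame of the rectangle may be met arbitrarily) is the set of edges separating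
  some set of faces from its complement. -/
  jordan : ∀ c : Set H, (∀ h, rev h ∈ c ↔ h ∈ c) →
    (∀ v, Even {h | h ∈ c ∧ src h = Sum.inl v}.ncard) →
    ∃ U : Set F, ∀ h, h ∈ c ↔ ¬ (face h ∈ U ↔ face (rev h) ∈ U)
  /-- Planarity, second half: one gets from every face to every other one by crossing edges. -/
  dual_connected : ∀ U : Set F, (∀ h, face h ∈ U ↔ face (rev h) ∈ U) → U = ∅ ∨ U = Set.univ

/-! ### Removing two half-edges from a rotation -/

/-- What is left of the half-edges after `a` and `b` are removed. -/
abbrev Cut {H : Type} (a b : H) : Type := {x : H // x ≠ a ∧ x ≠ b}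

open Classical in
/-- The first of `z`, `nx z`, `nx (nx z)` which differs from `a` and `b`. -/
def skipTwo {H : Type} (nx : H → H) (a b z : H) : H :=
  if z ≠ a ∧ z ≠ b then z else if nx z ≠ a ∧ nx z ≠ b then nx z else nx (nx z)

theorem skip_mem {H : Type} {nx : H → H} (inj : Function.Injective nx) (a b : H) {x : H}
    (hx : x ≠ a ∧ x ≠ b) : skipTwo nx a b (nx x) ≠ a ∧ skipTwo nx a b (nx x) ≠ b := by
  unfold skipTwo
  split_ifs with h1 h2
  · exact h1
  · exact h2
  · have e1 : nx (nx x) ≠ nx x := fun e => h1 (by rw [inj e]; exact hx)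
    have e2 : nx (nx (nx x)) ≠ nx (nx x) := fun e => e1 (inj e)
    have e3 : nx (nx (nx x)) ≠ nx x := fun e => h2 (by rw [inj e]; exact hx)
    by_contra hc
    have k1 : nx x = a ∨ nx x = b := by tauto
    have k2 : nx (nx x) = a ∨ nx (nx x) = b := by tauto
    have k3 : nx (nx (nx x)) = a ∨ nx (nx (nx x)) = b := by tauto
    rcases k1 with k1 | k1 <;> rcases k2 with k2 | k2 <;> rcases k3 with k3 | k3 <;>
      simp_all

/-- The rotation on the remaining half-edges. -/
def nextCut {H : Type} (nx : H → H) (inj : Function.Injective nx) (a b : H) (x : Cut a b) : Cut a b :=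
  ⟨skipTwo nx a b (nx x.1), skip_mem inj a b x.2⟩

theorem orbit_iff_closed {H P : Type} (nx : H → H) (s : H → P) :
    (∀ x y, s x = s y ↔ ∃ k : ℕ, nx^[k] x = y) ↔
      ((∀ x, s (nx x) = s x) ∧
        ∀ S : Set H, (∀ z ∈ S, nx z ∈ S) → ∀ x y, x ∈ S → s y = s x → y ∈ S) := by
  constructor
  · intro h
    refine ⟨fun x => ((h x (nx x)).2 ⟨1, rfl⟩).symm, fun S hS x y hx e => ?_⟩
    obtain ⟨k, rfl⟩ := (h x y).1 e.symm
    clear e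
    induction k with
    | zero => exact hx
    | succ k ih => rw [Function.iterate_succ_apply']; exact hS _ ih
  · rintro ⟨h1, h2⟩ x y
    constructor
    · intro e
      refine h2 {y | ∃ k : ℕ, nx^[k] x = y} ?_ x y ⟨0, rfl⟩ e.symm
      rintro z ⟨k, rfl⟩
      exact ⟨k + 1, Function.iterate_succ_apply' _ _ _⟩
    · rintro ⟨k, rfl⟩
      induction k with
      | zero => rfl
      | succ k ih => rw [Function.iterate_succ_apply', h1]; exact ih

theorem src_skip {H P : Type} {nx : H → H} {s : H → P} (h : ∀ x, s (nx x) = s x) (a b z : H) :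
    s (skipTwo nx a b z) = s z := by
  unfold skipTwo; split_ifs <;> simp [h]

theorem orbit_cut {H P : Type} (nx : H → H) (inj : Function.Injective nx) (a b : H) (s : H → P)
    (h : ∀ x y, s x = s y ↔ ∃ k : ℕ, nx^[k] x = y) (x y : Cut a b) :
    s x.1 = s y.1 ↔ ∃ k : ℕ, (nextCut nx inj a b)^[k] x = y := by
  obtain ⟨h1, h2⟩ := (orbit_iff_closed nx s).1 h
  refine (orbit_iff_closed (nextCut nx inj a b) (fun x => s x.1)).2 ⟨?_, ?_⟩ x y
  · intro x
    simp only [nextCut]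
    rw [src_skip h1, h1]
  · intro S hS x y hx e
    have key := h2 {z | ∃ u ∈ S, u.1 = skipTwo nx a b z} ?_ x.1 y.1 ⟨x, hx, ?_⟩ e
    · obtain ⟨u, hu, e⟩ := key
      have : skipTwo nx a b y.1 = y.1 := by unfold skipTwo; rw [if_pos y.2]
      rw [this] at e
      rwa [← Subtype.ext e]
    · rintro z ⟨u, hu, e⟩
      by_cases hz : z ≠ a ∧ z ≠ b
      · have : skipTwo nx a b z = z := by unfold skipTwo; rw [if_pos hz]
        exact ⟨_, hS _ hu, by simp only [nextCut]; rw [e, this]⟩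
      · refine ⟨u, hu, ?_⟩
        have hu2 := u.2
        rw [e] at hu2 ⊢
        unfold skipTwo at hu2 ⊢
        rw [if_neg hz] at hu2 ⊢
        by_cases h3 : nx z ≠ a ∧ nx z ≠ b
        · rw [if_pos h3, if_pos h3]
        · rw [if_neg h3] at hu2 ⊢
          rw [if_neg h3, if_pos hu2]
    · unfold skipTwo; rw [if_pos x.2]

namespace Drawing

variable {n : ℕ} (X : Drawing n)

attribute [instance] Drawing.finV Drawing.finH Drawing.finF

theorem src_next (x : X.H) : X.src (X.next x) = X.src x :=
  ((orbit_iff_closed X.next X.src).1 X.orbit).1 x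

theorem next_surj : Function.Surjective X.next := by
  intro y
  obtain ⟨k, hk⟩ := (X.orbit (X.next y) y).1 (X.src_next y)
  exact ⟨X.next^[k] y, by
    rw [← Function.iterate_succ_apply' X.next, Function.iterate_succ_apply, hk]⟩

theorem next_inj : Function.Injective X.next := Finite.injective_iff_surjective.2 X.next_surj

/-- `h` is a half of an inner edge: both ends are inner vertices. -/
def IsInner (h : X.H) : Prop :=
  ∃ v w, X.src h = Sum.inl v ∧ X.src (X.rev h) = Sum.inl w ∧ ¬ X.smooth v ∧ ¬ X.smooth w

/-- The edge of `h` is a loop. -/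
def IsLoop (h : X.H) : Prop := X.src h = X.src (X.rev h)

theorem rev_cut {h x : X.H} (hx : x ≠ h ∧ x ≠ X.rev h) : X.rev x ≠ h ∧ X.rev x ≠ X.rev h := by
  refine ⟨fun e => hx.2 ?_, fun e => hx.1 ?_⟩
  · rw [← e, X.rev_rev]
  · rw [← X.rev_rev x, e, X.rev_rev]

theorem ncard_cut {h : X.H} {p : X.H → Prop} (h1 : ¬ p h) (h2 : ¬ p (X.rev h)) :
    {x : Cut h (X.rev h) | p x.1}.ncard = {x | p x}.ncard := by
  rw [← Set.ncard_image_of_injective _ Subtype.val_injective]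
  congr 1
  ext x
  simp only [Set.mem_image, Set.mem_ofPred_eq, Subtype.exists, exists_and_left, exists_prop,
    exists_eq_right_right]
  constructor
  · exact fun hx => hx.1
  · exact fun hx => ⟨hx, fun e => h1 (e ▸ hx), fun e => h2 (e ▸ hx)⟩

/-- The face relation which merges the two sides of the edge of `h`. -/
abbrev Merged (h : X.H) : Type := Quot (fun f g : X.F => f = X.face h ∧ g = X.face (X.rev h))

theorem merged_eq (h : X.H) :
    (Quot.mk _ (X.face h) : X.Merged h) = Quot.mk _ (X.face (X.rev h)) := Quot.sound ⟨rfl, rfl⟩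

/-- Deletion of an inner edge: the faces on its two sides become one. -/
def delete (h : X.H) (hin : X.IsInner h) : Drawing n where
  V := X.V
  H := Cut h (X.rev h)
  F := X.Merged h
  finV := X.finV
  finH := inferInstance
  finF := inferInstance
  src x := X.src x.1
  rev x := ⟨X.rev x.1, X.rev_cut x.2⟩
  next := nextCut X.next X.next_inj h (X.rev h)
  face x := Quot.mk _ (X.face x.1)
  mark m := ⟨X.mark m, by
    obtain ⟨v, w, hv, hw, -⟩ := hin
    constructor <;> intro e
    · rw [← e, (X.src_mark _ m).2 rfl] at hv; cases hv
    · rw [← e, (X.src_mark _ m).2 rfl] at hw; cases hw⟩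
  gapT j := Quot.mk _ (X.gapT j)
  gapB j := Quot.mk _ (X.gapB j)
  inc v f := ∃ g, X.inc v g ∧ Quot.mk _ g = f
  smooth := X.smooth
  rev_rev x := Subtype.ext (X.rev_rev _)
  rev_ne x e := X.rev_ne x.1 (congrArg Subtype.val e)
  orbit := orbit_cut X.next X.next_inj h (X.rev h) X.src X.orbit
  src_mark x m := by rw [X.src_mark, Subtype.ext_iff]
  smooth_two v hv := by
    obtain ⟨a, b, ha, hb, ha', hb'⟩ := hin
    rw [X.ncard_cut (p := fun x => X.src x = Sum.inl v), X.smooth_two v hv]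
    · rw [ha]; rintro ⟨⟩; exact ha' hv
    · rw [hb]; rintro ⟨⟩; exact hb' hv
  corner x v hv := by
    have key : ∀ z, (Quot.mk _ (X.face (X.rev (skipTwo X.next h (X.rev h) (X.next z)))) : X.Merged h)
        = Quot.mk _ (X.face z) ∨ X.src z ≠ Sum.inl v := by
      intro z
      by_cases hz : X.src z = Sum.inl v
      · left
        have s1 := X.src_next z
        have s2 := X.src_next (X.next z)
        rw [hz] at s1
        rw [s1] at s2
        have c1 := X.corner _ _ hz
        have c2 := X.corner _ _ s1
        have c3 := X.corner _ _ s2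
        have m := X.merged_eq h
        have hr := X.rev_rev h
        unfold skipTwo
        split_ifs with h1 h2
        · rw [c1]
        · rw [c2, ← c1]
          have : X.next z = h ∨ X.next z = X.rev h := by tauto
          rcases this with e | e <;> rw [e]
          · exact m
          · rw [hr]; exact m.symm
        · have k1 : X.next z = h ∨ X.next z = X.rev h := by tauto
          have k2 : X.next (X.next z) = h ∨ X.next (X.next z) = X.rev h := by tauto
          rw [c3, ← c1]
          rcases k1 with e | e <;> rcases k2 with e' | e' <;> rw [e', e] <;>
            simp only [hr, m]
      · exact Or.inr hz
    exact (key x.1).resolve_right (fun hh => hh hv)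
  face_top i := congrArg _ (X.face_top i)
  face_rev_top i := congrArg _ (X.face_rev_top i)
  face_bot i := congrArg _ (X.face_bot i)
  face_rev_bot i := congrArg _ (X.face_rev_bot i)
  gap_left := congrArg _ X.gap_left
  gap_right := congrArg _ X.gap_right
  inc_iff x v hv f := by
    constructor
    · rintro ⟨g, hg, rfl⟩
      obtain ⟨y, hy, rfl⟩ := (X.inc_iff x.1 v hv g).1 hg
      have := ((orbit_iff_closed X.next X.src).1 X.orbit).2
        {z | X.src z = Sum.inl v ∧ ∃ u : Cut h (X.rev h), X.src u.1 = Sum.inl v ∧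
          (Quot.mk _ (X.face u.1) : X.Merged h) = Quot.mk _ (X.face z)} ?_ x.1 y
          ⟨hv, x, hv, rfl⟩ (hy.trans hv.symm)
      · exact this.2
      · rintro z ⟨hz, u, hu, e⟩
        have s1 := X.src_next z
        rw [hz] at s1
        have c1 := X.corner _ _ hz
        refine ⟨s1, ?_⟩
        by_cases hc : X.next z ≠ h ∧ X.next z ≠ X.rev h
        · exact ⟨⟨_, hc⟩, s1, rfl⟩
        · refine ⟨u, hu, ?_⟩
          rw [e, ← c1]
          have : X.next z = h ∨ X.next z = X.rev h := by tauto
          rcases this with e | e <;> rw [e]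
          · exact (X.merged_eq h).symm
          · rw [X.rev_rev]; exact X.merged_eq h
    · rintro ⟨y, hy, rfl⟩
      exact ⟨_, (X.inc_iff x.1 v hv _).2 ⟨y.1, hy, rfl⟩, rfl⟩
  inc_unique v hv := by
    by_cases hx : ∃ x, X.src x = Sum.inl v
    · obtain ⟨x, hx⟩ := hx
      refine ⟨Quot.mk _ (X.face x), ⟨_, (X.inc_iff x v hx _).2 ⟨x, hx, rfl⟩, rfl⟩, ?_⟩
      rintro _ ⟨g, hg, rfl⟩
      obtain ⟨y, hy, rfl⟩ := (X.inc_iff x v hx _).1 hg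
      have key : ∀ z, X.src z = Sum.inl v →
          (Quot.mk _ (X.face z) : X.Merged h) = Quot.mk _ (X.face h) := by
        intro z hz
        by_cases hc : z ≠ h ∧ z ≠ X.rev h
        · exact absurd hz (hv ⟨z, hc⟩)
        · have : z = h ∨ z = X.rev h := by tauto
          rcases this with e | e <;> rw [e]
          exact (X.merged_eq h).symm
      exact (key y hy).trans (key x hx).symm
    · obtain ⟨f, hf, hu⟩ := X.inc_unique v (fun x e => hx ⟨x, e⟩)
      refine ⟨Quot.mk _ f, ⟨f, hf, rfl⟩, ?_⟩
      rintro _ ⟨g, hg, rfl⟩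
      rw [hu g hg]
  jordan c hc hev := by
    have h1 : ∀ x, (∃ hx, (⟨X.rev x, hx⟩ : Cut h (X.rev h)) ∈ c) ↔
        ∃ hx, (⟨x, hx⟩ : Cut h (X.rev h)) ∈ c := by
      intro x
      constructor
      · rintro ⟨hx, hxc⟩
        have hx' := X.rev_cut hx
        rw [X.rev_rev] at hx'
        exact ⟨hx', (hc ⟨x, hx'⟩).1 hxc⟩
      · rintro ⟨hx, hxc⟩
        exact ⟨X.rev_cut hx, (hc ⟨x, hx⟩).2 hxc⟩
    have h2 : ∀ v, Even {x | (∃ hx, (⟨x, hx⟩ : Cut h (X.rev h)) ∈ c) ∧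
        X.src x = Sum.inl v}.ncard := by
      intro v
      have := hev v
      rw [← Set.ncard_image_of_injective _ Subtype.val_injective] at this
      convert this using 2
      ext x
      simp only [Set.mem_image, Set.mem_ofPred_eq, Subtype.exists, exists_and_right,
        exists_eq_right]
    obtain ⟨U, hU⟩ := X.jordan {x | ∃ hx, (⟨x, hx⟩ : Cut h (X.rev h)) ∈ c} h1 h2
    have hm : X.face h ∈ U ↔ X.face (X.rev h) ∈ U := by
      by_contra hcon
      obtain ⟨hx, -⟩ := (hU h).2 hcon
      exact hx.1 rfl
    refine ⟨{f | Quot.lift (fun g => g ∈ U) (fun f g hfg => ?_) f}, fun x => ?_⟩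
    · rw [hfg.1, hfg.2]; exact propext hm
    · exact Iff.trans ⟨fun hx => ⟨x.2, hx⟩, fun ⟨_, hx⟩ => hx⟩ (hU x.1)
  dual_connected U hU := by
    have := X.dual_connected {f | (Quot.mk _ f : X.Merged h) ∈ U} ?_
    · rcases this with h0 | h1
      · left
        ext f
        induction f using Quot.ind with
        | mk f => exact iff_of_false (fun hf => by
            have : f ∈ (∅ : Set X.F) := h0 ▸ hf
            exact this) (fun hf => hf)
      · right
        ext f
        induction f using Quot.ind with
        | mk f => exact iff_of_true (by
            have : f ∈ {f | (Quot.mk _ f : X.Merged h) ∈ U} := h1 ▸ Set.mem_univ f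
            exact this) trivial
    · intro x
      by_cases hx : x ≠ h ∧ x ≠ X.rev h
      · exact hU ⟨x, hx⟩
      · have : x = h ∨ x = X.rev h := by tauto
        have m := X.merged_eq h
        rcases this with e | e <;> subst e <;> simp only [Set.mem_ofPred_eq, X.rev_rev, m]

/-! ### Contraction -/

/-- The points, with the two ends of the edge of `h` made equal. -/
abbrev Glued (h : X.H) : Type :=
  Quot (fun a b : X.V => X.src h = Sum.inl a ∧ X.src (X.rev h) = Sum.inl b)

/-- The starting point of a half-edge after the two ends of the edge of `h` are made equal. -/
def gluedSrc (h x : X.H) : X.Glued h ⊕ Mark n := Sum.map (Quot.mk _) id (X.src x)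

theorem glued_eq {h : X.H} {v w : X.V} (hv : X.src h = Sum.inl v)
    (hw : X.src (X.rev h) = Sum.inl w) (a b : X.V) :
    (Quot.mk _ a : X.Glued h) = Quot.mk _ b ↔ a = b ∨ (a = v ∧ b = w) ∨ (a = w ∧ b = v) := by
  classical
  constructor
  · intro e
    have := congrArg (Quot.lift (fun u => if u = w then v else u) (fun a b hab => by
      have ea : v = a := Sum.inl_injective (hv.symm.trans hab.1)
      have eb : w = b := Sum.inl_injective (hw.symm.trans hab.2)
      subst ea; subst eb
      simp)) e
    simp only at this
    split_ifs at this with h1 h2 h2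
    · exact Or.inl (h1.trans h2.symm)
    · exact Or.inr (Or.inr ⟨h1, this.symm⟩)
    · exact Or.inr (Or.inl ⟨this, h2⟩)
    · exact Or.inl this
  · rintro (rfl | ⟨rfl, rfl⟩ | ⟨rfl, rfl⟩)
    · rfl
    · exact Quot.sound ⟨hv, hw⟩
    · exact (Quot.sound ⟨hv, hw⟩).symm

theorem gluedSrc_eq {h : X.H} (hin : X.IsInner h) (x y : X.H) :
    X.gluedSrc h x = X.gluedSrc h y ↔ X.src x = X.src y ∨
      (X.src x = X.src h ∧ X.src y = X.src (X.rev h)) ∨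
      (X.src x = X.src (X.rev h) ∧ X.src y = X.src h) := by
  obtain ⟨v, w, hv, hw, -⟩ := hin
  have key : ∀ p q : X.V ⊕ Mark n, (Sum.map (Quot.mk _) id p : X.Glued h ⊕ Mark n) =
      Sum.map (Quot.mk _) id q ↔ p = q ∨ (p = Sum.inl v ∧ q = Sum.inl w) ∨
        (p = Sum.inl w ∧ q = Sum.inl v) := by
    rintro (a | a) (b | b)
    · simp only [Sum.map_inl, Sum.inl.injEq, X.glued_eq hv hw]
    all_goals simp
  have := key (X.src x) (X.src y)
  rwa [← hv, ← hw] at this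

theorem gluedSrc_inl {h x : X.H} {q : X.Glued h} (e : X.gluedSrc h x = Sum.inl q) :
    ∃ u, X.src x = Sum.inl u ∧ Quot.mk _ u = q := by
  unfold gluedSrc at e
  rcases hx : X.src x with a | a <;> rw [hx] at e
  · exact ⟨a, rfl, Sum.inl_injective e⟩
  · cases e

theorem gluedSrc_of {h x : X.H} {u : X.V} (e : X.src x = Sum.inl u) :
    X.gluedSrc h x = Sum.inl (Quot.mk _ u) := by
  unfold gluedSrc; rw [e]; rfl

open Classical in
/-- The rotation in which the cycles of `h` and `rev h` are joined to one cycle. -/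
def turn (h z : X.H) : X.H :=
  if z = h then X.next (X.rev h) else if z = X.rev h then X.next h else X.next z

theorem turn_left (h : X.H) : X.turn h h = X.next (X.rev h) := if_pos rfl

theorem turn_right (h : X.H) : X.turn h (X.rev h) = X.next h := by
  unfold turn; rw [if_neg (X.rev_ne h), if_pos rfl]

theorem turn_of_ne {h z : X.H} (h1 : z ≠ h) (h2 : z ≠ X.rev h) : X.turn h z = X.next z := by
  unfold turn; rw [if_neg h1, if_neg h2]

theorem turn_inj (h : X.H) : Function.Injective (X.turn h) := by
  intro x y e
  have hr := X.rev_ne h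
  unfold turn at e
  split_ifs at e <;> have := X.next_inj e <;> grind

theorem turn_orbit {h : X.H} (hin : X.IsInner h) (hl : ¬ X.IsLoop h) (x y : X.H) :
    X.gluedSrc h x = X.gluedSrc h y ↔ ∃ k : ℕ, (X.turn h)^[k] x = y := by
  revert x y
  rw [orbit_iff_closed]
  obtain ⟨-, h2⟩ := (orbit_iff_closed X.next X.src).1 X.orbit
  constructor
  · intro x
    rw [X.gluedSrc_eq hin]
    by_cases e1 : x = h
    · subst e1; rw [X.turn_left, X.src_next]; exact Or.inr (Or.inr ⟨rfl, rfl⟩)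
    · by_cases e2 : x = X.rev h
      · subst e2; rw [X.turn_right, X.src_next]; exact Or.inr (Or.inl ⟨rfl, rfl⟩)
      · rw [X.turn_of_ne e1 e2, X.src_next]; exact Or.inl rfl
  · intro S hS x y hx e
    by_cases hno : h ∈ S ∨ X.rev h ∈ S
    · have hw : ∀ z ∈ S, X.src z = X.src (X.rev h) → X.rev h ∈ S := by
        intro z hz ez
        by_contra hcon
        refine hcon (h2 {z | z ∈ S ∧ X.src z = X.src (X.rev h)} ?_ z (X.rev h) ⟨hz, ez⟩ ez.symm).1
        rintro t ⟨ht, et⟩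
        have := hS t ht
        have n1 : t ≠ h := fun e => hl (by rw [e] at et; exact et)
        have n2 : t ≠ X.rev h := fun e => hcon (e ▸ ht)
        rw [X.turn_of_ne n1 n2] at this
        exact ⟨this, by rw [X.src_next]; exact et⟩
      have hv : ∀ z ∈ S, X.src z = X.src h → h ∈ S := by
        intro z hz ez
        by_contra hcon
        refine hcon (h2 {z | z ∈ S ∧ X.src z = X.src h} ?_ z h ⟨hz, ez⟩ ez.symm).1
        rintro t ⟨ht, et⟩
        have := hS t ht
        have n1 : t ≠ h := fun e => hcon (e ▸ ht)
        have n2 : t ≠ X.rev h := fun e => hl (by rw [e] at et; exact et.symm)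
        rw [X.turn_of_ne n1 n2] at this
        exact ⟨this, by rw [X.src_next]; exact et⟩
      have both : h ∈ S ∧ X.rev h ∈ S := by
        rcases hno with h0 | h0
        · refine ⟨h0, hw _ (hS _ h0) ?_⟩
          rw [X.turn_left, X.src_next]
        · refine ⟨hv _ (hS _ h0) ?_, h0⟩
          rw [X.turn_right, X.src_next]
      have cl : ∀ z ∈ S, X.next z ∈ S := by
        intro z hz
        by_cases e1 : z = h
        · rw [e1, ← X.turn_right]; exact hS _ both.2
        · by_cases e2 : z = X.rev h
          · rw [e2, ← X.turn_left]; exact hS _ both.1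
          · rw [← X.turn_of_ne e1 e2]; exact hS _ hz
      rcases (X.gluedSrc_eq hin _ _).1 e with e | ⟨e, -⟩ | ⟨e, -⟩
      · exact h2 S cl x y hx e
      · exact h2 S cl h y both.1 e
      · exact h2 S cl (X.rev h) y both.2 e
    · push Not at hno
      have cl : ∀ z ∈ S, X.next z ∈ S := by
        intro z hz
        have n1 : z ≠ h := fun e => hno.1 (e ▸ hz)
        have n2 : z ≠ X.rev h := fun e => hno.2 (e ▸ hz)
        rw [← X.turn_of_ne n1 n2]
        exact hS _ hz
      rcases (X.gluedSrc_eq hin _ _).1 e with e | ⟨-, e⟩ | ⟨-, e⟩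
      · exact h2 S cl x y hx e
      · exact absurd (h2 S cl x (X.rev h) hx e.symm) hno.2
      · exact absurd (h2 S cl x h hx e.symm) hno.1

/-- If `rev h` is the only half-edge at its point, then the edge of `h` has the same face on both
sides. -/
theorem face_of_fixed {h : X.H} (hin : X.IsInner h) (e : X.next (X.rev h) = X.rev h) :
    X.face h = X.face (X.rev h) := by
  obtain ⟨v, w, hv, hw, -⟩ := hin
  have := X.corner _ _ hw
  rwa [e, X.rev_rev] at this

theorem isInner_rev {h : X.H} (hin : X.IsInner h) : X.IsInner (X.rev h) := by
  obtain ⟨v, w, hv, hw, h1, h2⟩ := hin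
  exact ⟨w, v, hw, by rw [X.rev_rev]; exact hv, h2, h1⟩

theorem turn_corner_aux {h : X.H} (hin : X.IsInner h) (hl : ¬ X.IsLoop h) {x : X.H}
    (ex : X.next x = h) : X.face (X.rev (skipTwo (X.turn h) h (X.rev h) h)) = X.face x := by
  obtain ⟨v, w, hv, hw, -⟩ := id hin
  have sx : X.src x = Sum.inl v := by rw [← hv, ← ex, X.src_next]
  have c1 := X.corner _ _ sx
  rw [ex] at c1
  rw [← c1]
  have n1 : X.next (X.rev h) ≠ h := fun e => hl (by
    unfold IsLoop; rw [← X.src_next (X.rev h), e])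
  unfold skipTwo
  rw [if_neg (by simp), X.turn_left]
  split_ifs with h1
  · exact X.corner _ _ hw
  · have e : X.next (X.rev h) = X.rev h := by tauto
    rw [e, X.turn_right, X.corner _ _ hv]
    exact X.face_of_fixed hin e

theorem skip_swap {H : Type} (nx : H → H) (a b z : H) : skipTwo nx a b z = skipTwo nx b a z := by
  unfold skipTwo
  grind

theorem turn_swap (h : X.H) : X.turn (X.rev h) = X.turn h := by
  funext z
  unfold turn
  rw [X.rev_rev]
  have hr := X.rev_ne h
  grind

theorem turn_corner {h : X.H} (hin : X.IsInner h) (hl : ¬ X.IsLoop h) {x : X.H} {v : X.V}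
    (hx : x ≠ h ∧ x ≠ X.rev h) (hv : X.src x = Sum.inl v) :
    X.face (X.rev (skipTwo (X.turn h) h (X.rev h) (X.turn h x))) = X.face x := by
  rw [X.turn_of_ne hx.1 hx.2]
  by_cases e1 : X.next x = h
  · rw [e1]; exact X.turn_corner_aux hin hl e1
  · by_cases e2 : X.next x = X.rev h
    · have := X.turn_corner_aux (X.isInner_rev hin)
        (fun e => hl (by unfold IsLoop at e ⊢; rw [X.rev_rev] at e; exact e.symm)) e2
      rw [X.rev_rev, X.turn_swap, skip_swap] at this
      rw [e2]; exact this
    · have : skipTwo (X.turn h) h (X.rev h) (X.next x) = X.next x := by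
        unfold skipTwo; rw [if_pos ⟨e1, e2⟩]
      rw [this]; exact X.corner _ _ hv

/-- If some other half-edge starts at an end of the edge of `h`, then the face of `h` still occurs
after contraction. -/
theorem face_survives {h : X.H} (hin : X.IsInner h) (hl : ¬ X.IsLoop h) {x : X.H}
    (hx : x ≠ h ∧ x ≠ X.rev h) (sx : X.src x = X.src h ∨ X.src x = X.src (X.rev h)) :
    ∃ y : X.H, (y ≠ h ∧ y ≠ X.rev h) ∧ (X.src y = X.src h ∨ X.src y = X.src (X.rev h)) ∧
      X.face y = X.face h := by
  obtain ⟨v, w, hv, hw, -⟩ := id hin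
  obtain ⟨p, hp⟩ := X.next_surj (X.rev h)
  have sp : X.src p = X.src (X.rev h) := by rw [← hp, X.src_next]
  have cp := X.corner p w (sp.trans hw)
  rw [hp, X.rev_rev] at cp
  have np : p ≠ h := fun e => hl (by rw [e] at sp; exact sp)
  by_cases e : p = X.rev h
  · rw [e] at hp cp
    obtain ⟨q, hq⟩ := X.next_surj h
    have sq : X.src q = X.src h := by rw [← hq, X.src_next]
    have cq := X.corner q v (sq.trans hv)
    rw [hq] at cq
    refine ⟨q, ⟨fun e => ?_, fun e => hl (by rw [e] at sq; exact sq.symm)⟩, Or.inl sq,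
      cq.symm.trans cp.symm⟩
    have hfix : X.next h = h := by rw [e] at hq; exact hq
    have only : ∀ t z, X.next t = t → X.src z = X.src t → z = t := fun t z ht hz =>
      ((orbit_iff_closed X.next X.src).1 X.orbit).2 {t} (by rintro _ rfl; exact ht) t z rfl hz
    rcases sx with s | s
    · exact hx.1 (only h x hfix s)
    · exact hx.2 (only _ x hp s)
  · exact ⟨p, ⟨np, e⟩, Or.inr sp, cp.symm⟩

/-- Contraction of an inner edge which is not a loop: its two ends become one vertex, the rotations
at the ends are spliced at the edge, and the faces stay. -/
def contract (h : X.H) (hin : X.IsInner h) (hl : ¬ X.IsLoop h) : Drawing n where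
  V := X.Glued h
  H := Cut h (X.rev h)
  F := X.F
  finV := inferInstance
  finH := inferInstance
  finF := X.finF
  src x := X.gluedSrc h x.1
  rev x := ⟨X.rev x.1, X.rev_cut x.2⟩
  next := nextCut (X.turn h) (X.turn_inj h) h (X.rev h)
  face x := X.face x.1
  mark m := ⟨X.mark m, by
    obtain ⟨v, w, hv, hw, -⟩ := hin
    constructor <;> intro e
    · rw [← e, (X.src_mark _ m).2 rfl] at hv; cases hv
    · rw [← e, (X.src_mark _ m).2 rfl] at hw; cases hw⟩
  gapT := X.gapT
  gapB := X.gapB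
  inc q f := ∃ v, Quot.mk _ v = q ∧ X.inc v f
  smooth q := ∃ v, Quot.mk _ v = q ∧ X.smooth v
  rev_rev x := Subtype.ext (X.rev_rev _)
  rev_ne x e := X.rev_ne x.1 (congrArg Subtype.val e)
  orbit := orbit_cut (X.turn h) (X.turn_inj h) h (X.rev h) (X.gluedSrc h) (X.turn_orbit hin hl)
  src_mark x m := by
    rw [Subtype.ext_iff, ← X.src_mark]
    unfold gluedSrc
    rcases X.src x.1 with a | a <;> simp
  smooth_two := by
    rintro _ ⟨u, rfl, hu⟩
    obtain ⟨v, w, hv, hw, nv, nw⟩ := id hin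
    have h1 : u ≠ v := fun e => nv (e ▸ hu)
    have h2 : u ≠ w := fun e => nw (e ▸ hu)
    have key : ∀ x, X.gluedSrc h x = Sum.inl (Quot.mk _ u) ↔ X.src x = Sum.inl u := by
      intro x
      refine ⟨fun e => ?_, X.gluedSrc_of⟩
      obtain ⟨t, ht, e⟩ := X.gluedSrc_inl e
      rw [X.glued_eq hv hw] at e
      rw [ht]
      grind
    simp only [key]
    rw [X.ncard_cut (p := fun x => X.src x = Sum.inl u), X.smooth_two u hu]
    · rw [hv]; rintro ⟨⟩; exact h1 rfl
    · rw [hw]; rintro ⟨⟩; exact h2 rfl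
  corner x q hq := by
    obtain ⟨u, hu, -⟩ := X.gluedSrc_inl hq
    exact X.turn_corner hin hl x.2 hu
  face_top i := X.face_top i
  face_rev_top i := X.face_rev_top i
  face_bot i := X.face_bot i
  face_rev_bot i := X.face_rev_bot i
  gap_left := X.gap_left
  gap_right := X.gap_right
  inc_iff x q hq f := by
    obtain ⟨v, w, hv, hw, -⟩ := id hin
    have down : ∀ y : X.H, ∀ u, X.src y = Sum.inl u → Quot.mk _ u = q →
        ∃ h' : Cut h (X.rev h), X.gluedSrc h h'.1 = Sum.inl q ∧ X.face h'.1 = X.face y := by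
      intro y u hy hu
      have hyq : X.gluedSrc h y = Sum.inl q := by rw [X.gluedSrc_of hy, hu]
      by_cases hc : y ≠ h ∧ y ≠ X.rev h
      · exact ⟨⟨y, hc⟩, hyq, rfl⟩
      · have hy' : y = h ∨ y = X.rev h := by tauto
        have hs : X.gluedSrc h x.1 = X.gluedSrc h y := hq.trans hyq.symm
        have hglue : X.gluedSrc h (X.rev h) = X.gluedSrc h h :=
          (X.gluedSrc_eq hin _ _).2 (Or.inr (Or.inr ⟨rfl, rfl⟩))
        have hh : X.gluedSrc h h = Sum.inl q := by
          rcases hy' with e | e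
          · rw [e] at hyq; exact hyq
          · rw [e] at hyq; exact hglue.symm.trans hyq
        have sx : X.src x.1 = X.src h ∨ X.src x.1 = X.src (X.rev h) := by
          rcases (X.gluedSrc_eq hin x.1 h).1 (hq.trans hh.symm) with e | ⟨e, -⟩ | ⟨e, -⟩
          · exact Or.inl e
          · exact Or.inl e
          · exact Or.inr e
        have fin : ∀ z : X.H, (X.src z = X.src h ∨ X.src z = X.src (X.rev h)) →
            X.gluedSrc h z = Sum.inl q := by
          intro z hz
          rw [← hh, X.gluedSrc_eq hin]
          rcases hz with e | e
          · exact Or.inl e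
          · exact Or.inr (Or.inr ⟨e, rfl⟩)
        rcases hy' with rfl | rfl
        · obtain ⟨z, hz, sz, fz⟩ := X.face_survives hin hl x.2 sx
          exact ⟨⟨z, hz⟩, fin z sz, fz⟩
        · obtain ⟨z, hz, sz, fz⟩ := X.face_survives (X.isInner_rev hin)
            (fun e => hl (by unfold IsLoop at e ⊢; rw [X.rev_rev] at e; exact e.symm))
            (x := x.1) (by rw [X.rev_rev]; exact x.2.symm) (by rw [X.rev_rev]; exact sx.symm)
          rw [X.rev_rev] at hz sz
          exact ⟨⟨z, hz.symm⟩, fin z sz.symm, fz⟩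
    constructor
    · rintro ⟨u, hu, hf⟩
      by_cases hy : ∃ y, X.src y = Sum.inl u
      · obtain ⟨y, hy⟩ := hy
        obtain ⟨z, hz, rfl⟩ := (X.inc_iff y u hy f).1 hf
        exact down z u hz hu
      · exfalso
        obtain ⟨t, ht, e⟩ := X.gluedSrc_inl hq
        rw [← hu, X.glued_eq hv hw] at e
        rcases e with rfl | ⟨-, rfl⟩ | ⟨-, rfl⟩
        · exact hy ⟨_, ht⟩
        · exact hy ⟨_, hw⟩
        · exact hy ⟨_, hv⟩
    · rintro ⟨y, hy, rfl⟩
      obtain ⟨t, ht, e⟩ := X.gluedSrc_inl hy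
      exact ⟨t, e, (X.inc_iff y.1 t ht _).2 ⟨_, ht, rfl⟩⟩
  inc_unique q hq := by
    obtain ⟨v, w, hv, hw, -⟩ := id hin
    have hvw : (Quot.mk _ v : X.Glued h) = Quot.mk _ w := Quot.sound ⟨hv, hw⟩
    induction q using Quot.ind with
    | mk u =>
      by_cases hu : (Quot.mk _ u : X.Glued h) = Quot.mk _ v
      · have only : ∀ z t, X.src z = Sum.inl t → (Quot.mk _ t : X.Glued h) = Quot.mk _ u →
            z = h ∨ z = X.rev h := by
          intro z t hz ht
          by_contra hc
          refine hq ⟨z, by tauto⟩ ?_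
          change X.gluedSrc h z = _
          rw [X.gluedSrc_of hz, ht]
        have hfix : X.next (X.rev h) = X.rev h := by
          rcases only (X.next (X.rev h)) w (by rw [X.src_next, hw]) (hvw.symm.trans hu.symm) with e | e
          · exact absurd (by unfold IsLoop; rw [← X.src_next (X.rev h), e]) hl
          · exact e
        have hff := X.face_of_fixed hin hfix
        refine ⟨X.face h, ⟨v, hu.symm, (X.inc_iff h v hv _).2 ⟨h, hv, rfl⟩⟩, ?_⟩
        rintro f ⟨t, ht, hf⟩
        have hy : ∃ y, X.src y = Sum.inl t := by
          rcases (X.glued_eq hv hw t v).1 (ht.trans hu) with rfl | ⟨rfl, -⟩ | ⟨rfl, -⟩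
          · exact ⟨_, hv⟩
          · exact ⟨_, hv⟩
          · exact ⟨_, hw⟩
        obtain ⟨y, hy⟩ := hy
        obtain ⟨z, hz, rfl⟩ := (X.inc_iff y t hy f).1 hf
        rcases only z t hz ht with rfl | rfl
        · rfl
        · exact hff.symm
      · have single : ∀ t, (Quot.mk _ t : X.Glued h) = Quot.mk _ u → t = u := by
          intro t ht
          rcases (X.glued_eq hv hw t u).1 ht with e | ⟨rfl, -⟩ | ⟨rfl, -⟩
          · exact e
          · exact absurd ht.symm hu
          · exact absurd (ht.symm.trans hvw.symm) hu
        obtain ⟨f, hf, uq⟩ := X.inc_unique u (fun x hx => by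
          have hc : x ≠ h ∧ x ≠ X.rev h := by
            constructor <;> rintro rfl
            · exact hu (by rw [Sum.inl_injective (hx.symm.trans hv)])
            · exact hu (by rw [Sum.inl_injective (hx.symm.trans hw), hvw])
          exact hq ⟨x, hc⟩ (X.gluedSrc_of hx))
        refine ⟨f, ⟨u, rfl, hf⟩, ?_⟩
        rintro g ⟨t, ht, hg⟩
        rw [single t ht] at hg
        exact uq g hg
  jordan c hc hev := by
    obtain ⟨v, w, hv, hw, -⟩ := id hin
    have hvw : v ≠ w := fun e => hl (by unfold IsLoop; rw [hv, hw, e])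
    have hr := X.rev_ne h
    -- the part of the given set at an old point
    let O : X.V → Set X.H := fun u => {x | (∃ hx, (⟨x, hx⟩ : Cut h (X.rev h)) ∈ c) ∧
      X.src x = Sum.inl u}
    have hO : ∀ q : X.Glued h, {x : Cut h (X.rev h) | x ∈ c ∧ X.gluedSrc h x.1 = Sum.inl q}.ncard =
        {x | (∃ hx, (⟨x, hx⟩ : Cut h (X.rev h)) ∈ c) ∧ X.gluedSrc h x = Sum.inl q}.ncard := by
      intro q
      rw [← Set.ncard_image_of_injective _ Subtype.val_injective]
      congr 1
      ext x
      simp only [Set.mem_image, Set.mem_ofPred_eq, Subtype.exists, exists_and_right,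
        exists_eq_right]
    have even_sum : Even ((O v).ncard + (O w).ncard) := by
      rw [← Set.ncard_union_eq]
      · have := hev (Quot.mk _ v)
        change Even {x : Cut h (X.rev h) | x ∈ c ∧ X.gluedSrc h x.1 = _}.ncard at this
        rw [hO] at this
        convert this using 2
        ext x
        simp only [O, Set.mem_union, Set.mem_ofPred_eq]
        rw [← and_or_left]
        refine and_congr_right fun _ => ⟨?_, fun e => ?_⟩
        · rintro (e | e)
          · exact X.gluedSrc_of e
          · rw [X.gluedSrc_of e, (Quot.sound ⟨hv, hw⟩ : (Quot.mk _ v : X.Glued h) = Quot.mk _ w)]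
        · obtain ⟨t, ht, e⟩ := X.gluedSrc_inl e
          rcases (X.glued_eq hv hw t v).1 e with rfl | ⟨rfl, -⟩ | ⟨rfl, -⟩
          · exact Or.inl ht
          · exact Or.inl ht
          · exact Or.inr ht
      · rw [Set.disjoint_left]
        rintro x ⟨-, e1⟩ ⟨-, e2⟩
        exact hvw (Sum.inl_injective (e1.symm.trans e2))
    have even_other : ∀ u, u ≠ v → u ≠ w → Even (O u).ncard := by
      intro u h1 h2
      have := hev (Quot.mk _ u)
      change Even {x : Cut h (X.rev h) | x ∈ c ∧ X.gluedSrc h x.1 = _}.ncard at this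
      rw [hO] at this
      convert this using 2
      ext x
      simp only [O, Set.mem_ofPred_eq]
      refine and_congr_right fun _ => ⟨fun e => X.gluedSrc_of e, fun e => ?_⟩
      obtain ⟨t, ht, e⟩ := X.gluedSrc_inl e
      rw [X.glued_eq hv hw] at e
      rw [ht]
      grind
    let c' : Set X.H := {x | (∃ hx, (⟨x, hx⟩ : Cut h (X.rev h)) ∈ c) ∨
      (¬ Even (O v).ncard ∧ (x = h ∨ x = X.rev h))}
    have h1 : ∀ x, X.rev x ∈ c' ↔ x ∈ c' := by
      intro x
      refine or_congr ?_ (and_congr_right fun _ => ?_)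
      · constructor
        · rintro ⟨hx, hxc⟩
          have hx' := X.rev_cut hx
          rw [X.rev_rev] at hx'
          exact ⟨hx', (hc ⟨x, hx'⟩).1 hxc⟩
        · rintro ⟨hx, hxc⟩
          exact ⟨X.rev_cut hx, (hc ⟨x, hx⟩).2 hxc⟩
      · have r := X.rev_rev
        constructor
        · rintro (e | e)
          · exact Or.inr (by rw [← e, r])
          · exact Or.inl (by rw [← r x, e, r])
        · rintro (e | e)
          · exact Or.inr (by rw [e])
          · exact Or.inl (by rw [e, r])
    have notO : ∀ u, h ∉ O u ∧ X.rev h ∉ O u := by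
      intro u
      exact ⟨fun ⟨⟨hx, _⟩, _⟩ => hx.1 rfl, fun ⟨⟨hx, _⟩, _⟩ => hx.2 rfl⟩
    have h2 : ∀ u, Even {x | x ∈ c' ∧ X.src x = Sum.inl u}.ncard := by
      intro u
      by_cases ho : Even (O v).ncard
      · have e : {x | x ∈ c' ∧ X.src x = Sum.inl u} = O u := by
          ext x; simp [c', O, ho]
        rw [e]
        by_cases e1 : u = v
        · rw [e1]; exact ho
        · by_cases e2 : u = w
          · rw [e2]; exact (Nat.even_add.1 even_sum).1 ho
          · exact even_other u e1 e2
      · by_cases e1 : u = v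
        · have e : {x | x ∈ c' ∧ X.src x = Sum.inl u} = insert h (O v) := by
            subst e1
            ext x
            simp only [c', O, ho, Set.mem_ofPred_eq, Set.mem_insert_iff]
            constructor
            · rintro ⟨a | ⟨-, a | a⟩, b⟩
              · exact Or.inr ⟨a, b⟩
              · exact Or.inl a
              · rw [a, hw] at b; exact absurd (Sum.inl_injective b).symm hvw
            · rintro (a | ⟨a, b⟩)
              · exact ⟨Or.inr ⟨not_false, Or.inl a⟩, by rw [a, hv]⟩
              · exact ⟨Or.inl a, b⟩
          rw [e, Set.ncard_insert_of_notMem (notO v).1, Nat.even_add_one]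
          exact ho
        · by_cases e2 : u = w
          · have e : {x | x ∈ c' ∧ X.src x = Sum.inl u} = insert (X.rev h) (O w) := by
              subst e2
              ext x
              simp only [c', O, ho, Set.mem_ofPred_eq, Set.mem_insert_iff]
              constructor
              · rintro ⟨a | ⟨-, a | a⟩, b⟩
                · exact Or.inr ⟨a, b⟩
                · rw [a, hv] at b; exact absurd (Sum.inl_injective b) hvw
                · exact Or.inl a
              · rintro (a | ⟨a, b⟩)
                · exact ⟨Or.inr ⟨not_false, Or.inr a⟩, by rw [a, hw]⟩
                · exact ⟨Or.inl a, b⟩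
            rw [e, Set.ncard_insert_of_notMem (notO w).2, Nat.even_add_one]
            exact fun hcon => ho ((Nat.even_add.1 even_sum).2 hcon)
          · have e : {x | x ∈ c' ∧ X.src x = Sum.inl u} = O u := by
              ext x
              simp only [c', O, Set.mem_ofPred_eq]
              refine and_congr_left fun b => ⟨?_, Or.inl⟩
              rintro (a | ⟨-, a | a⟩)
              · exact a
              · rw [a, hv] at b; exact absurd (Sum.inl_injective b).symm e1
              · rw [a, hw] at b; exact absurd (Sum.inl_injective b).symm e2
            rw [e]
            exact even_other u e1 e2
    obtain ⟨U, hU⟩ := X.jordan c' h1 h2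
    refine ⟨U, fun x => Iff.trans ?_ (hU x.1)⟩
    constructor
    · exact fun hx => Or.inl ⟨x.2, hx⟩
    · rintro (⟨_, hx⟩ | ⟨-, e | e⟩)
      · exact hx
      · exact absurd e x.2.1
      · exact absurd e x.2.2
  dual_connected U hU := by
    obtain ⟨v, w, hv, hw, -⟩ := id hin
    have hh : X.face h ∈ U ↔ X.face (X.rev h) ∈ U := by
      obtain ⟨p, hp⟩ := X.next_surj h
      have sp : X.src p = X.src h := by rw [← hp, X.src_next]
      have cp := X.corner p v (sp.trans hv)
      rw [hp] at cp
      have := (((orbit_iff_closed X.next X.src).1 X.orbit).2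
        {z | X.src z = X.src h ∧ (X.face z ∈ U ↔ X.face h ∈ U)} ?_ h p ⟨rfl, Iff.rfl⟩ sp).2
      · rw [← this, cp]
      · rintro z ⟨sz, hz⟩
        have sn : X.src (X.next z) = X.src h := by rw [X.src_next, sz]
        refine ⟨sn, ?_⟩
        by_cases e : X.next z = h
        · rw [e]
        · have := hU ⟨X.next z, e, fun e' => hl (by rw [e'] at sn; exact sn.symm)⟩
          change X.face (X.next z) ∈ U ↔ X.face (X.rev (X.next z)) ∈ U at this
          rw [this, X.corner z v (sz.trans hv), hz]
    refine X.dual_connected U fun x => ?_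
    by_cases hx : x ≠ h ∧ x ≠ X.rev h
    · exact hU ⟨x, hx⟩
    · have : x = h ∨ x = X.rev h := by tauto
      rcases this with e | e <;> rw [e]
      · exact hh
      · rw [X.rev_rev]; exact hh.symm

/-! ### Stacking -/

/-- Where a point of the upper drawing lies in the stacked drawing: its bottom marked points become
interior points. -/
def upper {n : ℕ} {A B : Type} : A ⊕ Mark n → ((A ⊕ B) ⊕ Fin n) ⊕ Mark n
  | Sum.inl v => Sum.inl (Sum.inl (Sum.inl v))
  | Sum.inr (Mark.top i) => Sum.inr (Mark.top i)
  | Sum.inr (Mark.bot i) => Sum.inl (Sum.inr i)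

/-- Where a point of the lower drawing lies in the stacked drawing: its top marked points become
interior points. -/
def lower {n : ℕ} {A B : Type} : B ⊕ Mark n → ((A ⊕ B) ⊕ Fin n) ⊕ Mark n
  | Sum.inl v => Sum.inl (Sum.inl (Sum.inr v))
  | Sum.inr (Mark.top i) => Sum.inl (Sum.inr i)
  | Sum.inr (Mark.bot i) => Sum.inr (Mark.bot i)

variable (Y : Drawing n)

/-- The faces of the stacked drawing: a face along the bottom of the upper rectangle is united with
the corresponding one along the top of the lower rectangle. -/
abbrev StackFace : Type :=
  Quot (fun f g : X.F ⊕ Y.F => ∃ j, f = Sum.inl (X.gapB j) ∧ g = Sum.inr (Y.gapT j))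

/-- The starting points of half-edges in the stacked drawing. -/
def stackSrc : X.H ⊕ Y.H → ((X.V ⊕ Y.V) ⊕ Fin n) ⊕ Mark n
  | Sum.inl x => upper (X.src x)
  | Sum.inr y => lower (Y.src y)

/-- The rotation in the stacked drawing: where a bottom marked point of `X` meets the corresponding
top marked point of `Y`, the two half-edges follow each other. -/
def stackNext : X.H ⊕ Y.H → X.H ⊕ Y.H
  | Sum.inl x => match X.src x with
    | Sum.inr (Mark.bot i) => Sum.inr (Y.mark (Mark.top i))
    | _ => Sum.inl (X.next x)
  | Sum.inr y => match Y.src y with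
    | Sum.inr (Mark.top i) => Sum.inl (X.mark (Mark.bot i))
    | _ => Sum.inr (Y.next y)

/-- The face to the left of a half-edge in the stacked drawing. -/
def stackFace : X.H ⊕ Y.H → X.StackFace Y
  | Sum.inl x => Quot.mk _ (Sum.inl (X.face x))
  | Sum.inr y => Quot.mk _ (Sum.inr (Y.face y))

/-- The marked points of the stacked drawing. -/
def stackMark : Mark n → X.H ⊕ Y.H
  | Mark.top i => Sum.inl (X.mark (Mark.top i))
  | Mark.bot i => Sum.inr (Y.mark (Mark.bot i))

/-- Incidence of points and faces in the stacked drawing. -/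
def stackInc : (X.V ⊕ Y.V) ⊕ Fin n → X.StackFace Y → Prop
  | Sum.inl (Sum.inl v), f => ∃ g, X.inc v g ∧ Quot.mk _ (Sum.inl g) = f
  | Sum.inl (Sum.inr v), f => ∃ g, Y.inc v g ∧ Quot.mk _ (Sum.inr g) = f
  | Sum.inr i, f => Quot.mk _ (Sum.inl (X.gapB i.castSucc)) = f ∨
      Quot.mk _ (Sum.inl (X.gapB i.succ)) = f

/-- Smooth points of the stacked drawing; the points on the common side of the two rectangles, where
edges have been connected, are smooth. -/
def stackSmooth : (X.V ⊕ Y.V) ⊕ Fin n → Prop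
  | Sum.inl (Sum.inl v) => X.smooth v
  | Sum.inl (Sum.inr v) => Y.smooth v
  | Sum.inr _ => True

theorem upper_left {A B : Type} {p : A ⊕ Mark n} {v : A} :
    (upper p : ((A ⊕ B) ⊕ Fin n) ⊕ Mark n) = Sum.inl (Sum.inl (Sum.inl v)) ↔ p = Sum.inl v := by
  rcases p with a | (i | i) <;> simp [upper]

theorem upper_right {A B : Type} {p : A ⊕ Mark n} {v : B} :
    (upper p : ((A ⊕ B) ⊕ Fin n) ⊕ Mark n) ≠ Sum.inl (Sum.inl (Sum.inr v)) := by
  rcases p with a | (i | i) <;> simp [upper]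

theorem upper_mid {A B : Type} {p : A ⊕ Mark n} {i : Fin n} :
    (upper p : ((A ⊕ B) ⊕ Fin n) ⊕ Mark n) = Sum.inl (Sum.inr i) ↔ p = Sum.inr (Mark.bot i) := by
  rcases p with a | (i | i) <;> simp [upper]

theorem upper_top {A B : Type} {p : A ⊕ Mark n} {i : Fin n} :
    (upper p : ((A ⊕ B) ⊕ Fin n) ⊕ Mark n) = Sum.inr (Mark.top i) ↔
      p = Sum.inr (Mark.top i) := by
  rcases p with a | (i | i) <;> simp [upper]

theorem upper_bot {A B : Type} {p : A ⊕ Mark n} {i : Fin n} :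
    (upper p : ((A ⊕ B) ⊕ Fin n) ⊕ Mark n) ≠ Sum.inr (Mark.bot i) := by
  rcases p with a | (i | i) <;> simp [upper]

theorem lower_right {A B : Type} {p : B ⊕ Mark n} {v : B} :
    (lower p : ((A ⊕ B) ⊕ Fin n) ⊕ Mark n) = Sum.inl (Sum.inl (Sum.inr v)) ↔ p = Sum.inl v := by
  rcases p with a | (i | i) <;> simp [lower]

theorem lower_left {A B : Type} {p : B ⊕ Mark n} {v : A} :
    (lower p : ((A ⊕ B) ⊕ Fin n) ⊕ Mark n) ≠ Sum.inl (Sum.inl (Sum.inl v)) := by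
  rcases p with a | (i | i) <;> simp [lower]

theorem lower_mid {A B : Type} {p : B ⊕ Mark n} {i : Fin n} :
    (lower p : ((A ⊕ B) ⊕ Fin n) ⊕ Mark n) = Sum.inl (Sum.inr i) ↔ p = Sum.inr (Mark.top i) := by
  rcases p with a | (i | i) <;> simp [lower]

theorem lower_bot {A B : Type} {p : B ⊕ Mark n} {i : Fin n} :
    (lower p : ((A ⊕ B) ⊕ Fin n) ⊕ Mark n) = Sum.inr (Mark.bot i) ↔
      p = Sum.inr (Mark.bot i) := by
  rcases p with a | (i | i) <;> simp [lower]

theorem lower_top {A B : Type} {p : B ⊕ Mark n} {i : Fin n} :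
    (lower p : ((A ⊕ B) ⊕ Fin n) ⊕ Mark n) ≠ Sum.inr (Mark.top i) := by
  rcases p with a | (i | i) <;> simp [lower]

theorem stackNext_inl {x : X.H} (hx : ∀ i, X.src x ≠ Sum.inr (Mark.bot i)) :
    X.stackNext Y (Sum.inl x) = Sum.inl (X.next x) := by
  unfold stackNext
  rcases h : X.src x with v | (i | i) <;> simp_all

theorem stackNext_inr {y : Y.H} (hy : ∀ i, Y.src y ≠ Sum.inr (Mark.top i)) :
    X.stackNext Y (Sum.inr y) = Sum.inr (Y.next y) := by
  unfold stackNext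
  rcases h : Y.src y with v | (i | i) <;> simp_all

theorem stackNext_bot (i : Fin n) : X.stackNext Y (Sum.inl (X.mark (Mark.bot i))) =
    Sum.inr (Y.mark (Mark.top i)) := by
  unfold stackNext
  simp only [(X.src_mark _ (Mark.bot i)).2 rfl]

theorem stackNext_top (i : Fin n) : X.stackNext Y (Sum.inr (Y.mark (Mark.top i))) =
    Sum.inl (X.mark (Mark.bot i)) := by
  unfold stackNext
  simp only [(Y.src_mark _ (Mark.top i)).2 rfl]

theorem stack_gap (j : Fin (n + 1)) : (Quot.mk _ (Sum.inl (X.gapB j)) : X.StackFace Y) =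
    Quot.mk _ (Sum.inr (Y.gapT j)) := Quot.sound ⟨j, rfl, rfl⟩

theorem next_mark (m : Mark n) : X.next (X.mark m) = X.mark m :=
  (X.src_mark _ _).1 (by rw [X.src_next, (X.src_mark _ m).2 rfl])

theorem stack_orbit (x y : X.H ⊕ Y.H) :
    X.stackSrc Y x = X.stackSrc Y y ↔ ∃ k : ℕ, (X.stackNext Y)^[k] x = y := by
  revert x y
  rw [orbit_iff_closed]
  obtain ⟨-, hX⟩ := (orbit_iff_closed X.next X.src).1 X.orbit
  obtain ⟨-, hY⟩ := (orbit_iff_closed Y.next Y.src).1 Y.orbit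
  constructor
  · rintro (x | y)
    · by_cases h : ∃ i, X.src x = Sum.inr (Mark.bot i)
      · obtain ⟨i, h⟩ := h
        rw [X.src_mark] at h
        subst h
        rw [stackNext_bot]
        simp only [stackSrc, (X.src_mark _ (Mark.bot i)).2 rfl,
          (Y.src_mark _ (Mark.top i)).2 rfl, upper, lower]
      · push Not at h
        rw [X.stackNext_inl Y h]
        simp only [stackSrc, X.src_next]
    · by_cases h : ∃ i, Y.src y = Sum.inr (Mark.top i)
      · obtain ⟨i, h⟩ := h
        rw [Y.src_mark] at h
        subst h
        rw [stackNext_top]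
        simp only [stackSrc, (X.src_mark _ (Mark.bot i)).2 rfl,
          (Y.src_mark _ (Mark.top i)).2 rfl, upper, lower]
      · push Not at h
        rw [X.stackNext_inr Y h]
        simp only [stackSrc, Y.src_next]
  · intro S hS x y hx e
    have mid : ∀ i : Fin n, ∀ z : X.H ⊕ Y.H, X.stackSrc Y z = Sum.inl (Sum.inr i) →
        z = Sum.inl (X.mark (Mark.bot i)) ∨ z = Sum.inr (Y.mark (Mark.top i)) := by
      rintro i (z | z) hz <;> simp only [stackSrc] at hz
      · rw [upper_mid, X.src_mark] at hz; exact Or.inl (by rw [hz])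
      · rw [lower_mid, Y.src_mark] at hz; exact Or.inr (by rw [hz])
    have mids : ∀ i : Fin n, X.stackSrc Y x = Sum.inl (Sum.inr i) → y ∈ S := by
      intro i hi
      have hn := hS x hx
      rcases mid i x hi with e1 | e1 <;> rcases mid i y (e.trans hi) with e2 | e2 <;> rw [e1] at hn hx
      · rw [e2]; exact hx
      · rw [stackNext_bot] at hn; rw [e2]; exact hn
      · rw [stackNext_top] at hn; rw [e2]; exact hn
      · rw [e2]; exact hx
    rcases x with x | x
    · rcases hp : X.src x with v | (i | i)
      · have ex : X.stackSrc Y (Sum.inl x) = Sum.inl (Sum.inl (Sum.inl v)) := by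
          simp only [stackSrc, hp, upper]
        rw [ex] at e
        rcases y with y | y <;> simp only [stackSrc] at e
        · rw [upper_left] at e
          refine (hX {z | X.src z = Sum.inl v ∧ Sum.inl z ∈ S} ?_ x y ⟨hp, hx⟩ (e.trans hp.symm)).2
          rintro z ⟨hz, hzS⟩
          have := hS _ hzS
          rw [X.stackNext_inl Y (by rw [hz]; simp)] at this
          exact ⟨by rw [X.src_next, hz], this⟩
        · exact absurd e lower_left
      · have ex : X.stackSrc Y (Sum.inl x) = Sum.inr (Mark.top i) := by
          simp only [stackSrc, hp, upper]
        rw [ex] at e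
        rcases y with y | y <;> simp only [stackSrc] at e
        · rw [upper_top, X.src_mark] at e
          rw [X.src_mark] at hp
          rw [e, ← hp]; exact hx
        · exact absurd e lower_top
      · exact mids i (by simp only [stackSrc, hp, upper])
    · rcases hp : Y.src x with v | (i | i)
      · have ex : X.stackSrc Y (Sum.inr x) = Sum.inl (Sum.inl (Sum.inr v)) := by
          simp only [stackSrc, hp, lower]
        rw [ex] at e
        rcases y with y | y <;> simp only [stackSrc] at e
        · exact absurd e upper_right
        · rw [lower_right] at e
          refine (hY {z | Y.src z = Sum.inl v ∧ Sum.inr z ∈ S} ?_ x y ⟨hp, hx⟩ (e.trans hp.symm)).2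
          rintro z ⟨hz, hzS⟩
          have := hS _ hzS
          rw [X.stackNext_inr Y (by rw [hz]; simp)] at this
          exact ⟨by rw [Y.src_next, hz], this⟩
      · exact mids i (by simp only [stackSrc, hp, lower])
      · have ex : X.stackSrc Y (Sum.inr x) = Sum.inr (Mark.bot i) := by
          simp only [stackSrc, hp, lower]
        rw [ex] at e
        rcases y with y | y <;> simp only [stackSrc] at e
        · exact absurd e upper_bot
        · rw [lower_bot, Y.src_mark] at e
          rw [Y.src_mark] at hp
          rw [e, ← hp]; exact hx

theorem stack_at_left (P : X.H ⊕ Y.H → Prop) (v : X.V) :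
    {h | P h ∧ X.stackSrc Y h = Sum.inl (Sum.inl (Sum.inl v))} =
      Sum.inl '' {x | P (Sum.inl x) ∧ X.src x = Sum.inl v} := by
  ext z
  rcases z with z | z
  · simp [stackSrc, upper_left]
  · simp [stackSrc, lower_left]

theorem stack_at_right (P : X.H ⊕ Y.H → Prop) (v : Y.V) :
    {h | P h ∧ X.stackSrc Y h = Sum.inl (Sum.inl (Sum.inr v))} =
      Sum.inr '' {y | P (Sum.inr y) ∧ Y.src y = Sum.inl v} := by
  ext z
  rcases z with z | z
  · simp [stackSrc, upper_right]
  · simp [stackSrc, lower_right]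

theorem stack_at_mid (i : Fin n) (z : X.H ⊕ Y.H) : X.stackSrc Y z = Sum.inl (Sum.inr i) ↔
    z = Sum.inl (X.mark (Mark.bot i)) ∨ z = Sum.inr (Y.mark (Mark.top i)) := by
  rcases z with z | z
  · simp [stackSrc, upper_mid, X.src_mark]
  · simp [stackSrc, lower_mid, Y.src_mark]

/-- The drawing `X` stacked on top of the drawing `Y`. -/
def stack : Drawing n where
  V := (X.V ⊕ Y.V) ⊕ Fin n
  H := X.H ⊕ Y.H
  F := X.StackFace Y
  finV := inferInstance
  finH := inferInstance
  finF := inferInstance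
  src := X.stackSrc Y
  rev := Sum.map X.rev Y.rev
  next := X.stackNext Y
  face := X.stackFace Y
  mark := X.stackMark Y
  gapT j := Quot.mk _ (Sum.inl (X.gapT j))
  gapB j := Quot.mk _ (Sum.inr (Y.gapB j))
  inc := X.stackInc Y
  smooth := X.stackSmooth Y
  rev_rev := by rintro (x | y) <;> simp [X.rev_rev, Y.rev_rev]
  rev_ne := by rintro (x | y) <;> simp [X.rev_ne, Y.rev_ne]
  orbit := X.stack_orbit Y
  src_mark := by
    rintro (x | y) (i | i) <;> simp only [stackSrc, stackMark, reduceCtorEq, Sum.inl.injEq,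
      Sum.inr.injEq, iff_false]
    · rw [upper_top, X.src_mark]
    · exact upper_bot
    · exact lower_top
    · rw [lower_bot, Y.src_mark]
  smooth_two := by
    rintro ((v | v) | i) hv
    · have := X.stack_at_left Y (fun _ => True) v
      simp only [true_and] at this
      rw [this, Set.ncard_image_of_injective _ Sum.inl_injective]
      exact X.smooth_two v hv
    · have := X.stack_at_right Y (fun _ => True) v
      simp only [true_and] at this
      rw [this, Set.ncard_image_of_injective _ Sum.inr_injective]
      exact Y.smooth_two v hv
    · simp only [stack_at_mid]
      exact Set.ncard_pair (by simp)
  corner := by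
    rintro (x | y) ((v | v) | i) hv
    · simp only [stackSrc] at hv
      rw [upper_left] at hv
      rw [X.stackNext_inl Y (by rw [hv]; simp)]
      simp only [Sum.map_inl, stackFace, X.corner x v hv]
    · exact absurd hv upper_right
    · simp only [stackSrc] at hv
      rw [upper_mid, X.src_mark] at hv
      rw [hv, stackNext_bot]
      simp only [Sum.map_inr, stackFace, X.face_bot, Y.face_rev_top, stack_gap]
    · exact absurd hv lower_left
    · simp only [stackSrc] at hv
      rw [lower_right] at hv
      rw [X.stackNext_inr Y (by rw [hv]; simp)]
      simp only [Sum.map_inr, stackFace, Y.corner y v hv]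
    · simp only [stackSrc] at hv
      rw [lower_mid, Y.src_mark] at hv
      rw [hv, stackNext_top]
      simp only [Sum.map_inl, stackFace, X.face_rev_bot, Y.face_top, stack_gap]
  face_top i := by simp only [stackMark, stackFace, X.face_top]
  face_rev_top i := by simp only [stackMark, Sum.map_inl, stackFace, X.face_rev_top]
  face_bot i := by simp only [stackMark, stackFace, Y.face_bot]
  face_rev_bot i := by simp only [stackMark, Sum.map_inr, stackFace, Y.face_rev_bot]
  gap_left := by rw [X.gap_left, stack_gap, Y.gap_left]
  gap_right := by rw [X.gap_right, stack_gap, Y.gap_right]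
  inc_iff := by
    rintro h ((v | v) | i) hv f
    · rcases h with x | y
      · simp only [stackSrc] at hv
        rw [upper_left] at hv
        simp only [stackInc]
        constructor
        · rintro ⟨g, hg, rfl⟩
          obtain ⟨z, hz, rfl⟩ := (X.inc_iff x v hv g).1 hg
          exact ⟨Sum.inl z, upper_left.2 hz, rfl⟩
        · rintro ⟨z | z, hz, rfl⟩
          · exact ⟨_, (X.inc_iff x v hv _).2 ⟨z, upper_left.1 hz, rfl⟩, rfl⟩
          · exact absurd hz lower_left
      · exact absurd hv lower_left
    · rcases h with x | y
      · exact absurd hv upper_right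
      · simp only [stackSrc] at hv
        rw [lower_right] at hv
        simp only [stackInc]
        constructor
        · rintro ⟨g, hg, rfl⟩
          obtain ⟨z, hz, rfl⟩ := (Y.inc_iff y v hv g).1 hg
          exact ⟨Sum.inr z, lower_right.2 hz, rfl⟩
        · rintro ⟨z | z, hz, rfl⟩
          · exact absurd hz upper_right
          · exact ⟨_, (Y.inc_iff y v hv _).2 ⟨z, lower_right.1 hz, rfl⟩, rfl⟩
    · simp only [stackInc, stack_at_mid]
      constructor
      · rintro (e | e)
        · exact ⟨_, Or.inl rfl, by simp only [stackFace, X.face_bot, e]⟩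
        · exact ⟨_, Or.inr rfl, by simp only [stackFace, Y.face_top, ← stack_gap, e]⟩
      · rintro ⟨z, rfl | rfl, rfl⟩
        · left; simp only [stackFace, X.face_bot]
        · right; simp only [stackFace, Y.face_top, stack_gap]
  inc_unique := by
    rintro ((v | v) | i) hv
    · obtain ⟨f, hf, hu⟩ := X.inc_unique v (fun x hx => hv (Sum.inl x) (upper_left.2 hx))
      refine ⟨_, ⟨f, hf, rfl⟩, ?_⟩
      rintro _ ⟨g, hg, rfl⟩
      rw [hu g hg]
    · obtain ⟨f, hf, hu⟩ := Y.inc_unique v (fun x hx => hv (Sum.inr x) (lower_right.2 hx))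
      refine ⟨_, ⟨f, hf, rfl⟩, ?_⟩
      rintro _ ⟨g, hg, rfl⟩
      rw [hu g hg]
    · exact absurd ((X.stack_at_mid Y i _).2 (Or.inl rfl)) (hv _)
  jordan c hc hev := by
    obtain ⟨U, hU⟩ := X.jordan {x | Sum.inl x ∈ c} (fun x => hc (Sum.inl x)) (fun v => by
      have := hev (Sum.inl (Sum.inl v))
      rwa [X.stack_at_left Y (fun h => h ∈ c) v,
        Set.ncard_image_of_injective _ Sum.inl_injective] at this)
    obtain ⟨W, hW⟩ := Y.jordan {y | Sum.inr y ∈ c} (fun y => hc (Sum.inr y)) (fun v => by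
      have := hev (Sum.inl (Sum.inr v))
      rwa [X.stack_at_right Y (fun h => h ∈ c) v,
        Set.ncard_image_of_injective _ Sum.inr_injective] at this)
    have hmid : ∀ i, Sum.inl (X.mark (Mark.bot i)) ∈ c ↔ Sum.inr (Y.mark (Mark.top i)) ∈ c := by
      intro i
      have hi := hev (Sum.inr i)
      simp only [stack_at_mid] at hi
      by_contra hne
      have one : ∃ z, {h | h ∈ c ∧ (h = Sum.inl (X.mark (Mark.bot i)) ∨
          h = Sum.inr (Y.mark (Mark.top i)))} = {z} := by
        by_cases h1 : Sum.inl (X.mark (Mark.bot i)) ∈ c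
        · refine ⟨Sum.inl (X.mark (Mark.bot i)), ?_⟩
          ext z
          simp only [Set.mem_ofPred_eq, Set.mem_singleton_iff]
          constructor
          · rintro ⟨hz, rfl | rfl⟩
            · rfl
            · exact absurd (iff_of_true h1 hz) hne
          · rintro rfl
            exact ⟨h1, Or.inl rfl⟩
        · refine ⟨Sum.inr (Y.mark (Mark.top i)), ?_⟩
          ext z
          simp only [Set.mem_ofPred_eq, Set.mem_singleton_iff]
          constructor
          · rintro ⟨hz, rfl | rfl⟩
            · exact absurd hz h1
            · rfl
          · rintro rfl
            refine ⟨?_, Or.inr rfl⟩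
            by_contra h2
            exact hne (iff_of_false h1 h2)
      obtain ⟨z, hz⟩ := one
      rw [hz, Set.ncard_singleton] at hi
      exact absurd hi (by decide)
    -- both face sets agree, or differ everywhere, along the common side
    have hgap : ∀ j : Fin (n + 1), ((X.gapB j ∈ U ↔ X.gapB 0 ∈ U) ↔
        (Y.gapT j ∈ W ↔ Y.gapT 0 ∈ W)) := by
      intro j
      induction j using Fin.induction with
      | zero => simp
      | succ i ih =>
        have h1 := hU (X.mark (Mark.bot i))
        have h2 := hW (Y.mark (Mark.top i))
        have h3 := hmid i
        rw [X.face_bot, X.face_rev_bot] at h1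
        rw [Y.face_top, Y.face_rev_top] at h2
        change Sum.inl (X.mark (Mark.bot i)) ∈ c ↔ _ at h1
        change Sum.inr (Y.mark (Mark.top i)) ∈ c ↔ _ at h2
        tauto
    refine ⟨{f | Quot.lift (Sum.elim (fun g => g ∈ U ↔ X.gapB 0 ∈ U)
      (fun g => g ∈ W ↔ Y.gapT 0 ∈ W)) ?_ f}, ?_⟩
    · rintro _ _ ⟨j, rfl, rfl⟩
      exact propext (hgap j)
    · rintro (x | y)
      · refine Iff.trans (hU x) ?_
        change _ ↔ ¬ ((X.face x ∈ U ↔ X.gapB 0 ∈ U) ↔ (X.face (X.rev x) ∈ U ↔ X.gapB 0 ∈ U))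
        tauto
      · refine Iff.trans (hW y) ?_
        change _ ↔ ¬ ((Y.face y ∈ W ↔ Y.gapT 0 ∈ W) ↔ (Y.face (Y.rev y) ∈ W ↔ Y.gapT 0 ∈ W))
        tauto
  dual_connected U hU := by
    have h1 := X.dual_connected {f | (Quot.mk _ (Sum.inl f) : X.StackFace Y) ∈ U}
      (fun x => hU (Sum.inl x))
    have h2 := Y.dual_connected {f | (Quot.mk _ (Sum.inr f) : X.StackFace Y) ∈ U}
      (fun y => hU (Sum.inr y))
    have h3 := X.stack_gap Y 0
    simp only [Set.eq_empty_iff_forall_notMem, Set.eq_univ_iff_forall, Set.mem_ofPred_eq] at h1 h2 ⊢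
    have hind : ∀ P : X.StackFace Y → Prop, (∀ f, P (Quot.mk _ (Sum.inl f))) →
        (∀ f, P (Quot.mk _ (Sum.inr f))) → ∀ f, P f := by
      intro P a b f
      induction f using Quot.ind with
      | mk f => rcases f with f | f
                · exact a f
                · exact b f
    rcases h1 with h1 | h1 <;> rcases h2 with h2 | h2
    · exact Or.inl (hind _ h1 h2)
    · exact absurd (h3 ▸ h2 (Y.gapT 0)) (h1 (X.gapB 0))
    · exact absurd (h3 ▸ h1 (X.gapB 0)) (h2 (Y.gapT 0))
    · exact Or.inr (hind _ h1 h2)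

/-! ### Isotopy classes -/

/-- `Y` is, up to the names of its points, half-edges and faces, the drawing `X` with the smooth
points in the set `gone` forgotten, so that the two edges meeting at such a point become one edge. No
two neighbouring points are forgotten at once; in particular a closed curve keeps a point. For
`gone = ∅` this is an isomorphism of `X` and `Y`. -/
structure Coarsening {n : ℕ} (X Y : Drawing n) where
  gone : Set X.V
  onH : Y.H → X.H
  onV : Y.V → X.V
  onF : Y.F ≃ X.F
  gone_smooth : ∀ v ∈ gone, X.smooth v
  gone_apart : ∀ h, ∀ v ∈ gone, ∀ w ∈ gone, X.src h = Sum.inl v → X.src (X.rev h) ≠ Sum.inl w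
  injH : Function.Injective onH
  rangeH : ∀ x, x ∈ Set.range onH ↔ ∀ v ∈ gone, X.src x ≠ Sum.inl v
  injV : Function.Injective onV
  rangeV : ∀ v, v ∈ Set.range onV ↔ v ∉ gone
  src_eq : ∀ y, X.src (onH y) = Sum.map onV id (Y.src y)
  next_eq : ∀ y, X.next (onH y) = onH (Y.next y)
  /-- An edge of `X` which does not end at a forgotten point is an edge of `Y`. -/
  rev_eq : ∀ y, (∀ v ∈ gone, X.src (X.rev (onH y)) ≠ Sum.inl v) → onH (Y.rev y) = X.rev (onH y)
  /-- An edge of `X` which ends at a forgotten point is continued by the other edge there. -/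
  rev_gone : ∀ y, ∀ v ∈ gone, X.src (X.rev (onH y)) = Sum.inl v →
    onH (Y.rev y) = X.rev (X.next (X.rev (onH y)))
  face_eq : ∀ y, X.face (onH y) = onF (Y.face y)
  mark_eq : ∀ m, X.mark m = onH (Y.mark m)
  gapT_eq : ∀ j, X.gapT j = onF (Y.gapT j)
  gapB_eq : ∀ j, X.gapB j = onF (Y.gapB j)
  inc_eq : ∀ v f, X.inc (onV v) (onF f) ↔ Y.inc v f
  smooth_eq : ∀ v, X.smooth (onV v) ↔ Y.smooth v

/-- Every drawing coarsens to itself. -/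
def Coarsening.refl {n : ℕ} (X : Drawing n) : Coarsening X X where
  gone := ∅
  onH := id
  onV := id
  onF := Equiv.refl _
  gone_smooth := by simp
  gone_apart := by simp
  injH := Function.injective_id
  rangeH := by simp
  injV := Function.injective_id
  rangeV := by simp
  src_eq := by simp
  next_eq := by simp
  rev_eq := by simp
  rev_gone := by simp
  face_eq := by simp
  mark_eq := by simp
  gapT_eq := by simp
  gapB_eq := by simp
  inc_eq := by simp
  smooth_eq := by simp

theorem Coarsening.onF_aux {n : ℕ} {X X' Y Y' : Drawing n} (a : Coarsening X X')
    (b : Coarsening Y Y') (f g : X'.F ⊕ Y'.F) :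
    (∃ j, f = Sum.inl (X'.gapB j) ∧ g = Sum.inr (Y'.gapT j)) ↔
      ∃ j, Equiv.sumCongr a.onF b.onF f = Sum.inl (X.gapB j) ∧
        Equiv.sumCongr a.onF b.onF g = Sum.inr (Y.gapT j) := by
  simp only [a.gapB_eq, b.gapT_eq]
  rcases f with f | f <;> rcases g with g | g <;> simp

/-- Stacking respects coarsening. -/
def Coarsening.stack {n : ℕ} {X X' Y Y' : Drawing n} (a : Coarsening X X') (b : Coarsening Y Y') :
    Coarsening (X.stack Y) (X'.stack Y') where
  gone := {v | (∃ u ∈ a.gone, v = Sum.inl (Sum.inl u)) ∨ ∃ u ∈ b.gone, v = Sum.inl (Sum.inr u)}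
  onH := Sum.map a.onH b.onH
  onV := Sum.map (Sum.map a.onV b.onV) id
  onF := Quot.congr (Equiv.sumCongr a.onF b.onF) (onF_aux a b)
  gone_smooth := by
    rintro _ (⟨u, hu, rfl⟩ | ⟨u, hu, rfl⟩)
    · exact a.gone_smooth u hu
    · exact b.gone_smooth u hu
  gone_apart := by
    rintro (h | h) _ (⟨v, hv, rfl⟩ | ⟨v, hv, rfl⟩) _ (⟨w, hw, rfl⟩ | ⟨w, hw, rfl⟩) e e'
    · exact a.gone_apart h v hv w hw (upper_left.1 e) (upper_left.1 e')
    · exact upper_right e'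
    · exact upper_right e
    · exact upper_right e
    · exact lower_left e
    · exact lower_left e
    · exact lower_left e'
    · exact b.gone_apart h v hv w hw (lower_right.1 e) (lower_right.1 e')
  injH := Sum.map_injective.2 ⟨a.injH, b.injH⟩
  rangeH := by
    rintro (x | x)
    · have := a.rangeH x
      constructor
      · rintro ⟨y | y, e⟩
        · rintro _ (⟨u, hu, rfl⟩ | ⟨u, hu, rfl⟩) e'
          · exact this.1 ⟨y, Sum.inl_injective e⟩ u hu (upper_left.1 e')
          · exact upper_right e'
        · cases e
      · intro hx
        obtain ⟨y, rfl⟩ := this.2 (fun u hu e => hx _ (Or.inl ⟨u, hu, rfl⟩) (upper_left.2 e))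
        exact ⟨Sum.inl y, rfl⟩
    · have := b.rangeH x
      constructor
      · rintro ⟨y | y, e⟩
        · cases e
        · rintro _ (⟨u, hu, rfl⟩ | ⟨u, hu, rfl⟩) e'
          · exact lower_left e'
          · exact this.1 ⟨y, Sum.inr_injective e⟩ u hu (lower_right.1 e')
      · intro hx
        obtain ⟨y, rfl⟩ := this.2 (fun u hu e => hx _ (Or.inr ⟨u, hu, rfl⟩) (lower_right.2 e))
        exact ⟨Sum.inr y, rfl⟩
  injV := Sum.map_injective.2 ⟨Sum.map_injective.2 ⟨a.injV, b.injV⟩, Function.injective_id⟩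
  rangeV := by
    rintro ((v | v) | i)
    · have := a.rangeV v
      constructor
      · rintro ⟨(y | y) | y, e⟩
        · rintro (⟨u, hu, e'⟩ | ⟨u, hu, e'⟩)
          · cases e'
            exact this.1 ⟨y, Sum.inl_injective (Sum.inl_injective e)⟩ hu
          · cases e'
        · cases e
        · cases e
      · intro hx
        obtain ⟨y, rfl⟩ := this.2 (fun hu => hx (Or.inl ⟨v, hu, rfl⟩))
        exact ⟨Sum.inl (Sum.inl y), rfl⟩
    · have := b.rangeV v
      constructor
      · rintro ⟨(y | y) | y, e⟩
        · cases e
        · rintro (⟨u, hu, e'⟩ | ⟨u, hu, e'⟩)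
          · cases e'
          · cases e'
            exact this.1 ⟨y, Sum.inr_injective (Sum.inl_injective e)⟩ hu
        · cases e
      · intro hx
        obtain ⟨y, rfl⟩ := this.2 (fun hu => hx (Or.inr ⟨v, hu, rfl⟩))
        exact ⟨Sum.inl (Sum.inr y), rfl⟩
    · refine iff_of_true ⟨Sum.inr i, rfl⟩ ?_
      rintro (⟨u, hu, e'⟩ | ⟨u, hu, e'⟩) <;> cases e'
  src_eq := by
    rintro (y | y)
    · change upper (X.src (a.onH y)) = Sum.map _ id (upper (X'.src y))
      rw [a.src_eq]
      rcases X'.src y with v | (i | i) <;> rfl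
    · change lower (Y.src (b.onH y)) = Sum.map _ id (lower (Y'.src y))
      rw [b.src_eq]
      rcases Y'.src y with v | (i | i) <;> rfl
  next_eq := by
    rintro (y | y)
    · change X.stackNext Y (Sum.inl (a.onH y)) = Sum.map _ _ (X'.stackNext Y' (Sum.inl y))
      by_cases h : ∃ i, X'.src y = Sum.inr (Mark.bot i)
      · obtain ⟨i, h⟩ := h
        rw [X'.src_mark] at h
        rw [h, ← a.mark_eq, stackNext_bot, stackNext_bot, b.mark_eq]
        rfl
      · push Not at h
        rw [X'.stackNext_inl Y' h, X.stackNext_inl Y, a.next_eq]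
        · rfl
        · intro i e
          rw [X.src_mark, a.mark_eq] at e
          exact h i ((X'.src_mark _ _).2 (a.injH e))
    · change X.stackNext Y (Sum.inr (b.onH y)) = Sum.map _ _ (X'.stackNext Y' (Sum.inr y))
      by_cases h : ∃ i, Y'.src y = Sum.inr (Mark.top i)
      · obtain ⟨i, h⟩ := h
        rw [Y'.src_mark] at h
        rw [h, ← b.mark_eq, stackNext_top, stackNext_top, a.mark_eq]
        rfl
      · push Not at h
        rw [X'.stackNext_inr Y' h, X.stackNext_inr Y, b.next_eq]
        · rfl
        · intro i e
          rw [Y.src_mark, b.mark_eq] at e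
          exact h i ((Y'.src_mark _ _).2 (b.injH e))
  rev_eq := by
    rintro (y | y) hy
    · exact congrArg Sum.inl (a.rev_eq y fun v hv e => hy _ (Or.inl ⟨v, hv, rfl⟩) (upper_left.2 e))
    · exact congrArg Sum.inr (b.rev_eq y fun v hv e => hy _ (Or.inr ⟨v, hv, rfl⟩) (lower_right.2 e))
  rev_gone := by
    rintro (y | y) _ (⟨u, hu, rfl⟩ | ⟨u, hu, rfl⟩) e
    · have e' := upper_left.1 e
      change Sum.inl (a.onH (X'.rev y)) =
        Sum.map X.rev Y.rev (X.stackNext Y (Sum.inl (X.rev (a.onH y))))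
      rw [X.stackNext_inl Y (by rw [e']; simp), a.rev_gone y u hu e']
      rfl
    · exact absurd e upper_right
    · exact absurd e lower_left
    · have e' := lower_right.1 e
      change Sum.inr (b.onH (Y'.rev y)) =
        Sum.map X.rev Y.rev (X.stackNext Y (Sum.inr (Y.rev (b.onH y))))
      rw [X.stackNext_inr Y (by rw [e']; simp), b.rev_gone y u hu e']
      rfl
  face_eq := by
    rintro (y | y)
    · exact congrArg (fun f => Quot.mk _ (Sum.inl f)) (a.face_eq y)
    · exact congrArg (fun f => Quot.mk _ (Sum.inr f)) (b.face_eq y)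
  mark_eq := by
    rintro (i | i)
    · exact congrArg Sum.inl (a.mark_eq _)
    · exact congrArg Sum.inr (b.mark_eq _)
  gapT_eq j := congrArg (fun f => Quot.mk _ (Sum.inl f)) (a.gapT_eq j)
  gapB_eq j := congrArg (fun f => Quot.mk _ (Sum.inr f)) (b.gapB_eq j)
  inc_eq := by
    rintro ((v | v) | i) f
    · constructor
      · rintro ⟨g, hg, e⟩
        obtain ⟨g, rfl⟩ := a.onF.surjective g
        refine ⟨g, (a.inc_eq v g).1 hg, (Equiv.injective _ (e.symm.trans ?_)).symm⟩
        rfl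
      · rintro ⟨g, hg, rfl⟩
        exact ⟨a.onF g, (a.inc_eq v g).2 hg, rfl⟩
    · constructor
      · rintro ⟨g, hg, e⟩
        obtain ⟨g, rfl⟩ := b.onF.surjective g
        refine ⟨g, (b.inc_eq v g).1 hg, (Equiv.injective _ (e.symm.trans ?_)).symm⟩
        rfl
      · rintro ⟨g, hg, rfl⟩
        exact ⟨b.onF g, (b.inc_eq v g).2 hg, rfl⟩
    · have key : ∀ j, (Quot.mk _ (Sum.inl (X.gapB j)) : X.StackFace Y) =
          Quot.congr (Equiv.sumCongr a.onF b.onF) (onF_aux a b) f ↔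
          (Quot.mk _ (Sum.inl (X'.gapB j)) : X'.StackFace Y') = f := by
        intro j
        rw [a.gapB_eq]
        exact (Quot.congr (Equiv.sumCongr a.onF b.onF) (onF_aux a b)).injective.eq_iff
          (a := Quot.mk _ (Sum.inl (X'.gapB j)))
      exact or_congr (key _) (key _)
  smooth_eq := by
    rintro ((v | v) | i)
    · exact a.smooth_eq v
    · exact b.smooth_eq v
    · exact Iff.rfl

/-- The same drawing with the 2-valent vertex `v` turned into a smooth point, i.e. with the vertex
removed and its two edges merged. -/
def smoothen (v : X.V) (hv : {h | X.src h = Sum.inl v}.ncard = 2) : Drawing n :=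
  { X with
    smooth := fun u => X.smooth u ∨ u = v
    smooth_two := by
      rintro u (hu | rfl)
      · exact X.smooth_two u hu
      · exact hv }

end Drawing

/-- The `n`-th order chromatic diagrams: drawings up to isotopy. Two drawings are identified if one is
obtained from the other by an isomorphism and by forgetting smooth points (`Quot` takes the
equivalence relation which is generated). -/
def ChromaticDiagram (n : ℕ) : Type 1 :=
  Quot (fun X Y : Drawing n => Nonempty (Drawing.Coarsening X Y))

namespace ChromaticDiagram

/-- The isotopy class of a drawing. -/
def mk {n : ℕ} (X : Drawing n) : ChromaticDiagram n := Quot.mk _ X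

/-- The product `a * b` stacks `a` on top of `b`. -/
instance (n : ℕ) : Mul (ChromaticDiagram n) where
  mul := Quot.map₂ Drawing.stack
    (fun X _ _ ⟨b⟩ => ⟨(Drawing.Coarsening.refl X).stack b⟩)
    (fun _ _ Y ⟨a⟩ => ⟨a.stack (Drawing.Coarsening.refl Y)⟩)

end ChromaticDiagram

/-- The field `ℂ((Q))` of complex Laurent series. -/
def CQ : Type := LaurentSeries ℂ

instance : Field CQ := inferInstanceAs (Field (LaurentSeries ℂ))

/-- The indeterminate `Q`. -/
def indetQ : CQ := (HahnSeries.single (1 : ℤ) (1 : ℂ) : LaurentSeries ℂ)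

/-- The algebra with basis the chromatic diagrams, multiplied by stacking. -/
abbrev FreeChromatic (n : ℕ) : Type 1 := MonoidAlgebra CQ (ChromaticDiagram n)

/-- The basis element of a drawing. -/
def diag {n : ℕ} (X : Drawing n) : FreeChromatic n := MonoidAlgebra.single (ChromaticDiagram.mk X) 1

/-- The chromatic relations, as the differences of their two sides. -/
inductive ChromaticRel (n : ℕ) : FreeChromatic n → Prop
  /-- `G = G / e - G \ e` for an inner edge `e` which is not a loop. -/
  | contraction_deletion (X : Drawing n) (h : X.H) (hin : X.IsInner h) (hl : ¬ X.IsLoop h) :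
      ChromaticRel n (diag X - (diag (X.contract h hin hl) - diag (X.delete h hin)))
  /-- `G = (Q - 1) G \ e` for an inner edge `e` which is a loop. -/
  | loop (X : Drawing n) (h : X.H) (hin : X.IsInner h) (hl : X.IsLoop h) :
      ChromaticRel n (diag X - (indetQ - 1) • diag (X.delete h hin))
  /-- A 2-valent vertex may be removed, its two edges being merged. -/
  | two_valent (X : Drawing n) (v : X.V) (hv : {h | X.src h = Sum.inl v}.ncard = 2) :
      ChromaticRel n (diag X - diag (X.smoothen v hv))

/-- The two-sided ideal generated by the chromatic relations: the smallest subspace which contains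
them and is closed under multiplication by arbitrary elements from the left and from the right. -/
def chromaticIdeal (n : ℕ) : Submodule CQ (FreeChromatic n) :=
  sInf {J | (∀ r, ChromaticRel n r → r ∈ J) ∧ ∀ a, ∀ x ∈ J, a * x ∈ J ∧ x * a ∈ J}

/-- The `n`-th order chromatic algebra (as a vector space over `ℂ((Q))`). -/
abbrev ChromaticAlgebra (n : ℕ) : Type 1 := FreeChromatic n ⧸ chromaticIdeal n

/-- The Riordan numbers: `R 0 = 1`, `R 1 = 0` and `(m + 1) R m = (m - 1) (2 R (m - 1) + 3 R (m - 2))`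
for `m ≥ 2`. -/
def riordan : ℕ → ℚ
  | 0 => 1
  | 1 => 0
  | m + 2 => (m + 1) * (2 * riordan (m + 1) + 3 * riordan m) / (m + 3)

end

noncomputable section

/-! ### Inclusion-exclusion over the fibres of a surjection -/

/-! The dimension is the number of noncrossing partitions without singletons of the `2n` marked
points: such a partition `r` has a standard drawing `NCRel.star`, in which every block is a vertex
joined to its marked points, and the classes of these drawings form a basis.

They span. Contraction-deletion and the loop relation remove all inner edges. An edge joining two
marked points, which is not inner, is first subdivided, and the new point may be counted as a vertex
by the third relation. What remains are drawings whose edges all join a marked point to a vertex.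
The key relation is that a pendant edge kills a drawing (`cls_eq_zero_of_pendant`): double the
pendant edge, so that its end becomes 2-valent. For an edge `e` at a 2-valent vertex, contracting
`e` is the same as forgetting the vertex, so `G = G/e`, and `G = G/e - G\e` forces `G\e = 0`; here
`G\e` is the original drawing. Applied to an edge which attaches an isolated vertex to a
neighbouring vertex, the same vanishing shows that isolated vertices can be absorbed. A drawing
without isolated and univalent vertices whose edges all join a marked point to a vertex is a
standard drawing; that its partition is noncrossing, and that its faces are determined by the
partition, follows from the Jordan property and from the corner condition on faces
(`IsStarlike.starCoarsening`).

They are independent. The relations are those of the flow polynomial, which counts nowhere-zero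
flows with values in a group of order `Q`. The invariant used here is a version with boundary for
the formal variable `Q`: to a set `S` of half-edges belongs the space of mod 2 flows vanishing on
`S`, which is recorded by its space of boundary values and by `Q` to the dimension of its part
without boundary. The alternating sum over `S` is `flowSum`. It satisfies all three relations, and
the state sum of a stacked drawing is a bilinear function of the two state sums (`flowSum_stack`).
Hence its linear extension vanishes on the ideal. For a standard drawing, the coefficient at the
full boundary space of a partition `s` is `1` if `r = s` and `0` otherwise (`flowSum_star_apply`),
because without singletons no full boundary space vanishes at a marked point.

They are counted by Riordan numbers. Refining the count by the condition that the first `k` points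
lie in different blocks gives a three-term recursion, which is solved by differences of neighbouring
trinomial coefficients (`ncard_ncSet`); those at the centre satisfy the recursion of the Riordan
numbers (`riordan_eq`). -/

theorem eq_of_sum_powerset_eq {ι M : Type*} [DecidableEq ι] [AddCommGroup M] (a b : Finset ι → M)
    (h : ∀ T : Finset ι, ∑ S ∈ T.powerset, a S = ∑ S ∈ T.powerset, b S) : a = b := by
  funext T
  induction T using Finset.strongInduction with
  | H T ih =>
    have hT := h T
    rw [← Finset.insert_erase (Finset.mem_powerset_self T),
      Finset.sum_insert (Finset.notMem_erase _ _), Finset.sum_insert (Finset.notMem_erase _ _)] at hT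
    have : ∑ S ∈ T.powerset.erase T, a S = ∑ S ∈ T.powerset.erase T, b S := by
      refine Finset.sum_congr rfl fun S hS => ih S ?_
      rw [Finset.mem_erase, Finset.mem_powerset] at hS
      exact Finset.ssubset_iff_subset_ne.2 ⟨hS.2, hS.1⟩
    rw [this] at hT
    exact add_right_cancel hT

/-- After summation over all subsets of `T`, the left side is the alternating sum over the subsets
of the preimage of `T`, which is `1` or `0` according to whether this preimage is empty. By
surjectivity it is empty exactly when `T` is, so both sides have the same sums and therefore agree.
-/
theorem sum_neg_one_pow_card_image_eq {α β : Type*} [Fintype α] [Fintype β] [DecidableEq α]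
    [DecidableEq β] {p : α → β} (hp : Function.Surjective p) (T : Finset β) :
    ∑ S : Finset α with S.image p = T, (-1 : ℤ) ^ S.card = (-1) ^ T.card := by
  revert T
  rw [← funext_iff]
  refine eq_of_sum_powerset_eq _ _ fun T => ?_
  rw [Finset.sum_powerset_neg_one_pow_card]
  have e : ∑ U ∈ T.powerset, ∑ S : Finset α with S.image p = U, (-1 : ℤ) ^ S.card =
      ∑ S ∈ (Finset.univ.filter fun x => p x ∈ T).powerset, (-1 : ℤ) ^ S.card := by
    rw [← Finset.sum_fiberwise_of_maps_to (s := (Finset.univ.filter fun x => p x ∈ T).powerset)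
      (t := T.powerset) (g := fun S => S.image p)]
    · refine Finset.sum_congr rfl fun U hU => Finset.sum_congr ?_ fun _ _ => rfl
      ext S
      simp only [Finset.mem_filter, Finset.mem_univ, true_and, Finset.mem_powerset] at hU ⊢
      refine ⟨fun h => ⟨fun x hx => ?_, h⟩, fun h => h.2⟩
      simp only [Finset.mem_filter, Finset.mem_univ, true_and]
      exact hU (h ▸ Finset.mem_image_of_mem p hx)
    · intro S hS
      rw [Finset.mem_powerset] at hS ⊢
      intro y hy
      obtain ⟨x, hx, rfl⟩ := Finset.mem_image.1 hy
      exact (Finset.mem_filter.1 (hS hx)).2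
  rw [e, Finset.sum_powerset_neg_one_pow_card]
  refine if_congr ?_ rfl rfl
  rw [Finset.filter_eq_empty_iff, Finset.eq_empty_iff_forall_notMem]
  refine ⟨fun h y hy => ?_, fun h x _ => h _⟩
  obtain ⟨x, rfl⟩ := hp y
  exact h (Finset.mem_univ x) hy

/-- In an inclusion-exclusion sum, coordinates which always agree may be replaced by a single one.
This is what allows state sums to be taken over half-edges instead of edges. -/
theorem sum_neg_one_pow_card_image {α β M : Type*} [Fintype α] [Fintype β] [DecidableEq α]
    [DecidableEq β] [AddCommGroup M] {p : α → β} (hp : Function.Surjective p) (G : Finset β → M) :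
    ∑ S : Finset α, (-1 : ℤ) ^ S.card • G (S.image p) = ∑ T : Finset β, (-1 : ℤ) ^ T.card • G T := by
  rw [← Finset.sum_fiberwise (s := Finset.univ) (g := fun S : Finset α => S.image p)]
  refine Finset.sum_congr rfl fun T _ => ?_
  rw [← sum_neg_one_pow_card_image_eq hp T, Finset.sum_smul]
  refine Finset.sum_congr rfl fun S hS => ?_
  rw [(Finset.mem_filter.1 hS).2]

/-! ### State sums of binary codes with marked coordinates -/

/-- The boundary values of mod 2 flows. -/
abbrev Bdry (n : ℕ) : Type := Mark n → ZMod 2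

/-- The space in which the state sums take their values. -/
abbrev StateSpace (n : ℕ) : Type := Submodule (ZMod 2) (Bdry n) →₀ CQ

instance (n : ℕ) : Finite (Mark n) :=
  Finite.of_injective (fun m : Mark n => match m with
    | Mark.top i => (Sum.inl i : Fin n ⊕ Fin n)
    | Mark.bot i => Sum.inr i) (by rintro (i | i) (j | j) <;> simp)

/-- The weight of a subspace `B` of flows: its boundary values, weighted by a power of `Q` which
counts the flows without boundary. -/
def weight {n : ℕ} {A : Type} [AddCommGroup A] [Module (ZMod 2) A] (d : A →ₗ[ZMod 2] Bdry n)
    (B : Submodule (ZMod 2) A) : StateSpace n :=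
  Finsupp.single (B.map d) (indetQ ^ Module.finrank (ZMod 2) ↥(B ⊓ LinearMap.ker d))

theorem weight_equiv {n : ℕ} {A A' : Type} [AddCommGroup A] [Module (ZMod 2) A] [AddCommGroup A']
    [Module (ZMod 2) A'] (e : A ≃ₗ[ZMod 2] A') (d : A →ₗ[ZMod 2] Bdry n)
    (d' : A' →ₗ[ZMod 2] Bdry n) (hd : ∀ a, d' (e a) = d a) (B : Submodule (ZMod 2) A)
    (B' : Submodule (ZMod 2) A') (hB : ∀ a, e a ∈ B' ↔ a ∈ B) : weight d B = weight d' B' := by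
  have hB' : B' = B.map e.toLinearMap := by
    ext a
    obtain ⟨a, rfl⟩ := e.surjective a
    rw [hB]
    simp
  have hk : B' ⊓ LinearMap.ker d' = (B ⊓ LinearMap.ker d).map e.toLinearMap := by
    ext a
    obtain ⟨a, rfl⟩ := e.surjective a
    simp only [Submodule.mem_inf, hB, LinearMap.mem_ker, hd]
    simp
  have hm : B'.map d' = B.map d := by
    rw [hB', ← Submodule.map_comp]
    congr 1
    ext a : 1
    exact hd a
  unfold weight
  rw [hm, hk, LinearEquiv.finrank_map_eq]

/-- Flows which vanish on a set of coordinates. -/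
def vanishing {H A : Type} [AddCommGroup A] [Module (ZMod 2) A] (φ : A →ₗ[ZMod 2] H → ZMod 2)
    (S : Finset H) : Submodule (ZMod 2) A where
  carrier := {a | ∀ h ∈ S, φ a h = 0}
  add_mem' ha hb h hh := by simp [ha h hh, hb h hh]
  zero_mem' h _ := by simp
  smul_mem' c a ha h hh := by simp [ha h hh]

theorem mem_vanishing {H A : Type} [AddCommGroup A] [Module (ZMod 2) A]
    {φ : A →ₗ[ZMod 2] H → ZMod 2} {S : Finset H} {a : A} :
    a ∈ vanishing φ S ↔ ∀ h ∈ S, φ a h = 0 := Iff.rfl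

open Classical in
/-- The alternating sum of the weights of the spaces of flows with a prescribed set of zeros. It is
the generating function of nowhere-zero flows. -/
def stateSum {n : ℕ} {H A : Type} [Finite H] [AddCommGroup A] [Module (ZMod 2) A]
    (φ : A →ₗ[ZMod 2] H → ZMod 2) (d : A →ₗ[ZMod 2] Bdry n) : StateSpace n :=
  letI := Fintype.ofFinite H
  ∑ S : Finset H, (-1 : ℤ) ^ S.card • weight d (vanishing φ S)

theorem stateSum_eq {n : ℕ} {H A : Type} [Fintype H] [AddCommGroup A] [Module (ZMod 2) A]
    (φ : A →ₗ[ZMod 2] H → ZMod 2) (d : A →ₗ[ZMod 2] Bdry n) :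
    stateSum φ d = ∑ S : Finset H, (-1 : ℤ) ^ S.card • weight d (vanishing φ S) := by
  unfold stateSum
  congr!

/-- A flow vanishes on `S` exactly when its image vanishes on `S.image p`, so the sum over the
fibres of `p` collapses. This one criterion covers isomorphisms, the identification of the two
halves of an edge and the merging of edges at smooth points. -/
theorem stateSum_surj {n : ℕ} {H H' A A' : Type} [Finite H] [Finite H'] [AddCommGroup A]
    [Module (ZMod 2) A] [AddCommGroup A'] [Module (ZMod 2) A'] (e : A ≃ₗ[ZMod 2] A') {p : H → H'}
    (hp : Function.Surjective p) (φ : A →ₗ[ZMod 2] H → ZMod 2) (φ' : A' →ₗ[ZMod 2] H' → ZMod 2)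
    (d : A →ₗ[ZMod 2] Bdry n) (d' : A' →ₗ[ZMod 2] Bdry n)
    (hφ : ∀ a h, φ a h = φ' (e a) (p h)) (hd : ∀ a, d' (e a) = d a) :
    stateSum φ d = stateSum φ' d' := by
  classical
  have := Fintype.ofFinite H
  have := Fintype.ofFinite H'
  rw [stateSum_eq, stateSum_eq, ← sum_neg_one_pow_card_image hp]
  refine Finset.sum_congr rfl fun S _ => ?_
  rw [weight_equiv e d d' hd (vanishing φ S) (vanishing φ' (S.image p))]
  intro a
  simp only [mem_vanishing, Finset.mem_image, forall_exists_index, and_imp,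
    forall_apply_eq_imp_iff₂, hφ]

/-- Splitting off one coordinate. -/
theorem stateSum_option {n : ℕ} {H A : Type} [Finite H] [AddCommGroup A] [Module (ZMod 2) A]
    (φ : A →ₗ[ZMod 2] Option H → ZMod 2) (d : A →ₗ[ZMod 2] Bdry n) :
    stateSum φ d = stateSum (LinearMap.funLeft (ZMod 2) (ZMod 2) some ∘ₗ φ) d -
      stateSum (LinearMap.funLeft (ZMod 2) (ZMod 2) some ∘ₗ φ ∘ₗ
        (LinearMap.ker (LinearMap.proj none ∘ₗ φ)).subtype)
        (d ∘ₗ (LinearMap.ker (LinearMap.proj none ∘ₗ φ)).subtype) := by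
  classical
  have := Fintype.ofFinite H
  have himg : ∀ f : Finset (Option H) → StateSpace n,
      ∑ S ∈ (Finset.univ.map Function.Embedding.some).powerset, f S =
        ∑ S : Finset H, f (S.map Function.Embedding.some) := by
    intro f
    symm
    refine Finset.sum_bij (fun S _ => S.map Function.Embedding.some) ?_ ?_ ?_ ?_
    · intro S _
      exact Finset.mem_powerset.2 (Finset.map_subset_map.2 (Finset.subset_univ S))
    · exact fun S _ T _ e => Finset.map_injective _ e
    · intro S hS
      obtain ⟨T, -, rfl⟩ := Finset.subset_map_iff.1 (Finset.mem_powerset.1 hS)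
      exact ⟨T, Finset.mem_univ _, rfl⟩
    · exact fun _ _ => rfl
  rw [stateSum_eq, stateSum_eq, stateSum_eq, ← Finset.sum_sub_distrib, ← Finset.powerset_univ]
  have huniv : (Finset.univ : Finset (Option H)) =
      insert none (Finset.univ.map Function.Embedding.some) := by
    ext (_ | x) <;> simp
  rw [huniv, Finset.sum_powerset_insert (by simp), himg, himg, ← Finset.sum_add_distrib]
  refine Finset.sum_congr rfl fun S _ => ?_
  rw [Finset.card_insert_of_notMem (by simp), Finset.card_map, pow_succ, mul_neg, mul_one, neg_smul,
    ← sub_eq_add_neg]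
  congr 2
  · congr 1
    ext a
    simp [mem_vanishing, LinearMap.funLeft]
  -- The sets containing `none` acquire an extra sign and describe flows inside `K`. The inclusion
  -- of `K` is injective, so it changes neither the boundary space nor the dimension.
  · set K := LinearMap.ker (LinearMap.proj none ∘ₗ φ)
    set φ' := LinearMap.funLeft (ZMod 2) (ZMod 2) some ∘ₗ φ ∘ₗ K.subtype
    have hv : vanishing φ (insert none (S.map Function.Embedding.some)) =
        (vanishing φ' S).map K.subtype := by
      ext a
      simp [mem_vanishing, K, φ', LinearMap.funLeft, and_comm]
    have hk : vanishing φ (insert none (S.map Function.Embedding.some)) ⊓ LinearMap.ker d =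
        (vanishing φ' S ⊓ LinearMap.ker (d ∘ₗ K.subtype)).map K.subtype := by
      rw [hv]
      ext a
      simp only [Submodule.mem_inf, Submodule.mem_map, LinearMap.mem_ker, LinearMap.comp_apply]
      constructor
      · rintro ⟨⟨b, hb, rfl⟩, hd⟩
        exact ⟨b, ⟨hb, hd⟩, rfl⟩
      · rintro ⟨b, ⟨hb, hd⟩, rfl⟩
        exact ⟨⟨b, hb, rfl⟩, hd⟩
    unfold weight
    rw [hk, hv, Submodule.map_comp,
      ← (Submodule.equivMapOfInjective K.subtype K.injective_subtype _).finrank_eq]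

theorem finrank_submodule_prod {A A' : Type} [AddCommGroup A] [Module (ZMod 2) A] [Finite A]
    [AddCommGroup A'] [Module (ZMod 2) A'] [Finite A'] (p : Submodule (ZMod 2) A)
    (q : Submodule (ZMod 2) A') : Module.finrank (ZMod 2) ↥(p.prod q) =
      Module.finrank (ZMod 2) p + Module.finrank (ZMod 2) q := by
  rw [← Module.finrank_prod]
  refine LinearEquiv.finrank_eq
    { toFun := fun x => (⟨x.1.1, x.2.1⟩, ⟨x.1.2, x.2.2⟩)
      invFun := fun x => ⟨(x.1.1, x.2.1), x.1.2, x.2.2⟩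
      map_add' := fun _ _ => rfl
      map_smul' := fun _ _ => rfl
      left_inv := fun _ => rfl
      right_inv := fun _ => rfl }

/-- A free coordinate contributes a factor `Q`. -/
theorem stateSum_prod {n : ℕ} {H A : Type} [Finite H] [AddCommGroup A] [Module (ZMod 2) A]
    [Finite A] (φ : A →ₗ[ZMod 2] H → ZMod 2) (d : A →ₗ[ZMod 2] Bdry n) :
    stateSum (φ ∘ₗ LinearMap.snd (ZMod 2) (ZMod 2) A) (d ∘ₗ LinearMap.snd (ZMod 2) (ZMod 2) A) =
      indetQ • stateSum φ d := by
  classical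
  have := Fintype.ofFinite H
  rw [stateSum_eq, stateSum_eq, Finset.smul_sum]
  refine Finset.sum_congr rfl fun S _ => ?_
  rw [smul_comm]
  congr 1
  -- The extra factor is constrained neither by the zeros nor by the boundary values; it raises
  -- every exponent of `Q` by one.
  have hk : vanishing (φ ∘ₗ LinearMap.snd (ZMod 2) (ZMod 2) A) S ⊓
      LinearMap.ker (d ∘ₗ LinearMap.snd (ZMod 2) (ZMod 2) A) =
      Submodule.prod ⊤ (vanishing φ S ⊓ LinearMap.ker d) := by
    ext ⟨t, a⟩
    simp [mem_vanishing]
  have hm : (vanishing (φ ∘ₗ LinearMap.snd (ZMod 2) (ZMod 2) A) S).map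
      (d ∘ₗ LinearMap.snd (ZMod 2) (ZMod 2) A) = (vanishing φ S).map d := by
    ext b
    simp [mem_vanishing]
  unfold weight
  rw [hk, hm, Finsupp.smul_single]
  congr 1
  rw [finrank_submodule_prod, finrank_top, Module.finrank_self, pow_add, pow_one, smul_eq_mul]

/-! ### Composition of state sums -/

/-- The mismatch of two boundary values along the common side of two stacked rectangles. -/
def mismatch (n : ℕ) : Bdry n × Bdry n →ₗ[ZMod 2] Fin n → ZMod 2 where
  toFun w i := w.1 (Mark.bot i) - w.2 (Mark.top i)
  map_add' w w' := by ext i; simp; ring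
  map_smul' c w := by ext i; simp; ring

/-- The boundary values of two stacked rectangles along the outer sides. -/
def outer (n : ℕ) : Bdry n × Bdry n →ₗ[ZMod 2] Bdry n where
  toFun w m := match m with
    | Mark.top i => w.1 (Mark.top i)
    | Mark.bot i => w.2 (Mark.bot i)
  map_add' w w' := by ext (i | i) <;> simp
  map_smul' c w := by ext (i | i) <;> simp

/-- The bilinear product on the state space which corresponds to stacking. -/
def compose (n : ℕ) : StateSpace n →ₗ[CQ] StateSpace n →ₗ[CQ] StateSpace n :=
  Finsupp.linearCombination CQ fun W => Finsupp.linearCombination CQ fun W' =>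
    Finsupp.single ((W.prod W' ⊓ LinearMap.ker (mismatch n)).map (outer n))
      (indetQ ^ Module.finrank (ZMod 2)
        ↥(W.prod W' ⊓ LinearMap.ker (mismatch n) ⊓ LinearMap.ker (outer n)))

theorem finrank_map_add_finrank_inf_ker {A B : Type} [AddCommGroup A] [Module (ZMod 2) A] [Finite A]
    [AddCommGroup B] [Module (ZMod 2) B] (f : A →ₗ[ZMod 2] B) (N : Submodule (ZMod 2) A) :
    Module.finrank (ZMod 2) ↥N = Module.finrank (ZMod 2) ↥(N.map f) +
      Module.finrank (ZMod 2) ↥(N ⊓ LinearMap.ker f) := by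
  rw [← LinearMap.finrank_range_add_finrank_ker (f ∘ₗ N.subtype), LinearMap.range_comp,
    Submodule.range_subtype]
  congr 1
  rw [LinearMap.ker_comp, (Submodule.equivMapOfInjective N.subtype N.injective_subtype _).finrank_eq,
    Submodule.map_comap_subtype]

/-- Pairs of flows which agree along the common side. -/
abbrev Matched {n : ℕ} {A A' : Type} [AddCommGroup A] [Module (ZMod 2) A] [AddCommGroup A']
    [Module (ZMod 2) A'] (d : A →ₗ[ZMod 2] Bdry n) (d' : A' →ₗ[ZMod 2] Bdry n) :
    Submodule (ZMod 2) (A × A') := LinearMap.ker (mismatch n ∘ₗ d.prodMap d')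

/-- Rank-nullity for the pair of boundary maps, restricted to the matched pairs with zero outer
boundary. The image consists of the matching boundary values which vanish outside, giving the
exponent in `compose`; the kernel is the product of the two spaces of flows without boundary, giving
the exponents of the two factors. -/
theorem weight_matched {n : ℕ} {A A' : Type} [AddCommGroup A] [Module (ZMod 2) A] [Finite A]
    [AddCommGroup A'] [Module (ZMod 2) A'] [Finite A'] (d : A →ₗ[ZMod 2] Bdry n)
    (d' : A' →ₗ[ZMod 2] Bdry n) (B : Submodule (ZMod 2) A) (B' : Submodule (ZMod 2) A') :
    weight (outer n ∘ₗ d.prodMap d' ∘ₗ (Matched d d').subtype)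
      ((B.prod B').comap (Matched d d').subtype) = compose n (weight d B) (weight d' B') := by
  set D := d.prodMap d'
  set K := Matched d d'
  have hm : ((B.prod B').comap K.subtype).map (outer n ∘ₗ D ∘ₗ K.subtype) =
      (((B.map d).prod (B'.map d')) ⊓ LinearMap.ker (mismatch n)).map (outer n) := by
    rw [Submodule.map_comp, Submodule.map_comp, Submodule.map_comap_subtype]
    congr 1
    ext ⟨b, b'⟩
    simp only [Submodule.mem_map, Submodule.mem_inf, LinearMap.mem_ker, K, D, Submodule.mem_prod,
      Prod.exists, LinearMap.comp_apply, LinearMap.prodMap_apply, Prod.mk.injEq]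
    constructor
    · rintro ⟨a, a', ⟨h, hB, hB'⟩, rfl, rfl⟩
      exact ⟨⟨⟨a, hB, rfl⟩, a', hB', rfl⟩, h⟩
    · rintro ⟨⟨⟨a, hB, rfl⟩, a', hB', rfl⟩, h⟩
      exact ⟨a, a', ⟨h, hB, hB'⟩, rfl, rfl⟩
  have hk : Module.finrank (ZMod 2) ↥((B.prod B').comap K.subtype ⊓
      LinearMap.ker (outer n ∘ₗ D ∘ₗ K.subtype)) =
      Module.finrank (ZMod 2) ↥((B.map d).prod (B'.map d') ⊓ LinearMap.ker (mismatch n) ⊓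
        LinearMap.ker (outer n)) + (Module.finrank (ZMod 2) ↥(B ⊓ LinearMap.ker d) +
          Module.finrank (ZMod 2) ↥(B' ⊓ LinearMap.ker d')) := by
    rw [(Submodule.equivMapOfInjective K.subtype K.injective_subtype _).finrank_eq,
      finrank_map_add_finrank_inf_ker D, ← finrank_submodule_prod (B ⊓ LinearMap.ker d)]
    refine congrArg₂ (fun (p : Submodule (ZMod 2) (Bdry n × Bdry n)) (q : ℕ) => Module.finrank (ZMod 2) ↥p + q) ?_
      (congrArg (fun p : Submodule (ZMod 2) (A × A') => Module.finrank (ZMod 2) ↥p) ?_)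
    · ext ⟨b, b'⟩
      simp only [Submodule.mem_map, Submodule.mem_inf, LinearMap.mem_ker, K, D, Submodule.mem_prod,
        Submodule.mem_comap, Subtype.exists,
        Prod.exists, LinearMap.comp_apply, LinearMap.prodMap_apply, Prod.mk.injEq,
        Submodule.subtype_apply]
      constructor
      · rintro ⟨a, a', ⟨_, _, h, ⟨⟨hB, hB'⟩, h'⟩, e⟩, rfl, rfl⟩
        obtain ⟨rfl, rfl⟩ := e
        exact ⟨⟨⟨⟨_, hB, rfl⟩, _, hB', rfl⟩, h⟩, h'⟩
      · rintro ⟨⟨⟨⟨a, hB, rfl⟩, a', hB', rfl⟩, h⟩, h'⟩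
        exact ⟨a, a', ⟨a, a', h, ⟨⟨hB, hB'⟩, h'⟩, rfl, rfl⟩, rfl, rfl⟩
    · ext ⟨a, a'⟩
      simp only [Submodule.mem_map, Submodule.mem_inf, LinearMap.mem_ker, K, D, Submodule.mem_prod,
        Submodule.mem_comap, Subtype.exists,
        Prod.exists, LinearMap.comp_apply, LinearMap.prodMap_apply, Prod.mk.injEq,
        Submodule.subtype_apply, Prod.mk_eq_zero]
      constructor
      · rintro ⟨⟨_, _, h, ⟨⟨hB, hB'⟩, h'⟩, e⟩, h1, h2⟩
        obtain ⟨rfl, rfl⟩ := e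
        exact ⟨⟨hB, h1⟩, hB', h2⟩
      · rintro ⟨⟨hB, h1⟩, hB', h2⟩
        have e : (d a, d' a') = 0 := by rw [h1, h2]; rfl
        exact ⟨⟨a, a', (congrArg (mismatch n) e).trans (map_zero _), ⟨⟨hB, hB'⟩, by rw [e, map_zero]⟩, rfl, rfl⟩, h1, h2⟩
  unfold weight
  rw [hm, hk, compose, Finsupp.linearCombination_single, LinearMap.smul_apply,
    Finsupp.linearCombination_single, Finsupp.smul_single, Finsupp.smul_single, pow_add, pow_add]
  congr 1
  simp only [smul_eq_mul]
  ring

/-- A set of coordinates in `H ⊕ H'` is a pair of sets, its sign is the product of their signs, and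
`compose` is bilinear; so the claim reduces to `weight_matched` term by term. -/
theorem stateSum_matched {n : ℕ} {H H' A A' : Type} [Finite H] [Finite H'] [AddCommGroup A]
    [Module (ZMod 2) A] [Finite A] [AddCommGroup A'] [Module (ZMod 2) A'] [Finite A']
    (φ : A →ₗ[ZMod 2] H → ZMod 2) (φ' : A' →ₗ[ZMod 2] H' → ZMod 2) (d : A →ₗ[ZMod 2] Bdry n)
    (d' : A' →ₗ[ZMod 2] Bdry n) (ψ : ↥(Matched d d') →ₗ[ZMod 2] H ⊕ H' → ZMod 2)
    (hl : ∀ a h, ψ a (Sum.inl h) = φ a.1.1 h) (hr : ∀ a h, ψ a (Sum.inr h) = φ' a.1.2 h) :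
    stateSum ψ (outer n ∘ₗ d.prodMap d' ∘ₗ (Matched d d').subtype) =
      compose n (stateSum φ d) (stateSum φ' d') := by
  classical
  have := Fintype.ofFinite H
  have := Fintype.ofFinite H'
  rw [stateSum_eq, stateSum_eq, stateSum_eq]
  simp only [map_sum, LinearMap.sum_apply]
  rw [Finset.sum_comm, ← Finset.sum_product', Finset.univ_product_univ]
  symm
  refine Fintype.sum_equiv (Finset.sumEquiv (α := H) (β := H')).symm.toEquiv _ _ ?_
  rintro ⟨S, S'⟩
  simp only [map_zsmul, LinearMap.smul_apply]
  rw [← weight_matched, smul_smul]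
  change _ = (-1 : ℤ) ^ (S.disjSum S').card • weight _ (vanishing ψ (S.disjSum S'))
  rw [Finset.card_disjSum, pow_add, mul_comm]
  congr 2
  ext ⟨⟨a, a'⟩, ha⟩
  simp [mem_vanishing, hl, hr]

end

/-! ### Mod 2 flows on drawings and the state sum as an invariant -/

noncomputable section
namespace Drawing

variable {n : ℕ} (X : Drawing n)

/-- The mod 2 flows on a drawing. -/
def flows : Submodule (ZMod 2) (X.H → ZMod 2) where
  carrier := {f | (∀ h, f (X.rev h) = f h) ∧ ∀ v, ∑ᶠ h ∈ {h | X.src h = Sum.inl v}, f h = 0}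
  add_mem' := by
    rintro f g ⟨hf, hf'⟩ ⟨hg, hg'⟩
    refine ⟨fun h => by simp [hf, hg], fun v => ?_⟩
    simp only [Pi.add_apply]
    rw [finsum_mem_add_distrib (Set.toFinite _), hf', hg', add_zero]
  zero_mem' := ⟨fun h => rfl, fun v => by simp⟩
  smul_mem' := by
    rintro c f ⟨hf, hf'⟩
    refine ⟨fun h => by simp [hf], fun v => ?_⟩
    simp only [Pi.smul_apply]
    rw [← smul_finsum_mem (Set.toFinite _), hf', smul_zero]

/-- The boundary values of flows. -/
def flowBdry : X.flows →ₗ[ZMod 2] Bdry n :=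
  LinearMap.funLeft (ZMod 2) (ZMod 2) X.mark ∘ₗ X.flows.subtype

/-- The state sum of a drawing. -/
def flowSum : StateSpace n := stateSum X.flows.subtype X.flowBdry

/-! ### Forgetting smooth points -/

theorem eq_of_fixed {t z : X.H} (ht : X.next t = t) (hz : X.src z = X.src t) : z = t :=
  ((orbit_iff_closed X.next X.src).1 X.orbit).2 {t} (by rintro _ rfl; exact ht) t z rfl hz

theorem fiber_eq_pair {v : X.V} (hv : {h | X.src h = Sum.inl v}.ncard = 2) {x : X.H}
    (hx : X.src x = Sum.inl v) : X.next x ≠ x ∧ {h | X.src h = Sum.inl v} = {x, X.next x} := by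
  have hne : X.next x ≠ x := by
    intro e
    have : {h | X.src h = Sum.inl v} = {x} := by
      ext z
      exact ⟨fun hz => X.eq_of_fixed e (hz.trans hx.symm), fun hz => by rw [hz]; exact hx⟩
    rw [this, Set.ncard_singleton] at hv
    cases hv
  refine ⟨hne, (Set.eq_of_subset_of_ncard_le ?_ ?_).symm⟩
  · rintro z (rfl | rfl)
    · exact hx
    · exact (X.src_next x).trans hx
  · rw [hv, Set.ncard_pair hne.symm]

/-- Conservation at a 2-valent point says that two values have sum zero, which in characteristic two
makes them equal. -/
theorem flow_next {f : X.H → ZMod 2} (hf : f ∈ X.flows) {v : X.V}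
    (hv : {h | X.src h = Sum.inl v}.ncard = 2) {x : X.H} (hx : X.src x = Sum.inl v) :
    f (X.next x) = f x := by
  obtain ⟨hne, he⟩ := X.fiber_eq_pair hv hx
  have := hf.2 v
  rw [he, finsum_mem_pair hne.symm, CharTwo.add_eq_zero] at this
  exact this.symm

/-- A flow passes unchanged through a forgotten point, so flows on `X` and on `Y` correspond. The
map `p` sends each half-edge of `X` to a half-edge of `Y` which carries the same value; restriction
along `c.onH` and pullback along `p` are inverse to each other, and `stateSum_surj` applies to `p`.
-/
theorem Coarsening.flowSum_eq {X Y : Drawing n} (c : Coarsening X Y) : X.flowSum = Y.flowSum := by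
  have hex : ∀ x, ∃ y, c.onH y = x ∨ (x ∉ Set.range c.onH ∧ c.onH y = X.rev x) := by
    intro x
    by_cases hx : x ∈ Set.range c.onH
    · obtain ⟨y, hy⟩ := hx
      exact ⟨y, Or.inl hy⟩
    · have hx' := hx
      rw [c.rangeH] at hx'
      push Not at hx'
      obtain ⟨v, hv, e⟩ := hx'
      -- A half-edge at a forgotten point is represented by the other half of its edge, which
      -- survives because no two neighbouring points are forgotten.
      obtain ⟨y, hy⟩ := (c.rangeH (X.rev x)).2 fun w hw => c.gone_apart x v hv w hw e
      exact ⟨y, Or.inr ⟨hx, hy⟩⟩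
  choose p hp using hex
  have p_on : ∀ y, p (c.onH y) = y := fun y =>
    (hp (c.onH y)).elim (fun e => c.injH e) fun e => absurd ⟨y, rfl⟩ e.1
  have p_out : ∀ x, x ∉ Set.range c.onH → c.onH (p x) = X.rev x := fun x hx =>
    (hp x).elim (fun e => absurd ⟨_, e⟩ hx) fun e => e.2
  have out : ∀ x, ∀ v ∈ c.gone, X.src x = Sum.inl v → x ∉ Set.range c.onH := fun x v hv e hx =>
    (c.rangeH x).1 hx v hv e
  have fib : ∀ v, {x | X.src x = Sum.inl (c.onV v)} = c.onH '' {y | Y.src y = Sum.inl v} := by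
    intro v
    ext x
    constructor
    · intro hx
      obtain ⟨y, rfl⟩ := (c.rangeH x).2 fun w hw e => by
        have := Sum.inl_injective (hx.symm.trans e)
        exact (c.rangeV (c.onV v)).1 ⟨v, rfl⟩ (this ▸ hw)
      refine ⟨y, ?_, rfl⟩
      change X.src _ = _ at hx
      rw [c.src_eq] at hx
      rcases hy : Y.src y with u | m <;> rw [hy] at hx
      · exact hy.trans (congrArg Sum.inl (c.injV (Sum.inl_injective hx)))
      · cases hx
    · rintro ⟨y, hy, rfl⟩
      change X.src _ = _
      rw [c.src_eq, hy]
      rfl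
  have hsum : ∀ (f : X.H → ZMod 2) v, ∑ᶠ x ∈ {x | X.src x = Sum.inl (c.onV v)}, f x =
      ∑ᶠ y ∈ {y | Y.src y = Sum.inl v}, f (c.onH y) := by
    intro f v
    rw [fib, finsum_mem_image c.injH.injOn]
  have fwd : ∀ f ∈ X.flows, f ∘ c.onH ∈ Y.flows := by
    intro f hf
    refine ⟨fun y => ?_, fun v => (hsum f v).symm.trans (hf.2 _)⟩
    simp only [Function.comp]
    by_cases hg : ∀ v ∈ c.gone, X.src (X.rev (c.onH y)) ≠ Sum.inl v
    · rw [c.rev_eq y hg, hf.1]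
    · push Not at hg
      obtain ⟨v, hv, e⟩ := hg
      rw [c.rev_gone y v hv e, hf.1, X.flow_next hf (X.smooth_two v (c.gone_smooth v hv)) e, hf.1]
  have bwd : ∀ g ∈ Y.flows, g ∘ p ∈ X.flows := by
    intro g hg
    refine ⟨fun x => ?_, fun v => ?_⟩
    · simp only [Function.comp]
      by_cases hx : x ∈ Set.range c.onH
      · obtain ⟨y, rfl⟩ := hx
        rw [p_on]
        by_cases hr : X.rev (c.onH y) ∈ Set.range c.onH
        · rw [c.rangeH] at hr
          rw [← c.rev_eq y hr, p_on, hg.1]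
        · have := p_out _ hr
          rw [X.rev_rev] at this
          rw [c.injH this]
      · rw [← p_out x hx, p_on]
    · by_cases hv : v ∈ c.gone
      · by_cases hx : ∃ x, X.src x = Sum.inl v
        · obtain ⟨x, hx⟩ := hx
          -- The two half-edges at the forgotten point are represented by the two halves of the
          -- merged edge, on which `g` agrees; their sum vanishes mod 2.
          obtain ⟨hne, he⟩ := X.fiber_eq_pair (X.smooth_two v (c.gone_smooth v hv)) hx
          rw [he, finsum_mem_pair hne.symm, CharTwo.add_eq_zero]
          simp only [Function.comp]
          have e1 := p_out x (out x v hv hx)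
          have e2 := p_out (X.next x) (out _ v hv ((X.src_next x).trans hx))
          have e3 := c.rev_gone (p x) v hv (by rw [e1, X.rev_rev]; exact hx)
          rw [e1, X.rev_rev, ← e2] at e3
          rw [← c.injH e3, hg.1]
        · push Not at hx
          refine finsum_mem_eq_zero_of_forall_eq_zero fun x hx' => absurd hx' (hx x)
      · obtain ⟨u, rfl⟩ := (c.rangeV v).2 hv
        rw [hsum]
        simp only [Function.comp, p_on]
        exact hg.2 u
  have fp : ∀ f ∈ X.flows, ∀ x, f (c.onH (p x)) = f x := by
    intro f hf x
    rcases hp x with e | ⟨-, e⟩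
    · rw [e]
    · rw [e, hf.1]
  let e : X.flows ≃ₗ[ZMod 2] Y.flows :=
    { toFun := fun f => ⟨f.1 ∘ c.onH, fwd f.1 f.2⟩
      invFun := fun g => ⟨g.1 ∘ p, bwd g.1 g.2⟩
      map_add' := fun _ _ => rfl
      map_smul' := fun _ _ => rfl
      left_inv := fun f => Subtype.ext (funext fun x => fp f.1 f.2 x)
      right_inv := fun g => Subtype.ext (funext fun y => congrArg g.1 (p_on y)) }
  refine stateSum_surj e (p := p) (fun y => ⟨_, p_on y⟩) _ _ _ _ (fun f x => ?_) (fun f => ?_)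
  · exact (fp f.1 f.2 x).symm
  · funext m
    exact congrArg f.1 (c.mark_eq m).symm

/-! ### Contraction and deletion -/

/-- The restriction to the half-edges other than `h` and `rev h`. -/
def restrictCut (h : X.H) : (X.H → ZMod 2) →ₗ[ZMod 2] Cut h (X.rev h) → ZMod 2 :=
  LinearMap.funLeft (ZMod 2) (ZMod 2) Subtype.val

open Classical in
theorem finsum_cut (h : X.H) (s : Set X.H) (f : X.H → ZMod 2) :
    ∑ᶠ x ∈ s, f x = ∑ᶠ x ∈ {x : Cut h (X.rev h) | x.1 ∈ s}, f x.1 +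
      ((if h ∈ s then f h else 0) + if X.rev h ∈ s then f (X.rev h) else 0) := by
  have hs : s = Subtype.val '' {x : Cut h (X.rev h) | x.1 ∈ s} ∪ (s ∩ {h, X.rev h}) := by
    ext x
    simp only [Set.mem_union, Set.mem_image, Set.mem_ofPred_eq, Subtype.exists, exists_and_right,
      exists_eq_right, exists_prop, Set.mem_inter_iff, Set.mem_insert_iff, Set.mem_singleton_iff]
    tauto
  have hd : Disjoint (Subtype.val '' {x : Cut h (X.rev h) | x.1 ∈ s}) (s ∩ {h, X.rev h}) := by
    rw [Set.disjoint_left]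
    rintro _ ⟨x, hx, rfl⟩ ⟨-, e | e⟩
    · exact x.2.1 e
    · exact x.2.2 e
  conv_lhs => rw [hs]
  rw [finsum_mem_union hd (Set.toFinite _) (Set.toFinite _),
    finsum_mem_image Subtype.val_injective.injOn]
  congr 1
  have hr := X.rev_ne h
  by_cases h1 : h ∈ s <;> by_cases h2 : X.rev h ∈ s
  · rw [Set.inter_eq_right.2 (by rintro _ (rfl | rfl) <;> assumption), finsum_mem_pair hr.symm,
      if_pos h1, if_pos h2]
  · have : s ∩ {h, X.rev h} = {h} := by ext x; grind
    rw [this, finsum_mem_singleton, if_pos h1, if_neg h2, add_zero]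
  · have : s ∩ {h, X.rev h} = {X.rev h} := by ext x; grind
    rw [this, finsum_mem_singleton, if_neg h1, if_pos h2, zero_add]
  · have : s ∩ {h, X.rev h} = ∅ := by ext x; grind
    rw [this, finsum_mem_empty, if_neg h1, if_neg h2, zero_add]

/-- The flow out of a point along the half-edges other than `h` and `rev h`. -/
def cutSum (h : X.H) (g : Cut h (X.rev h) → ZMod 2) (v : X.V) : ZMod 2 :=
  ∑ᶠ x ∈ {x : Cut h (X.rev h) | X.src x.1 = Sum.inl v}, g x

-- The value on the edge of `h` enters the conservation law at a point once for each end of the edge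
-- at that point. For a loop it enters twice and disappears mod 2, which is the difference between
-- the two edge relations.
open Classical in
theorem mem_flows_cut {h : X.H} {v w : X.V} (hv : X.src h = Sum.inl v)
    (hw : X.src (X.rev h) = Sum.inl w) {f : X.H → ZMod 2} : f ∈ X.flows ↔ f (X.rev h) = f h ∧
      (∀ x : Cut h (X.rev h), f (X.rev x.1) = f x.1) ∧
      ∀ u, X.cutSum h (X.restrictCut h f) u + ((if v = u then f h else 0) +
        if w = u then f h else 0) = 0 := by
  have key : ∀ u, f (X.rev h) = f h → ∑ᶠ x ∈ {x | X.src x = Sum.inl u}, f x =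
      X.cutSum h (X.restrictCut h f) u + ((if v = u then f h else 0) +
        if w = u then f h else 0) := by
    intro u e
    rw [X.finsum_cut h]
    simp only [Set.mem_ofPred_eq, hv, hw, Sum.inl.injEq, e]
    rfl
  constructor
  · rintro ⟨h1, h2⟩
    exact ⟨h1 h, fun x => h1 x.1, fun u => (key u (h1 h)).symm.trans (h2 u)⟩
  · rintro ⟨h1, h2, h3⟩
    refine ⟨fun x => ?_, fun u => (key u h1).trans (h3 u)⟩
    by_cases hx : x ≠ h ∧ x ≠ X.rev h
    · exact h2 ⟨x, hx⟩
    · have : x = h ∨ x = X.rev h := by tauto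
      rcases this with rfl | rfl
      · exact h1
      · rw [X.rev_rev, h1]

open Classical in
/-- The extension of `g` with the value `t` on the edge of `h`. -/
def extendCut (h : X.H) (g : Cut h (X.rev h) → ZMod 2) (t : ZMod 2) (x : X.H) : ZMod 2 :=
  if hx : x ≠ h ∧ x ≠ X.rev h then g ⟨x, hx⟩ else t

theorem extendCut_cut (h : X.H) (g : Cut h (X.rev h) → ZMod 2) (t : ZMod 2)
    (x : Cut h (X.rev h)) : X.extendCut h g t x.1 = g x := dif_pos x.2

theorem extendCut_self (h : X.H) (g : Cut h (X.rev h) → ZMod 2) (t : ZMod 2) :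
    X.extendCut h g t h = t := dif_neg (by simp)

theorem extendCut_rev (h : X.H) (g : Cut h (X.rev h) → ZMod 2) (t : ZMod 2) :
    X.extendCut h g t (X.rev h) = t := dif_neg (by simp)

theorem restrictCut_extendCut (h : X.H) (g : Cut h (X.rev h) → ZMod 2) (t : ZMod 2) :
    X.restrictCut h (X.extendCut h g t) = g := funext fun x => X.extendCut_cut h g t x

theorem ext_cut {h : X.H} {f f' : X.H → ZMod 2} (hf : f ∈ X.flows) (hf' : f' ∈ X.flows)
    (e : f h = f' h) (e' : X.restrictCut h f = X.restrictCut h f') : f = f' := by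
  funext x
  by_cases hx : x ≠ h ∧ x ≠ X.rev h
  · exact congrFun e' ⟨x, hx⟩
  · have : x = h ∨ x = X.rev h := by tauto
    rcases this with rfl | rfl
    · exact e
    · rw [hf.1, hf'.1, e]

open Classical in
theorem extendCut_mem {h : X.H} {v w : X.V} (hv : X.src h = Sum.inl v)
    (hw : X.src (X.rev h) = Sum.inl w) {g : Cut h (X.rev h) → ZMod 2} {t : ZMod 2} :
    X.extendCut h g t ∈ X.flows ↔
      (∀ x : Cut h (X.rev h), g ⟨X.rev x.1, X.rev_cut x.2⟩ = g x) ∧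
      ∀ u, X.cutSum h g u + ((if v = u then t else 0) + if w = u then t else 0) = 0 := by
  rw [X.mem_flows_cut hv hw]
  simp only [extendCut_self, extendCut_rev, restrictCut_extendCut, true_and]
  refine and_congr_left fun _ => forall_congr' fun x => ?_
  rw [← X.extendCut_cut h g t x, ← X.extendCut_cut h g t ⟨X.rev x.1, X.rev_cut x.2⟩]

theorem mem_flows_delete {h : X.H} {hin : X.IsInner h} {g : Cut h (X.rev h) → ZMod 2} :
    g ∈ (X.delete h hin).flows ↔
      (∀ x : Cut h (X.rev h), g ⟨X.rev x.1, X.rev_cut x.2⟩ = g x) ∧ ∀ u, X.cutSum h g u = 0 := Iff.rfl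

/-- The half-edges at the glued vertex are the disjoint union of the remaining ones at `v` and at
`w`; elsewhere nothing changes. -/
theorem mem_flows_contract {h : X.H} {hin : X.IsInner h} {hl : ¬ X.IsLoop h} {v w : X.V}
    (hv : X.src h = Sum.inl v) (hw : X.src (X.rev h) = Sum.inl w)
    {g : Cut h (X.rev h) → ZMod 2} : g ∈ (X.contract h hin hl).flows ↔
      (∀ x : Cut h (X.rev h), g ⟨X.rev x.1, X.rev_cut x.2⟩ = g x) ∧
      X.cutSum h g v + X.cutSum h g w = 0 ∧ ∀ u, u ≠ v → u ≠ w → X.cutSum h g u = 0 := by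
  have hvw : v ≠ w := fun e => hl (by unfold IsLoop; rw [hv, hw, e])
  have h1 : ∀ u, u ≠ v → u ≠ w → ∑ᶠ x ∈ {x : Cut h (X.rev h) | X.gluedSrc h x.1 =
      Sum.inl (Quot.mk _ u)}, g x = X.cutSum h g u := by
    intro u hu hu'
    unfold cutSum
    refine finsum_mem_congr (Set.ext fun x => ?_) fun _ _ => rfl
    refine ⟨fun e => ?_, X.gluedSrc_of⟩
    obtain ⟨t, ht, e⟩ := X.gluedSrc_inl e
    rw [X.glued_eq hv hw] at e
    grind
  have hq : (Quot.mk _ v : X.Glued h) = Quot.mk _ w := Quot.sound ⟨hv, hw⟩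
  have h2 : ∑ᶠ x ∈ {x : Cut h (X.rev h) | X.gluedSrc h x.1 = Sum.inl (Quot.mk _ v)}, g x =
      X.cutSum h g v + X.cutSum h g w := by
    unfold cutSum
    rw [← finsum_mem_union _ (Set.toFinite _) (Set.toFinite _)]
    · refine finsum_mem_congr (Set.ext fun x => ?_) fun _ _ => rfl
      constructor
      · intro e
        obtain ⟨t, ht, e⟩ := X.gluedSrc_inl e
        rw [X.glued_eq hv hw] at e
        simp only [Set.mem_union, Set.mem_ofPred_eq]
        grind
      · rintro (e | e)
        · exact X.gluedSrc_of e
        · rw [hq]; exact X.gluedSrc_of e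
    · rw [Set.disjoint_left]
      intro x e1 e2
      exact hvw (Sum.inl_injective (e1.symm.trans e2))
  refine and_congr_right fun _ => ⟨fun hg => ⟨h2.symm.trans (hg _), fun u hu hu' =>
    (h1 u hu hu').symm.trans (hg _)⟩, ?_⟩
  rintro ⟨ha, hb⟩ q
  induction q using Quot.ind with
  | mk u =>
    by_cases e1 : u = v
    · subst e1; exact h2.trans ha
    · by_cases e2 : u = w
      · subst e2
        have := h2.trans ha
        rwa [hq] at this
      · exact (h1 u e1 e2).trans (hb u e1 e2)

open Classical in
/-- The coordinates of flows with the two halves of the edge of `h` identified. -/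
def optionFlow (h : X.H) : X.flows →ₗ[ZMod 2] Option (Cut h (X.rev h)) → ZMod 2 :=
  LinearMap.funLeft (ZMod 2) (ZMod 2) (fun x => x.elim h Subtype.val) ∘ₗ X.flows.subtype

/-- With both halves of the edge collapsed to the coordinate `none`, the edge can be split off by
`stateSum_option`. -/
theorem flowSum_option (h : X.H) : X.flowSum = stateSum (X.optionFlow h) X.flowBdry := by
  classical
  refine stateSum_surj (LinearEquiv.refl _ _)
    (p := fun x => if hx : x ≠ h ∧ x ≠ X.rev h then some ⟨x, hx⟩ else none) ?_ _ _ _ _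
    (fun f x => ?_) (fun _ => rfl)
  · rintro (_ | x)
    · exact ⟨h, dif_neg (by simp)⟩
    · exact ⟨x.1, dif_pos x.2⟩
  · split_ifs with hx
    · rfl
    · have : x = h ∨ x = X.rev h := by tauto
      rcases this with rfl | rfl
      · rfl
      · exact f.2.1 h

/-- Flows after deletion are the flows which vanish on the edge: restriction and extension by zero
are inverse. This is the subtracted term of `stateSum_option`. -/
theorem flowSum_delete {h : X.H} (hin : X.IsInner h) : (X.delete h hin).flowSum =
    stateSum (LinearMap.funLeft (ZMod 2) (ZMod 2) some ∘ₗ X.optionFlow h ∘ₗ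
        (LinearMap.ker (LinearMap.proj none ∘ₗ X.optionFlow h)).subtype)
        (X.flowBdry ∘ₗ (LinearMap.ker (LinearMap.proj none ∘ₗ X.optionFlow h)).subtype) := by
  classical
  obtain ⟨v, w, hv, hw, -⟩ := id hin
  symm
  let e : LinearMap.ker (LinearMap.proj none ∘ₗ X.optionFlow h) ≃ₗ[ZMod 2]
      (X.delete h hin).flows :=
    { toFun := fun f => ⟨X.restrictCut h f.1.1, by
        obtain ⟨-, h2, h3⟩ := (X.mem_flows_cut hv hw).1 f.1.2
        refine X.mem_flows_delete.2 ⟨h2, fun u => ?_⟩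
        have := h3 u
        have e0 : f.1.1 h = 0 := f.2
        simpa [e0] using this⟩
      invFun := fun g => ⟨⟨X.extendCut h g.1 0, by
        obtain ⟨h1, h2⟩ := X.mem_flows_delete.1 g.2
        refine (X.extendCut_mem hv hw).2 ⟨h1, fun u => ?_⟩
        rw [h2]
        simp⟩, X.extendCut_self h g.1 0⟩
      map_add' := fun _ _ => rfl
      map_smul' := fun _ _ => rfl
      left_inv := fun f => Subtype.ext (Subtype.ext (by
        have hm : X.extendCut h (X.restrictCut h f.1.1) 0 ∈ X.flows := by
          rw [X.extendCut_mem hv hw]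
          obtain ⟨-, h2, h3⟩ := (X.mem_flows_cut hv hw).1 f.1.2
          refine ⟨h2, fun u => ?_⟩
          have e0 : f.1.1 h = 0 := f.2
          have := h3 u
          rwa [e0] at this
        refine X.ext_cut hm f.1.2 ?_ (X.restrictCut_extendCut h _ _)
        exact (X.extendCut_self _ _ _).trans f.2.symm))
      right_inv := fun g => Subtype.ext (X.restrictCut_extendCut h _ _) }
  exact stateSum_surj e (p := id) Function.surjective_id _ _ _ _ (fun _ _ => rfl) (fun _ => rfl)

/-- For an edge which is not a loop, conservation at `v` determines the value on the edge from the
other values, and conservation at `w` then becomes the condition at the glued vertex. So flows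
without any condition of being nonzero on the edge are the flows of the contraction. -/
theorem flowSum_contraction_deletion {h : X.H} (hin : X.IsInner h) (hl : ¬ X.IsLoop h) :
    X.flowSum = (X.contract h hin hl).flowSum - (X.delete h hin).flowSum := by
  classical
  obtain ⟨v, w, hv, hw, -⟩ := id hin
  have hvw : v ≠ w := fun e => hl (by unfold IsLoop; rw [hv, hw, e])
  rw [X.flowSum_option h, stateSum_option, ← X.flowSum_delete hin]
  congr 1
  have char : ∀ g t, X.extendCut h g t ∈ X.flows ↔
      g ∈ (X.contract h hin hl).flows ∧ t = X.cutSum h g v := by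
    intro g t
    rw [X.extendCut_mem hv hw, X.mem_flows_contract hv hw, and_assoc]
    refine and_congr_right fun _ => ⟨fun hu => ?_, ?_⟩
    · have h1 := hu v
      have h2 := hu w
      rw [if_pos rfl, if_neg hvw.symm, add_zero, CharTwo.add_eq_zero] at h1
      rw [if_neg hvw, if_pos rfl, zero_add, CharTwo.add_eq_zero] at h2
      refine ⟨⟨by rw [h1, h2, CharTwo.add_self_eq_zero], fun u hv' hw' => ?_⟩, h1.symm⟩
      have h3 := hu u
      rwa [if_neg (Ne.symm hv'), if_neg (Ne.symm hw'), add_zero, add_zero] at h3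
    · rintro ⟨⟨h1, h2⟩, rfl⟩ u
      rw [CharTwo.add_eq_zero] at h1
      by_cases e1 : v = u
      · subst e1
        rw [if_pos rfl, if_neg hvw.symm, add_zero, CharTwo.add_self_eq_zero]
      · by_cases e2 : w = u
        · subst e2
          rw [if_neg hvw, if_pos rfl, zero_add, h1, CharTwo.add_self_eq_zero]
        · rw [if_neg e1, if_neg e2, h2 u (Ne.symm e1) (Ne.symm e2), add_zero, add_zero]
  have back : ∀ f ∈ X.flows, X.extendCut h (X.restrictCut h f) (f h) = f := by
    intro f hf
    funext x
    unfold extendCut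
    split_ifs with hx
    · rfl
    · have : x = h ∨ x = X.rev h := by tauto
      rcases this with rfl | rfl
      · rfl
      · exact (hf.1 h).symm
  have char' : ∀ f ∈ X.flows, X.restrictCut h f ∈ (X.contract h hin hl).flows ∧
      f h = X.cutSum h (X.restrictCut h f) v := fun f hf => (char _ _).1 (by rwa [back f hf])
  let e : X.flows ≃ₗ[ZMod 2] (X.contract h hin hl).flows :=
    { toFun := fun f => ⟨X.restrictCut h f.1, (char' f.1 f.2).1⟩
      invFun := fun g => ⟨X.extendCut h g.1 (X.cutSum h g.1 v), (char _ _).2 ⟨g.2, rfl⟩⟩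
      map_add' := fun _ _ => rfl
      map_smul' := fun _ _ => rfl
      left_inv := fun f => Subtype.ext (by
        change X.extendCut h (X.restrictCut h f.1) _ = f.1
        rw [← (char' f.1 f.2).2, back f.1 f.2])
      right_inv := fun g => Subtype.ext (X.restrictCut_extendCut h _ _) }
  exact stateSum_surj e (p := id) Function.surjective_id _ _ _ _ (fun _ _ => rfl) (fun _ => rfl)

/-- The value on a loop is arbitrary. As a free coordinate it contributes the factor `Q`, and
subtracting the flows which vanish on the loop leaves `Q - 1`. -/
theorem flowSum_loop {h : X.H} (hin : X.IsInner h) (hl : X.IsLoop h) :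
    X.flowSum = (indetQ - 1) • (X.delete h hin).flowSum := by
  classical
  obtain ⟨v, w, hv, hw, -⟩ := id hin
  obtain rfl : v = w := Sum.inl_injective (hv.symm.trans (Eq.trans hl hw))
  rw [sub_smul, one_smul, X.flowSum_option h, stateSum_option, ← X.flowSum_delete hin]
  congr 1
  have char : ∀ g t, X.extendCut h g t ∈ X.flows ↔ g ∈ (X.delete h hin).flows := by
    intro g t
    rw [X.extendCut_mem hv hw, X.mem_flows_delete]
    refine and_congr_right fun _ => forall_congr' fun u => ?_
    rw [CharTwo.add_self_eq_zero, add_zero]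
  have back : ∀ f ∈ X.flows, X.extendCut h (X.restrictCut h f) (f h) = f := by
    intro f hf
    funext x
    unfold extendCut
    split_ifs with hx
    · rfl
    · have : x = h ∨ x = X.rev h := by tauto
      rcases this with rfl | rfl
      · rfl
      · exact (hf.1 h).symm
  have char' : ∀ f ∈ X.flows, X.restrictCut h f ∈ (X.delete h hin).flows :=
    fun f hf => (char _ (f h)).1 (by rwa [back f hf])
  let e : X.flows ≃ₗ[ZMod 2] ZMod 2 × (X.delete h hin).flows :=
    { toFun := fun f => (f.1 h, ⟨X.restrictCut h f.1, char' f.1 f.2⟩)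
      invFun := fun g => ⟨X.extendCut h g.2.1 g.1, (char _ _).2 g.2.2⟩
      map_add' := fun _ _ => rfl
      map_smul' := fun _ _ => rfl
      left_inv := fun f => Subtype.ext (back f.1 f.2)
      right_inv := fun g => Prod.ext (X.extendCut_self _ _ _)
        (Subtype.ext (X.restrictCut_extendCut h _ _)) }
  have : Finite (X.delete h hin).flows := inferInstance
  unfold flowSum
  rw [← stateSum_prod]
  exact stateSum_surj e (p := id) Function.surjective_id _ _ _ _ (fun _ _ => rfl) (fun _ => rfl)

/-! ### Stacking -/

/-- The points on the common side are 2-valent, so conservation there is precisely the agreement of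
the boundary values of the two parts. -/
theorem mem_flows_stack (Y : Drawing n) {f : X.H ⊕ Y.H → ZMod 2} : f ∈ (X.stack Y).flows ↔
    (fun x => f (Sum.inl x)) ∈ X.flows ∧ (fun y => f (Sum.inr y)) ∈ Y.flows ∧
      ∀ i, f (Sum.inl (X.mark (Mark.bot i))) = f (Sum.inr (Y.mark (Mark.top i))) := by
  have hl : ∀ v, ∑ᶠ h ∈ {h | X.stackSrc Y h = Sum.inl (Sum.inl (Sum.inl v))}, f h =
      ∑ᶠ x ∈ {x | X.src x = Sum.inl v}, f (Sum.inl x) := by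
    intro v
    have := X.stack_at_left Y (fun _ => True) v
    simp only [true_and] at this
    rw [this, finsum_mem_image Sum.inl_injective.injOn]
  have hr : ∀ v, ∑ᶠ h ∈ {h | X.stackSrc Y h = Sum.inl (Sum.inl (Sum.inr v))}, f h =
      ∑ᶠ x ∈ {x | Y.src x = Sum.inl v}, f (Sum.inr x) := by
    intro v
    have := X.stack_at_right Y (fun _ => True) v
    simp only [true_and] at this
    rw [this, finsum_mem_image Sum.inr_injective.injOn]
  have hm : ∀ i, ∑ᶠ h ∈ {h | X.stackSrc Y h = Sum.inl (Sum.inr i)}, f h =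
      f (Sum.inl (X.mark (Mark.bot i))) + f (Sum.inr (Y.mark (Mark.top i))) := by
    intro i
    have : {h | X.stackSrc Y h = Sum.inl (Sum.inr i)} =
        {Sum.inl (X.mark (Mark.bot i)), Sum.inr (Y.mark (Mark.top i))} :=
      Set.ext fun z => X.stack_at_mid Y i z
    rw [this, finsum_mem_pair (by simp)]
  constructor
  · rintro ⟨h1, h2⟩
    exact ⟨⟨fun x => h1 (Sum.inl x), fun v => (hl v).symm.trans (h2 _)⟩,
      ⟨fun x => h1 (Sum.inr x), fun v => (hr v).symm.trans (h2 _)⟩,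
      fun i => CharTwo.add_eq_zero.1 ((hm i).symm.trans (h2 _))⟩
  · rintro ⟨⟨h1, h2⟩, ⟨h3, h4⟩, h5⟩
    refine ⟨?_, ?_⟩
    · rintro (x | y)
      · exact h1 x
      · exact h3 y
    · rintro ((v | v) | i)
      · exact (hl v).trans (h2 v)
      · exact (hr v).trans (h4 v)
      · exact (hm i).trans (CharTwo.add_eq_zero.2 (h5 i))

theorem flowSum_stack (Y : Drawing n) :
    (X.stack Y).flowSum = compose n X.flowSum Y.flowSum := by
  let ψ : ↥(Matched X.flowBdry Y.flowBdry) →ₗ[ZMod 2] X.H ⊕ Y.H → ZMod 2 :=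
    { toFun := fun a => Sum.elim a.1.1.1 a.1.2.1
      map_add' := fun a b => by ext (x | x) <;> rfl
      map_smul' := fun c a => by ext (x | x) <;> rfl }
  unfold flowSum
  rw [← stateSum_matched _ _ _ _ ψ (fun _ _ => rfl) (fun _ _ => rfl)]
  let e : (X.stack Y).flows ≃ₗ[ZMod 2] Matched X.flowBdry Y.flowBdry :=
    { toFun := fun f => ⟨(⟨_, ((X.mem_flows_stack Y).1 f.2).1⟩, ⟨_, ((X.mem_flows_stack Y).1 f.2).2.1⟩),
        funext fun i => sub_eq_zero.2 (((X.mem_flows_stack Y).1 f.2).2.2 i)⟩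
      invFun := fun a => ⟨ψ a, (X.mem_flows_stack Y).2 ⟨a.1.1.2, a.1.2.2,
        fun i => sub_eq_zero.1 (congrFun a.2 i)⟩⟩
      map_add' := fun _ _ => rfl
      map_smul' := fun _ _ => rfl
      left_inv := fun f => Subtype.ext (by ext (x | x) <;> rfl)
      right_inv := fun a => rfl }
  refine stateSum_surj e (p := id) Function.surjective_id _ _ _ _ (fun f x => ?_) (fun f => ?_)
  · rcases x with x | x <;> rfl
  · ext (i | i) <;> rfl

end Drawing

/-! ### The state sum on the chromatic algebra -/

/-- The state sum of a diagram. -/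
def ChromaticDiagram.flowSum {n : ℕ} : ChromaticDiagram n → StateSpace n :=
  Quot.lift Drawing.flowSum fun _ _ ⟨c⟩ => c.flowSum_eq

/-- The state sum as a linear map. -/
def flowMap (n : ℕ) : FreeChromatic n →ₗ[CQ] StateSpace n :=
  Finsupp.linearCombination CQ ChromaticDiagram.flowSum ∘ₗ
    (MonoidAlgebra.coeffLinearEquiv CQ).toLinearMap

theorem flowMap_single {n : ℕ} (D : ChromaticDiagram n) (c : CQ) :
    flowMap n (MonoidAlgebra.single D c) = c • D.flowSum :=
  Finsupp.linearCombination_single _ _ _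

theorem flowMap_diag {n : ℕ} (X : Drawing n) : flowMap n (diag X) = X.flowSum := by
  rw [diag, flowMap_single, one_smul]
  rfl

theorem ChromaticDiagram.flowSum_mul {n : ℕ} (D E : ChromaticDiagram n) :
    (D * E).flowSum = compose n D.flowSum E.flowSum := by
  induction D using Quot.ind with
  | mk X => induction E using Quot.ind with
    | mk Y => exact X.flowSum_stack Y

/-- Only the fact that `compose` is bilinear matters: it makes the kernel of `flowMap` closed under
multiplication from both sides. -/
theorem flowMap_mul {n : ℕ} (a b : FreeChromatic n) :
    flowMap n (a * b) = compose n (flowMap n a) (flowMap n b) := by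
  induction a using MonoidAlgebra.induction_linear with
  | zero => simp
  | add a a' h h' => rw [add_mul, map_add, h, h', map_add, map_add, LinearMap.add_apply]
  | single D c =>
    induction b using MonoidAlgebra.induction_linear with
    | zero => simp
    | add b b' h h' => rw [mul_add, map_add, h, h', map_add, map_add]
    | single E c' =>
      rw [MonoidAlgebra.single_mul_single, flowMap_single, flowMap_single, flowMap_single,
        ChromaticDiagram.flowSum_mul, map_smul, map_smul, LinearMap.smul_apply, smul_smul, mul_comm]

/-- The kernel is one of the subspaces whose intersection defines the ideal. The third relation
holds because flows do not see which points are smooth. -/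
theorem chromaticIdeal_le_ker (n : ℕ) : chromaticIdeal n ≤ LinearMap.ker (flowMap n) := by
  refine sInf_le ⟨?_, ?_⟩
  · intro r hr
    rw [LinearMap.mem_ker]
    cases hr with
    | contraction_deletion X h hin hl =>
      rw [map_sub, map_sub, flowMap_diag, flowMap_diag, flowMap_diag,
        X.flowSum_contraction_deletion hin hl, sub_self]
    | loop X h hin hl =>
      rw [map_sub, map_smul, flowMap_diag, flowMap_diag, X.flowSum_loop hin hl, sub_self]
    | two_valent X v hv =>
      rw [map_sub, flowMap_diag, flowMap_diag, sub_eq_zero]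
      rfl
  · intro a x hx
    rw [LinearMap.mem_ker] at hx
    exact ⟨by rw [LinearMap.mem_ker, flowMap_mul, hx, map_zero],
      by rw [LinearMap.mem_ker, flowMap_mul, hx, map_zero, LinearMap.zero_apply]⟩

end

noncomputable section

/-! ### Noncrossing partitions without singletons -/

/-- `r` is (the equivalence relation of) a noncrossing partition of `{0, …, N - 1}` without
singletons. -/
structure NCRel (N : ℕ) (r : ℕ → ℕ → Prop) : Prop where
  lt : ∀ {a b}, r a b → a < N
  refl : ∀ {a}, a < N → r a a
  symm : ∀ {a b}, r a b → r b a
  trans : ∀ {a b c}, r a b → r b c → r a c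
  nc : ∀ {a b c d}, a < b → b < c → c < d → r a c → r b d → r a b
  partner : ∀ {a}, a < N → ∃ b, b ≠ a ∧ r a b

/-- The noncrossing partitions without singletons whose first `k` points lie in different blocks. -/
def ncSet (N k : ℕ) : Set (ℕ → ℕ → Prop) := {r | NCRel N r ∧ ∀ a b, a < k → b < k → r a b → a = b}

theorem finite_ncRel (N : ℕ) : {r | NCRel N r}.Finite := by
  refine Set.Finite.of_finite_image (f := fun r (a b : Fin N) => r a b) (Set.toFinite _) ?_
  intro r hr s hs e
  funext a b
  apply propext
  constructor
  · intro h
    exact (congrFun (congrFun e ⟨a, hr.lt h⟩) ⟨b, hr.lt (hr.symm h)⟩).mp h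
  · intro h
    exact (congrFun (congrFun e ⟨a, hs.lt h⟩) ⟨b, hs.lt (hs.symm h)⟩).mpr h

theorem finite_ncSet (N k : ℕ) : (ncSet N k).Finite := (finite_ncRel N).subset fun _ h => h.1

theorem ncSet_zero_zero : ncSet 0 0 = {fun _ _ => False} := by
  ext r
  constructor
  · rintro ⟨h, -⟩
    funext a b
    exact propext ⟨fun hab => by have := h.lt hab; omega, False.elim⟩
  · rintro rfl
    refine ⟨⟨?_, ?_, ?_, ?_, ?_, ?_⟩, ?_⟩ <;> intros <;> contradiction

theorem ncSet_self_succ (k : ℕ) : ncSet (k + 1) (k + 1) = ∅ := by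
  ext r
  simp only [Set.mem_empty_iff_false, iff_false]
  rintro ⟨h, h'⟩
  obtain ⟨b, hb, hr⟩ := h.partner (Nat.succ_pos k)
  exact hb (h' _ _ (Nat.succ_pos k) (h.lt (h.symm hr)) hr).symm

/-- The condition on a single point is vacuous. This supplies the boundary case of the recursion,
which itself starts at one distinguished point. -/
theorem ncSet_one_eq (N : ℕ) : ncSet N 0 = ncSet N 1 := by
  ext r
  refine and_congr_right fun _ => ⟨fun _ a b ha hb _ => by omega, fun _ a b ha => by omega⟩

/-- Doubling the point `j`. -/
def doublePoint (j : ℕ) (r : ℕ → ℕ → Prop) (a b : ℕ) : Prop :=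
  r (if a ≤ j then a else a - 1) (if b ≤ j then b else b - 1)

/-- Inserting a new block which consists of `j` and `j + 1`. -/
def insertPair (j : ℕ) (r : ℕ → ℕ → Prop) (a b : ℕ) : Prop :=
  ((a = j ∨ a = j + 1) ∧ (b = j ∨ b = j + 1)) ∨
    ((a ≠ j ∧ a ≠ j + 1) ∧ (b ≠ j ∧ b ≠ j + 1) ∧
      r (if a < j then a else a - 2) (if b < j then b else b - 2))

theorem doublePoint_injective (j : ℕ) : Function.Injective (doublePoint j) := by
  intro r s e
  funext a b
  have := congrFun (congrFun e (if a ≤ j then a else a + 1)) (if b ≤ j then b else b + 1)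
  unfold doublePoint at this
  have h : ∀ a, (if (if a ≤ j then a else a + 1) ≤ j then (if a ≤ j then a else a + 1)
      else (if a ≤ j then a else a + 1) - 1) = a := by
    intro a; split_ifs <;> omega
  rwa [h, h] at this

theorem insertPair_injective (j : ℕ) : Function.Injective (insertPair j) := by
  intro r s e
  funext a b
  have := congrFun (congrFun e (if a < j then a else a + 2)) (if b < j then b else b + 2)
  have h : ∀ a, (if (if a < j then a else a + 2) < j then (if a < j then a else a + 2)
      else (if a < j then a else a + 2) - 2) = a := by
    intro a; split_ifs <;> omega
  have h' : ∀ a, (if a < j then a else a + 2) ≠ j ∧ (if a < j then a else a + 2) ≠ j + 1 := by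
    intro a; split_ifs <;> omega
  unfold insertPair at this
  rw [h, h] at this
  have ha := h' a
  have hb := h' b
  simpa [ha.1, ha.2, hb.1, hb.2] using this

theorem doublePoint_mem {N j : ℕ} (hj : j + 1 ≤ N) {r : ℕ → ℕ → Prop} (hr : r ∈ ncSet N (j + 1)) :
    doublePoint j r ∈ ncSet (N + 1) (j + 1) := by
  obtain ⟨h, h'⟩ := hr
  unfold doublePoint
  refine ⟨⟨?_, ?_, ?_, ?_, ?_, ?_⟩, ?_⟩
  · intro a b hab
    have := h.lt hab
    split_ifs at this <;> omega
  · intro a ha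
    refine h.refl ?_
    split_ifs <;> omega
  · exact fun hab => h.symm hab
  · exact fun hab hbc => h.trans hab hbc
  · intro a b c d hab hbc hcd hac hbd
    generalize ea : (if a ≤ j then a else a - 1) = a' at *
    generalize eb : (if b ≤ j then b else b - 1) = b' at *
    generalize ec : (if c ≤ j then c else c - 1) = c' at *
    generalize ed : (if d ≤ j then d else d - 1) = d' at *
    have h1 : a' ≤ b' := by split_ifs at ea eb <;> omega
    have h2 : b' ≤ c' := by split_ifs at eb ec <;> omega
    have h3 : c' ≤ d' := by split_ifs at ec ed <;> omega
    -- Collapsing `j` and `j + 1` is only weakly monotone. If two neighbouring positions coincide,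
    -- the claim follows from reflexivity, from the hypothesis or from transitivity; otherwise no
    -- crossing occurs in `r`.
    rcases h1.eq_or_lt with rfl | h1
    · exact h.refl (h.lt hac)
    · rcases h2.eq_or_lt with rfl | h2
      · exact hac
      · rcases h3.eq_or_lt with rfl | h3
        · exact h.trans hac (h.symm hbd)
        · exact h.nc h1 h2 h3 hac hbd
  · intro a ha
    by_cases e : a = j ∨ a = j + 1
    · refine ⟨if a = j then j + 1 else j, by split_ifs <;> omega, ?_⟩
      have e1 : (if a ≤ j then a else a - 1) = j := by split_ifs <;> omega
      have e2 : (if (if a = j then j + 1 else j) ≤ j then (if a = j then j + 1 else j)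
          else (if a = j then j + 1 else j) - 1) = j := by split_ifs <;> omega
      rw [e1, e2]
      exact h.refl (by omega)
    · obtain ⟨b, hb, hab⟩ := h.partner (a := if a ≤ j then a else a - 1) (by split_ifs <;> omega)
      refine ⟨if b ≤ j then b else b + 1, ?_, ?_⟩
      · split_ifs at hb ⊢ <;> omega
      · convert hab using 1
        split_ifs <;> omega
  · intro a b ha hb hab
    rw [if_pos (by omega), if_pos (by omega)] at hab
    exact h' a b ha hb hab

theorem insertPair_mem {N j : ℕ} (hj : j ≤ N) {r : ℕ → ℕ → Prop} (hr : r ∈ ncSet N j) :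
    insertPair j r ∈ ncSet (N + 2) (j + 1) := by
  obtain ⟨h, h'⟩ := hr
  unfold insertPair
  refine ⟨⟨?_, ?_, ?_, ?_, ?_, ?_⟩, ?_⟩
  · rintro a b (hab | ⟨-, -, hab⟩)
    · omega
    · have := h.lt hab
      split_ifs at this <;> omega
  · intro a ha
    by_cases e : a = j ∨ a = j + 1
    · exact Or.inl ⟨e, e⟩
    · push Not at e
      exact Or.inr ⟨e, e, h.refl (by split_ifs <;> omega)⟩
  · rintro a b (⟨h1, h2⟩ | ⟨h1, h2, h3⟩)
    · exact Or.inl ⟨h2, h1⟩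
    · exact Or.inr ⟨h2, h1, h.symm h3⟩
  · rintro a b c (⟨h1, h2⟩ | ⟨h1, h2, h3⟩) (⟨h4, h5⟩ | ⟨h4, h5, h6⟩)
    · exact Or.inl ⟨h1, h5⟩
    · omega
    · omega
    · exact Or.inr ⟨h1, h5, h.trans h3 h6⟩
  · rintro a b c d hab hbc hcd (⟨h1, h2⟩ | ⟨h1, h2, h3⟩) (⟨h4, h5⟩ | ⟨h4, h5, h6⟩)
    · exact Or.inl ⟨h1, h4⟩
    · omega
    · omega
    · refine Or.inr ⟨h1, h4, h.nc ?_ ?_ ?_ h3 h6⟩ <;> split_ifs <;> omega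
  · intro a ha
    by_cases e : a = j ∨ a = j + 1
    · exact ⟨if a = j then j + 1 else j, by split_ifs <;> omega,
        Or.inl ⟨e, by split_ifs <;> omega⟩⟩
    · push Not at e
      obtain ⟨b, hb, hab⟩ := h.partner (a := if a < j then a else a - 2) (by split_ifs <;> omega)
      refine ⟨if b < j then b else b + 2, ?_, Or.inr ⟨e, ?_, ?_⟩⟩
      · split_ifs at hb ⊢ <;> omega
      · split_ifs <;> omega
      · convert hab using 1
        split_ifs <;> omega
  · rintro a b ha hb (⟨h1, h2⟩ | ⟨h1, h2, h3⟩)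
    · omega
    · rw [if_pos (by omega), if_pos (by omega)] at h3
      exact h' a b (by omega) (by omega) h3

/-- Doubling is undone by dropping the point `j + 1`. The third member `b` of the block keeps `j`
from becoming a singleton. -/
theorem exists_doublePoint {N j : ℕ} (hj : j + 1 ≤ N) {r : ℕ → ℕ → Prop}
    (hr : r ∈ ncSet (N + 1) (j + 1)) (e : r j (j + 1)) {b : ℕ} (hb : r j b) (hb1 : b ≠ j)
    (hb2 : b ≠ j + 1) : ∃ s ∈ ncSet N (j + 1), doublePoint j s = r := by
  obtain ⟨h, h'⟩ := hr
  refine ⟨fun a b => r (if a ≤ j then a else a + 1) (if b ≤ j then b else b + 1),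
    ⟨⟨?_, ?_, ?_, ?_, ?_, ?_⟩, ?_⟩, ?_⟩
  · intro a b hab
    have := h.lt hab
    split_ifs at this <;> omega
  · intro a ha
    refine h.refl ?_
    split_ifs <;> omega
  · exact fun hab => h.symm hab
  · exact fun hab hbc => h.trans hab hbc
  · intro a b c d hab hbc hcd hac hbd
    refine h.nc ?_ ?_ ?_ hac hbd <;> split_ifs <;> omega
  · intro a ha
    obtain ⟨c, hc, hac⟩ : ∃ c, (c ≠ (if a ≤ j then a else a + 1) ∧ c ≠ j + 1) ∧
        r (if a ≤ j then a else a + 1) c := by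
      by_cases ea : a = j
      · subst ea
        rw [if_pos le_rfl]
        exact ⟨b, ⟨hb1, hb2⟩, hb⟩
      · obtain ⟨c, hc, hac⟩ := h.partner (a := if a ≤ j then a else a + 1) (by split_ifs <;> omega)
        by_cases ec : c = j + 1
        · refine ⟨j, ⟨?_, by omega⟩, h.trans (ec ▸ hac) (h.symm e)⟩
          split_ifs <;> omega
        · exact ⟨c, ⟨hc, ec⟩, hac⟩
    refine ⟨if c ≤ j then c else c - 1, ?_, ?_⟩
    · split_ifs at hc ⊢ <;> omega
    · convert hac using 1
      split_ifs <;> omega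
  · intro a b ha hb hab
    rw [if_pos (by omega), if_pos (by omega)] at hab
    exact h' a b ha hb hab
  · have key : ∀ a, (if (if a ≤ j then a else a - 1) ≤ j then (if a ≤ j then a else a - 1)
        else (if a ≤ j then a else a - 1) + 1) = if a = j + 1 then j else a := by
      intro a; split_ifs <;> omega
    have sub : ∀ a b, r a b ↔ r (if a = j + 1 then j else a) b := by
      intro a b
      split_ifs with ha
      · subst ha
        exact ⟨h.trans e, h.trans (h.symm e)⟩
      · rfl
    funext a b
    unfold doublePoint
    apply propext
    beta_reduce
    rw [key, key, ← sub]
    exact ⟨fun t => h.symm ((sub _ _).2 (h.symm t)), fun t => h.symm ((sub _ _).1 (h.symm t))⟩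

/-- Since `j` and `j + 1` form a whole block, dropping both leaves every other block complete, so no
singletons arise. -/
theorem exists_insertPair {N j : ℕ} {r : ℕ → ℕ → Prop}
    (hr : r ∈ ncSet (N + 2) (j + 1)) (e : r j (j + 1)) (hp : ∀ b, r j b → b = j ∨ b = j + 1) :
    ∃ s ∈ ncSet N j, insertPair j s = r := by
  obtain ⟨h, h'⟩ := hr
  have hjN : j + 1 < N + 2 := h.lt (h.symm e)
  have hp' : ∀ a b, r a b → ((a = j ∨ a = j + 1) ↔ (b = j ∨ b = j + 1)) := by
    have : ∀ a b, r a b → (a = j ∨ a = j + 1) → (b = j ∨ b = j + 1) := by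
      rintro a b hab (rfl | rfl)
      · exact hp b hab
      · exact hp b (h.trans e hab)
    exact fun a b hab => ⟨this a b hab, this b a (h.symm hab)⟩
  refine ⟨fun a b => r (if a < j then a else a + 2) (if b < j then b else b + 2),
    ⟨⟨?_, ?_, ?_, ?_, ?_, ?_⟩, ?_⟩, ?_⟩
  · intro a b hab
    have := h.lt hab
    split_ifs at this <;> omega
  · intro a ha
    refine h.refl ?_
    split_ifs <;> omega
  · exact fun hab => h.symm hab
  · exact fun hab hbc => h.trans hab hbc
  · intro a b c d hab hbc hcd hac hbd
    refine h.nc ?_ ?_ ?_ hac hbd <;> split_ifs <;> omega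
  · intro a ha
    obtain ⟨c, hc, hac⟩ := h.partner (a := if a < j then a else a + 2) (by split_ifs <;> omega)
    have := hp' _ _ hac
    have hcj : c ≠ j ∧ c ≠ j + 1 := by
      split_ifs at this <;> omega
    refine ⟨if c < j then c else c - 2, ?_, ?_⟩
    · split_ifs at hc ⊢ <;> omega
    · convert hac using 1
      split_ifs <;> omega
  · intro a b ha hb hab
    rw [if_pos ha, if_pos hb] at hab
    exact h' a b (by omega) (by omega) hab
  · funext a b
    unfold insertPair
    apply propext
    have key : ∀ a, a ≠ j → a ≠ j + 1 → (if (if a < j then a else a - 2) < j then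
        (if a < j then a else a - 2) else (if a < j then a else a - 2) + 2) = a := by
      intro a h1 h2; split_ifs <;> omega
    constructor
    · rintro (⟨rfl | rfl, rfl | rfl⟩ | ⟨h1, h2, h3⟩)
      · exact h.refl (by omega)
      · exact e
      · exact h.symm e
      · exact h.refl hjN
      · rwa [key a h1.1 h1.2, key b h2.1 h2.2] at h3
    · intro hab
      have := hp' a b hab
      by_cases ea : a = j ∨ a = j + 1
      · exact Or.inl ⟨ea, this.1 ea⟩
      · have eb : ¬ (b = j ∨ b = j + 1) := fun t => ea (this.2 t)
        push Not at ea eb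
        refine Or.inr ⟨ea, eb, ?_⟩
        beta_reduce
        rwa [key a ea.1 ea.2, key b eb.1 eb.2]

/-- If `j` and `j + 1` are equivalent, their block either has a third point, and is obtained by
doubling, or is an inserted pair. If they are not, then `j + 1` is not equivalent to any `a < j`
either: a partner of `j` would have to lie beyond `j + 1`, so a block through `a` and `j + 1` would
cross the block of `j`. Hence the first `j + 2` points lie in different blocks. -/
theorem ncSet_succ (N j : ℕ) (hj : j ≤ N) : ncSet (N + 2) (j + 1) = ncSet (N + 2) (j + 2) ∪
    (doublePoint j '' ncSet (N + 1) (j + 1) ∪ insertPair j '' ncSet N j) := by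
  ext r
  constructor
  · intro hr
    obtain ⟨h, h'⟩ := hr
    by_cases e : r j (j + 1)
    · right
      by_cases hp : ∀ b, r j b → b = j ∨ b = j + 1
      · exact Or.inr (exists_insertPair ⟨h, h'⟩ e hp)
      · push Not at hp
        obtain ⟨b, hb, hb1, hb2⟩ := hp
        exact Or.inl (exists_doublePoint (by omega) ⟨h, h'⟩ e hb hb1 hb2)
    · left
      have no : ∀ a, a ≤ j → ¬ r a (j + 1) := by
        intro a ha hra
        have haj : a < j := lt_of_le_of_ne ha fun t => e (t ▸ hra)
        obtain ⟨b, hb, hjb⟩ := h.partner (a := j) (by omega)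
        rcases lt_trichotomy b (j + 1) with hb' | rfl | hb'
        · exact hb (h' b j hb' (by omega) (h.symm hjb))
        · exact e hjb
        · have := h.nc haj (Nat.lt_succ_self j) hb' hra hjb
          exact absurd (h' a j (by omega) (by omega) this) (by omega)
      refine ⟨h, fun a b ha hb hab => ?_⟩
      by_cases ea : a = j + 1
      · subst ea
        by_contra hne
        exact no b (by omega) (h.symm hab)
      · by_cases eb : b = j + 1
        · subst eb
          exact absurd hab (no a (by omega))
        · exact h' a b (by omega) (by omega) hab
  · rintro (⟨h, h'⟩ | ⟨s, hs, rfl⟩ | ⟨s, hs, rfl⟩)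
    · exact ⟨h, fun a b ha hb => h' a b (by omega) (by omega)⟩
    · exact doublePoint_mem (by omega) hs
    · exact insertPair_mem hj hs

theorem ncard_ncSet_succ (N j : ℕ) (hj : j ≤ N) : (ncSet (N + 2) (j + 1)).ncard =
    (ncSet (N + 2) (j + 2)).ncard + (ncSet (N + 1) (j + 1)).ncard + (ncSet N j).ncard := by
  rw [ncSet_succ N j hj, Set.ncard_union_eq _ (finite_ncSet _ _)
    (((finite_ncSet _ _).image _).union ((finite_ncSet _ _).image _)), Set.ncard_union_eq _
    ((finite_ncSet _ _).image _) ((finite_ncSet _ _).image _),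
    Set.ncard_image_of_injective _ (doublePoint_injective j),
    Set.ncard_image_of_injective _ (insertPair_injective j), add_assoc]
  · rw [Set.disjoint_left]
    rintro _ ⟨s, hs, rfl⟩ ⟨t, ht, e⟩
    -- The partner of `j` gives a third point of the doubled block, whereas an inserted pair has
    -- none.
    obtain ⟨b, hb, hjb⟩ := hs.1.partner (a := j) (by omega)
    have := congrFun (congrFun e j) (if b ≤ j then b else b + 1)
    have e2 : doublePoint j s j (if b ≤ j then b else b + 1) := by
      unfold doublePoint
      rw [if_pos le_rfl]
      convert hjb using 1
      split_ifs <;> omega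
    rw [← this] at e2
    unfold insertPair at e2
    split_ifs at e2 <;> omega
  · rw [Set.disjoint_left]
    rintro r ⟨-, h'⟩ (⟨s, hs, rfl⟩ | ⟨s, hs, rfl⟩)
    · have := h' j (j + 1) (by omega) (by omega)
      unfold doublePoint at this
      rw [if_pos le_rfl, if_neg (by omega)] at this
      exact absurd (this (hs.1.refl (by omega))) (by omega)
    · exact absurd (h' j (j + 1) (by omega) (by omega) (Or.inl (by omega))) (by omega)

/-! ### Trinomial coefficients and Riordan numbers -/

/-- The coefficient of `x ^ j` in `(x⁻¹ + 1 + x) ^ m`. -/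
def trinomial : ℕ → ℤ → ℤ
  | 0, j => if j = 0 then 1 else 0
  | m + 1, j => trinomial m (j - 1) + trinomial m j + trinomial m (j + 1)

theorem trinomial_neg (m : ℕ) (j : ℤ) : trinomial m (-j) = trinomial m j := by
  induction m generalizing j with
  | zero => simp [trinomial]
  | succ m ih =>
    simp only [trinomial]
    rw [show -j - 1 = -(j + 1) by ring, show -j + 1 = -(j - 1) by ring, ih, ih, ih]
    ring

/-- With `P = x⁻¹ + 1 + x` and `θ = x d/dx`, this compares the coefficients of `x ^ j` in `P · θ(P ^
m) = m · θ(P) · P ^ m`, where `θ(P) = x - x⁻¹`. -/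
theorem trinomial_rel (m : ℕ) (j : ℤ) : (m - j + 1) * trinomial m (j - 1) =
    j * trinomial m j + (m + j + 1) * trinomial m (j + 1) := by
  induction m generalizing j with
  | zero =>
    simp only [trinomial]
    split_ifs with h1 h2 h3 h2 h3 h3 <;> omega
  | succ m ih =>
    have h1 := ih (j - 1)
    have h2 := ih j
    have h3 := ih (j + 1)
    simp only [trinomial]
    rw [show j - 1 + 1 = j by ring, show j - 1 - 1 = j - 2 by ring] at *
    rw [show j + 1 - 1 = j by ring, show j + 1 + 1 = j + 2 by ring] at *
    push_cast
    linarith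

/-- For `k > 0`, `ncard_ncSet_succ` is the Pascal recursion of the trinomial coefficients, so
differences of neighbouring ones solve it. At `k = 0` only the term with one distinguished point
occurs, as for the walks counted by Riordan numbers, which have no flat step at height zero; this
boundary condition is met because trinomial coefficients are symmetric. -/
theorem ncard_ncSet (m k : ℕ) :
    ((ncSet (m + k) k).ncard : ℤ) = trinomial m k - trinomial m (k + 1) := by
  induction m generalizing k with
  | zero =>
    rcases k with _ | k
    · simp [ncSet_zero_zero, trinomial]
    · rw [zero_add, ncSet_self_succ]
      simp only [trinomial]
      rw [if_neg (by omega), if_neg (by omega)]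
      simp
  | succ m ih =>
    rcases k with _ | k
    · rw [ncSet_one_eq]
      have := ih 1
      simp only [trinomial]
      push_cast at this ⊢
      rw [add_zero, this]
      have h1 := trinomial_neg m 1
      rw [h1]
      ring
    · rw [show m + 1 + (k + 1) = m + k + 2 by ring, ncard_ncSet_succ _ _ (by omega)]
      have h1 := ih k
      have h2 := ih (k + 1)
      have h3 := ih (k + 2)
      rw [show m + (k + 1) = m + k + 1 by ring] at h2
      rw [show m + (k + 2) = m + k + 2 by ring] at h3
      push_cast at h1 h2 h3 ⊢
      rw [h1, h2, h3]
      simp only [trinomial]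
      ring_nf

/-- By symmetry and `trinomial_rel` at `j = 1`, the coefficients at `0` and `1` in row `m + 1` are
rational combinations of those in row `m`. Two such steps express everything in one row, where the
Riordan recursion becomes an algebraic identity. -/
theorem riordan_eq (m : ℕ) : riordan m = trinomial m 0 - trinomial m 1 := by
  have step0 : ∀ m, trinomial (m + 1) 0 = trinomial m 0 + 2 * trinomial m 1 := by
    intro m
    have := trinomial_neg m 1
    simp only [trinomial]
    norm_num
    rw [this]
    ring
  have step1 : ∀ m : ℕ, ((m : ℤ) + 2) * trinomial (m + 1) 1 =
      (2 * m + 2) * trinomial m 0 + (m + 1) * trinomial m 1 := by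
    intro m
    have := trinomial_rel m 1
    simp only [trinomial]
    norm_num at this ⊢
    linarith
  suffices h : ∀ m, riordan m = trinomial m 0 - trinomial m 1 ∧
      riordan (m + 1) = trinomial (m + 1) 0 - trinomial (m + 1) 1 from (h m).1
  intro m
  induction m with
  | zero => simp [riordan, trinomial]
  | succ m ih =>
    refine ⟨ih.2, ?_⟩
    rw [riordan, ih.1, ih.2]
    have a0 := step0 m
    have a1 := step1 m
    have b0 := step0 (m + 1)
    have b1 := step1 (m + 1)
    rw [show m + 1 + 1 = m + 2 by ring] at *
    qify at a0 a1 b0 b1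
    have p1 : (m : ℚ) + 2 ≠ 0 := by positivity
    have p2 : (m : ℚ) + 3 ≠ 0 := by positivity
    have e1 : (trinomial (m + 1) 1 : ℚ) =
        ((2 * m + 2) * trinomial m 0 + (m + 1) * trinomial m 1) / (m + 2) := by
      field_simp; linarith
    have e2 : (trinomial (m + 2) 1 : ℚ) =
        ((2 * (m + 1) + 2) * trinomial (m + 1) 0 + (m + 1 + 1) * trinomial (m + 1) 1) / (m + 3) := by
      field_simp; linarith
    rw [e2, b0, e1, a0]
    field_simp
    ring

theorem ncard_ncRel (N : ℕ) : ({r | NCRel N r}.ncard : ℚ) = riordan N := by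
  have h : {r | NCRel N r} = ncSet (N + 0) 0 := by
    ext r
    exact ⟨fun hr => ⟨hr, fun a b ha => by omega⟩, fun hr => hr.1⟩
  have := ncard_ncSet N 0
  rw [h, riordan_eq, ← Int.cast_natCast, this]
  push_cast
  simp
end

noncomputable section

/-! ### Positions of marked points -/

/-- The marked points in clockwise order, beginning with the top left one. -/
def markEquiv (n : ℕ) : Fin (2 * n) ≃ Mark n where
  toFun p := if h : p.1 < n then Mark.top ⟨p.1, h⟩ else Mark.bot ⟨2 * n - 1 - p.1, by omega⟩
  invFun m := match m with
    | Mark.top i => ⟨i.1, by omega⟩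
    | Mark.bot i => ⟨2 * n - 1 - i.1, by omega⟩
  left_inv p := by
    by_cases h : p.1 < n
    · simp [h]
    · simp only [h, dite_false]
      ext
      simp
      omega
  right_inv m := by
    rcases m with i | i
    · simp
    · have : ¬ 2 * n - 1 - i.1 < n := by omega
      simp only [this, dite_false, Mark.bot.injEq]
      ext
      simp
      omega

/-- The position of a marked point in clockwise order. -/
def pos {n : ℕ} (m : Mark n) : ℕ := ((markEquiv n).symm m).1

theorem pos_bot {n : ℕ} (i : Fin n) : pos (Mark.bot i) = 2 * n - 1 - i.1 := rfl

theorem pos_markEquiv {n : ℕ} (p : Fin (2 * n)) : pos (markEquiv n p) = p.1 := by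
  unfold pos; rw [Equiv.symm_apply_apply]

/-! ### Combinatorics of gaps -/

/-- Which pairs of equivalent points are separated by the gap in front of the position `a`. Two gaps
with the same value are not separated from each other by any block. -/
def gapType (r : ℕ → ℕ → Prop) (a i j : ℕ) : Prop := r i j → (i < a ↔ j < a)

/-- `q` is the cyclic predecessor of `p` in its block. -/
def IsPred (r : ℕ → ℕ → Prop) (p q : ℕ) : Prop :=
  r p q ∧ ∀ k, r p k → (¬ k < p ↔ (p ≤ q ↔ k ≤ q))

theorem IsPred.unique {r : ℕ → ℕ → Prop} {p q q' : ℕ} (h : IsPred r p q) (h' : IsPred r p q') :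
    q = q' := by
  have h1 := h.2 q' h'.1
  have h2 := h'.2 q h.1
  have h3 := h.2 q h.1
  have h4 := h'.2 q' h'.1
  grind

/-- The condition in `IsPred` is the equality of these two gap types, evaluated only at pairs of `p`
and another point of its block. -/
theorem isPred_of_gapType_eq {r : ℕ → ℕ → Prop} {p q : ℕ} (h : r p q)
    (e : gapType r p = gapType r (q + 1)) : IsPred r p q := by
  refine ⟨h, fun k hk => ?_⟩
  have := congrFun (congrFun e p) k
  simp only [gapType, hk, true_imp_iff, lt_irrefl, false_iff, Nat.lt_succ_iff, eq_iff_iff] at this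
  exact this

namespace NCRel

variable {N : ℕ} {r : ℕ → ℕ → Prop}

/-- The predecessor is the largest smaller member of the block if there is one, and otherwise the
maximum of the block. -/
theorem exists_isPred (hr : NCRel N r) {p : ℕ} (hp : p < N) : ∃ q, IsPred r p q := by
  classical
  by_cases h : ∃ k, k < p ∧ r p k
  · have hne : ((Finset.range p).filter fun k => r p k).Nonempty := by
      obtain ⟨k, hk, hk'⟩ := h
      exact ⟨k, by simp [hk, hk']⟩
    obtain ⟨q, hm, hle⟩ := Finset.exists_max_image _ id hne
    simp only [Finset.mem_filter, Finset.mem_range, id] at hm hle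
    refine ⟨q, hm.2, fun k hk => ?_⟩
    have := fun hkp => hle k ⟨hkp, hk⟩
    grind
  · push Not at h
    have hne : ((Finset.range N).filter fun k => r p k).Nonempty := ⟨p, by simp [hp, hr.refl hp]⟩
    obtain ⟨q, hm, hle⟩ := Finset.exists_max_image _ id hne
    simp only [Finset.mem_filter, Finset.mem_range, id] at hm hle
    refine ⟨q, hm.2, fun k hk => ?_⟩
    have h1 := hle k ⟨hr.lt (hr.symm hk), hk⟩
    have h2 := hle p ⟨hp, hr.refl hp⟩
    have h3 : ¬ k < p := fun t => h k t hk
    grind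

/-- The gaps in front of `p` and behind its predecessor `q` bound the same corner at the vertex of
the block. The block of `p` does not separate them since it has no member in between, and any other
block stays within one arc between `p` and `q` because the partition is noncrossing. -/
theorem gapType_eq_of_isPred (hr : NCRel N r) {p q : ℕ} (h : IsPred r p q) : gapType r p = gapType r (q + 1) := by
  obtain ⟨hpq, h⟩ := h
  -- A point which lies between two members of the block of `p`, but outside this block, has its own
  -- block trapped between them.
  have inner : ∀ i j l u, r i j → ¬ r p i → r p l → r p u → l < i → i < u → l < j ∧ j < u := by
    intro i j l u hij hpi hl hu h1 h2
    have n1 : j ≠ l := fun e => hpi (hr.trans hl (hr.symm (e ▸ hij)))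
    have n2 : j ≠ u := fun e => hpi (hr.trans hu (hr.symm (e ▸ hij)))
    by_contra hc
    rcases (show j < l ∨ u < j by omega) with hj | hj
    · have := hr.nc hj h1 h2 (hr.symm hij) (hr.trans (hr.symm hl) hu)
      exact hpi (hr.trans hl (hr.trans (hr.symm this) (hr.symm hij)))
    · exact hpi (hr.trans hl (hr.nc h1 h2 hj (hr.trans (hr.symm hl) hu) hij))
  have key : ∀ i j, r i j → ((i < p ↔ j < p) ↔ (i ≤ q ↔ j ≤ q)) := by
    intro i j hij
    by_cases hpi : r p i
    · have h1 := h i hpi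
      have h2 := h j (hr.trans hpi hij)
      tauto
    · have hpj : ¬ r p j := fun t => hpi (hr.trans t (hr.symm hij))
      have hpp := hr.refl (hr.lt hpq)
      have n1 : i ≠ p := fun e => hpi (by rw [e]; exact hpp)
      have n2 : i ≠ q := fun e => hpi (by rw [e]; exact hpq)
      have n3 : j ≠ p := fun e => hpj (by rw [e]; exact hpp)
      have n4 : j ≠ q := fun e => hpj (by rw [e]; exact hpq)
      have a1 := inner i j p q hij hpi hpp hpq
      have a2 := inner i j q p hij hpi hpq hpp
      have a3 := inner j i p q (hr.symm hij) hpj hpp hpq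
      have a4 := inner j i q p (hr.symm hij) hpj hpq hpp
      omega
  funext i j
  simp only [gapType, Nat.lt_succ_iff]
  exact propext (forall_congr' fun hij => key i j hij)

/-- A set which is closed under cyclic predecessors contains all blocks which it meets. -/
theorem mem_of_isPred_closed (hr : NCRel N r) {T : Set ℕ} (hT : ∀ p ∈ T, ∀ q, IsPred r p q → q ∈ T) {p q : ℕ}
    (hp : p ∈ T) (hpq : r p q) : q ∈ T := by
  classical
  have step : ∀ k ∈ T, r p k → ∃ l ∈ T, r p l ∧ ∀ x, r p x → (¬ x < k ↔ (k ≤ l ↔ x ≤ l)) := by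
    intro k hk hpk
    obtain ⟨l, hl⟩ := hr.exists_isPred (hr.lt (hr.symm hpk))
    exact ⟨l, hT k hk l hl, hr.trans hpk hl.1, fun x hx => hl.2 x (hr.trans (hr.symm hpk) hx)⟩
  have hex : ∃ k, k ∈ T ∧ r p k := ⟨p, hp, hr.refl (hr.lt hpq)⟩
  obtain ⟨hm, hm'⟩ := Nat.find_spec hex
  obtain ⟨l, hl, hpl, hl'⟩ := step _ hm hm'
  -- The least member of the block in `T` has a predecessor in `T` which is not smaller. So the
  -- predecessor has wrapped around, and `l` is the maximum of the block.
  have hml : Nat.find hex ≤ l := Nat.find_min' hex ⟨hl, hpl⟩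
  have hmax : q ≤ l := by
    have := hl' q hpq
    generalize Nat.find hex = m at *
    grind
  by_contra hq
  -- If `q` were missing from `T`, the predecessor of the least member of `T` above `q` would lie
  -- strictly between `q` and that member, contrary to minimality.
  have hex' : ∃ k, k ∈ T ∧ r p k ∧ q < k :=
    ⟨l, hl, hpl, lt_of_le_of_ne hmax fun e => hq (e ▸ hl)⟩
  obtain ⟨hz, hz', hz''⟩ := Nat.find_spec hex'
  obtain ⟨x, hx, hpx, hx'⟩ := step _ hz hz'
  have h1 := hx' q hpq
  have h2 : q ≠ x := fun e => hq (e ▸ hx)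
  have h3 := fun t => Nat.find_min' hex' ⟨hx, hpx, t⟩
  generalize Nat.find hex' = z at *
  grind

/-- Gaps of equal type are not separated by any block, so the positions between them form a union of
whole blocks. -/
theorem mem_Ico_iff {a b i j : ℕ} (_hab : a ≤ b) (e : gapType r a = gapType r b) (hij : r i j) :
    i ∈ Finset.Ico a b ↔ j ∈ Finset.Ico a b := by
  have := congrFun (congrFun e i) j
  simp only [gapType, hij, true_imp_iff, eq_iff_iff] at this
  simp only [Finset.mem_Ico]
  omega

open Classical in
/-- If `t` has sum zero on all blocks, then its partial sums only depend on the type of the gap. -/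
theorem sum_range_eq (hr : NCRel N r) {t : ℕ → ZMod 2}
    (ht : ∀ p < N, ∑ i ∈ (Finset.range N).filter (r p), t i = 0) {a b : ℕ} (ha : a ≤ N) (hb : b ≤ N)
    (e : gapType r a = gapType r b) : ∑ i ∈ Finset.range a, t i = ∑ i ∈ Finset.range b, t i := by
  wlog hab : a ≤ b generalizing a b
  · exact (this hb ha e.symm (by omega)).symm
  rw [← Finset.sum_range_add_sum_Ico t hab]
  suffices h : ∑ i ∈ Finset.Ico a b, t i = 0 by rw [h, add_zero]
  -- The positions between the two gaps are grouped into blocks, with the predicate `r i` as the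
  -- name of the block of `i`; each group is a full block and has sum zero.
  rw [← Finset.sum_fiberwise_of_maps_to (t := (Finset.Ico a b).image r)
    fun i hi => Finset.mem_image_of_mem r hi]
  refine Finset.sum_eq_zero fun B hB => ?_
  obtain ⟨p, hp, rfl⟩ := Finset.mem_image.1 hB
  have hpN : p < N := by rw [Finset.mem_Ico] at hp; omega
  rw [← ht p hpN]
  refine Finset.sum_congr ?_ fun _ _ => rfl
  ext i
  simp only [Finset.mem_filter, Finset.mem_range]
  constructor
  · rintro ⟨hi, h⟩
    rw [Finset.mem_Ico] at hi
    exact ⟨by omega, h ▸ hr.refl (by omega)⟩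
  · rintro ⟨hi, h⟩
    refine ⟨(mem_Ico_iff hab e h).1 hp, ?_⟩
    funext x
    exact propext ⟨hr.trans h, hr.trans (hr.symm h)⟩

end NCRel

/-! ### The standard drawing of a noncrossing partition -/

theorem even_ncard_iff {α : Type*} [Finite α] (s : Set α) :
    Even s.ncard ↔ ∑ᶠ x ∈ s, (1 : ZMod 2) = 0 := by
  rw [finsum_mem_eq_finite_toFinset_sum _ (Set.toFinite s), Finset.sum_const, nsmul_one,
    ZMod.natCast_eq_zero_iff_even, Set.ncard_eq_toFinset_card s]

theorem zmod_two_ne_iff (x y : ZMod 2) : x + y = 1 ↔ ¬ (x = 1 ↔ y = 1) := by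
  revert x y; decide

section

variable {n : ℕ} {r : ℕ → ℕ → Prop}

/-- The points of the standard drawing: the blocks. -/
abbrev StarV (n : ℕ) (r : ℕ → ℕ → Prop) : Type := Set.range fun p : Fin (2 * n) => r p

/-- The faces of the standard drawing: the types of gaps. -/
abbrev StarF (n : ℕ) (r : ℕ → ℕ → Prop) : Type :=
  Set.range fun a : Fin (2 * n + 1) => gapType r a

/-- The block of a position. -/
def starBlock (r : ℕ → ℕ → Prop) (p : Fin (2 * n)) : StarV n r := ⟨r p, p, rfl⟩

/-- The face at a gap. -/
def starGap (r : ℕ → ℕ → Prop) (a : Fin (2 * n + 1)) : StarF n r := ⟨gapType r a, a, rfl⟩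

theorem starGap_eq {a b : Fin (2 * n + 1)} :
    starGap r a = starGap r b ↔ gapType r a = gapType r b := Subtype.ext_iff

theorem NCRel.starBlock_eq {p q : Fin (2 * n)} (hr : NCRel (2 * n) r) :
    starBlock r p = starBlock r q ↔ r p q := by
  constructor
  · intro e
    have e' : r p = r q := congrArg Subtype.val e
    rw [e']
    exact hr.refl q.2
  · intro h
    refine Subtype.ext (funext fun x => ?_)
    exact propext ⟨hr.trans (hr.symm h), hr.trans h⟩

/-- The cyclic predecessor in the block. -/
def NCRel.pred (hr : NCRel (2 * n) r) (p : Fin (2 * n)) : Fin (2 * n) :=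
  ⟨(hr.exists_isPred p.2).choose, hr.lt (hr.symm (hr.exists_isPred p.2).choose_spec.1)⟩

theorem NCRel.isPred_pred (hr : NCRel (2 * n) r) (p : Fin (2 * n)) : IsPred r p (hr.pred p) :=
  (hr.exists_isPred p.2).choose_spec

/-- The starting points of half-edges in the standard drawing. The half-edge `(p, false)` starts at
the marked point of position `p`, and `(p, true)` is the other half of its edge. -/
def starSrc (r : ℕ → ℕ → Prop) (h : Fin (2 * n) × Bool) : StarV n r ⊕ Mark n :=
  if h.2 then Sum.inl (starBlock r h.1) else Sum.inr (markEquiv n h.1)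

/-- The rotation of the standard drawing. -/
def NCRel.starNext (hr : NCRel (2 * n) r) (h : Fin (2 * n) × Bool) : Fin (2 * n) × Bool :=
  if h.2 then (hr.pred h.1, true) else h

/-- The face to the left of a half-edge in the standard drawing. -/
def starFace (r : ℕ → ℕ → Prop) (h : Fin (2 * n) × Bool) : StarF n r :=
  if h.2 then starGap r h.1.castSucc else starGap r h.1.succ

/-- Passing to cyclic predecessors runs through the whole block (`mem_of_isPred_closed`), so the
rotation at a vertex is a single cycle. -/
theorem NCRel.star_orbit (hr : NCRel (2 * n) r) (x y : Fin (2 * n) × Bool) :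
    starSrc r x = starSrc r y ↔ ∃ k : ℕ, hr.starNext^[k] x = y := by
  revert x y
  rw [orbit_iff_closed]
  constructor
  · rintro ⟨p, _ | _⟩
    · rfl
    · exact congrArg Sum.inl (hr.starBlock_eq.2 (hr.symm (hr.isPred_pred p).1))
  · rintro S hS ⟨p, _ | _⟩ ⟨q, _ | _⟩ hx e
    · have e' : q = p := (markEquiv n).injective (Sum.inr_injective e)
      rwa [e']
    · cases e
    · cases e
    · have hpq := hr.starBlock_eq.1 (Sum.inl_injective e)
      have key := hr.mem_of_isPred_closed (T := {k | ∃ hk : k < 2 * n, (⟨k, hk⟩, true) ∈ S}) ?_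
        (p := p) (q := q) ⟨p.2, hx⟩ (hr.symm hpq)
      · exact key.2
      · rintro k ⟨hk, hkS⟩ l hl
        have hkl := (hr.isPred_pred ⟨k, hk⟩).unique hl
        have := hS _ hkS
        refine ⟨hkl ▸ (hr.pred ⟨k, hk⟩).2, ?_⟩
        have e' : (⟨l, hkl ▸ (hr.pred ⟨k, hk⟩).2⟩ : Fin (2 * n)) = hr.pred ⟨k, hk⟩ := Fin.ext hkl.symm
        rw [e']
        exact this

/-- Evenness of `c` at a vertex says that the indicator `t` of the legs in `c` has sum zero on the
block. Hence the parity of the number of legs of `c` in front of a gap depends only on the face at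
the gap. -/
theorem NCRel.star_sum (hr : NCRel (2 * n) r) {c : Set (Fin (2 * n) × Bool)}
    (hc : ∀ p, (p, true) ∈ c ↔ (p, false) ∈ c)
    (hev : ∀ v, Even {h | h ∈ c ∧ starSrc r h = Sum.inl v}.ncard) {t : ℕ → ZMod 2}
    (ht : ∀ p : Fin (2 * n), (t p = 1 ↔ (p, false) ∈ c)) {a b : ℕ} (ha : a ≤ 2 * n)
    (hb : b ≤ 2 * n) (e : gapType r a = gapType r b) :
    ∑ i ∈ Finset.range a, t i = ∑ i ∈ Finset.range b, t i := by
  classical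
  refine hr.sum_range_eq (fun p hp => ?_) ha hb e
  have hev := hev (starBlock r ⟨p, hp⟩)
  have t01 : ∀ x : ZMod 2, x = if x = 1 then 1 else 0 := by decide
  have himg : {h | h ∈ c ∧ starSrc r h = Sum.inl (starBlock r ⟨p, hp⟩)} =
      (fun k : Fin (2 * n) => (k, true)) ''
        {k | t k = 1 ∧ r p k} := by
    ext ⟨k, _ | _⟩
    · constructor
      · rintro ⟨-, h⟩
        cases h
      · rintro ⟨_, -, h⟩
        cases h
    · constructor
      · rintro ⟨h1, h2⟩
        exact ⟨k, ⟨(ht k).2 ((hc k).1 h1), hr.symm (hr.starBlock_eq.1 (Sum.inl_injective h2))⟩, rfl⟩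
      · rintro ⟨k', ⟨h1, h2⟩, e⟩
        obtain rfl : k' = k := (Prod.ext_iff.1 e).1
        exact ⟨(hc k').2 ((ht k').1 h1), congrArg Sum.inl (hr.starBlock_eq.2 (hr.symm h2))⟩
  rw [himg, Set.ncard_image_of_injective _ (fun _ _ e => (Prod.ext_iff.1 e).1), even_ncard_iff,
    finsum_mem_eq_finite_toFinset_sum _ (Set.toFinite _)] at hev
  rw [← hev, Finset.sum_filter, ← Fin.sum_univ_eq_sum_range (fun i => if r p i then t i else 0)]
  rw [← Finset.sum_filter_add_sum_filter_not Finset.univ (fun k : Fin (2 * n) => t k = 1 ∧ r p k)]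
  rw [Finset.sum_eq_zero (s := Finset.univ.filter fun k : Fin (2 * n) => ¬ (t k = 1 ∧ r p k)),
    add_zero]
  · refine Finset.sum_congr (by ext; simp) fun k hk => ?_
    simp only [Set.Finite.mem_toFinset, Set.mem_ofPred_eq] at hk
    rw [if_pos hk.2, hk.1]
  · intro k hk
    rw [Finset.mem_filter] at hk
    split_ifs with h
    · rw [t01 (t k), if_neg fun e => hk.2 ⟨e, h⟩]
    · rfl

/-- The standard drawing of a noncrossing partition: every block is a vertex joined to its marked
points. -/
def NCRel.star (hr : NCRel (2 * n) r) : Drawing n where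
  V := StarV n r
  H := Fin (2 * n) × Bool
  F := StarF n r
  finV := inferInstance
  finH := inferInstance
  finF := inferInstance
  src := starSrc r
  rev h := (h.1, !h.2)
  -- Positions are numbered clockwise and rotations run counterclockwise, hence the use of
  -- predecessors.
  next := hr.starNext
  face := starFace r
  mark m := ((markEquiv n).symm m, false)
  gapT j := starGap r ⟨j, by omega⟩
  -- In clockwise order the bottom edge is read from right to left.
  gapB j := starGap r ⟨2 * n - j, by omega⟩
  inc v f := ∃ h, starSrc r h = Sum.inl v ∧ starFace r h = f
  smooth _ := False
  rev_rev h := by simp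
  rev_ne h e := by
    have := congrArg Prod.snd e
    simp at this
  orbit := hr.star_orbit
  src_mark := by
    rintro ⟨p, _ | _⟩ m
    · simp only [starSrc, Bool.false_eq_true, if_false, Sum.inr.injEq, Prod.mk.injEq, and_true]
      exact (Equiv.eq_symm_apply _).symm
    · simp [starSrc]
  smooth_two _ h := h.elim
  corner := by
    rintro ⟨p, _ | _⟩ v hv
    · cases hv
    · exact starGap_eq.2 (hr.gapType_eq_of_isPred (hr.isPred_pred p)).symm
  face_top i := rfl
  face_rev_top i := rfl
  face_bot i := starGap_eq.2 (congrArg (gapType r) (by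
    change pos (Mark.bot i) + 1 = 2 * n - i.1
    rw [pos_bot]; omega))
  face_rev_bot i := starGap_eq.2 (congrArg (gapType r) (by
    change pos (Mark.bot i) = 2 * n - (i.1 + 1)
    rw [pos_bot]; omega))
  -- The gaps `0` and `2 * n` meet at the left side: every position lies behind the first and in
  -- front of the last, so neither separates anything.
  gap_left := starGap_eq.2 (by
    funext i j
    simp only [gapType]
    refine propext (forall_congr' fun h => ?_)
    have h1 := hr.lt h
    have h2 := hr.lt (hr.symm h)
    simp [h1, h2])
  gap_right := starGap_eq.2 (congrArg (gapType r) (by simp; omega))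
  inc_iff _ _ _ _ := Iff.rfl
  inc_unique := by
    rintro ⟨_, p, rfl⟩ hv
    exact absurd rfl (hv (p, true))
  jordan c hc hev := by
    classical
    let t : ℕ → ZMod 2 := fun k => if ∃ hk : k < 2 * n, ((⟨k, hk⟩, false) : Fin (2 * n) × Bool) ∈ c
      then 1 else 0
    have ht : ∀ p : Fin (2 * n), (t p = 1 ↔ (p, false) ∈ c) := by
      intro p
      simp [t]
    -- A face belongs to the required set if an odd number of legs in `c` precedes one of its gaps;
    -- the choice of the gap does not matter, and crossing a leg changes the parity exactly when the
    -- leg is in `c`.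
    have hwd : ∀ a b : Fin (2 * n + 1), gapType r a = gapType r b →
        ∑ i ∈ Finset.range a, t i = ∑ i ∈ Finset.range b, t i := fun a b e =>
      hr.star_sum (fun p => hc (p, false)) hev ht (by omega) (by omega) e
    have hU : ∀ a : Fin (2 * n + 1), starGap r a ∈ {f : StarF n r | ∃ b, f = starGap r b ∧
        ∑ i ∈ Finset.range b.1, t i = 1} ↔ ∑ i ∈ Finset.range a.1, t i = 1 := by
      intro a
      constructor
      · rintro ⟨b, e, hb⟩
        rw [hwd a b (starGap_eq.1 e), hb]
      · exact fun h => ⟨a, rfl, h⟩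
    have key : ∀ p : Fin (2 * n), (p, false) ∈ c ↔
        ¬ (∑ i ∈ Finset.range p.succ.1, t i = 1 ↔ ∑ i ∈ Finset.range p.castSucc.1, t i = 1) := by
      intro p
      rw [← ht, Fin.val_succ, Finset.sum_range_succ, ← zmod_two_ne_iff, Fin.val_castSucc]
      rw [add_right_comm, CharTwo.add_self_eq_zero, zero_add]
    refine ⟨{f : StarF n r | ∃ b, f = starGap r b ∧ ∑ i ∈ Finset.range b.1, t i = 1}, ?_⟩
    rintro ⟨p, _ | _⟩
    · exact (key p).trans (not_congr (iff_congr (hU _) (hU _)).symm)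
    · refine (hc (p, false)).trans ((key p).trans (not_congr ?_))
      exact iff_comm.trans (iff_congr (hU _) (hU _)).symm
  dual_connected U hU := by
    have h : ∀ a : Fin (2 * n + 1), starGap r a ∈ U ↔ starGap r 0 ∈ U := by
      intro a
      induction a using Fin.induction with
      | zero => rfl
      | succ i ih => exact (hU (i, false)).trans ih
    by_cases h0 : starGap r (0 : Fin (2 * n + 1)) ∈ U
    · right
      ext f
      obtain ⟨a, ha⟩ := f.2
      have : f = starGap r a := Subtype.ext ha.symm
      rw [this, h]
      exact iff_of_true h0 trivial
    · left
      ext f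
      obtain ⟨a, ha⟩ := f.2
      have : f = starGap r a := Subtype.ext ha.symm
      rw [this, h]
      exact iff_of_false h0 (fun t => t)

end
end

noncomputable section

/-! ### Linear independence of the standard diagrams -/

section

variable {n : ℕ} {r s : ℕ → ℕ → Prop}

theorem NCRel.star_vertex_sum (hr : NCRel (2 * n) r) (f : Fin (2 * n) × Bool → ZMod 2)
    (p : Fin (2 * n)) : ∑ᶠ h ∈ {h | starSrc r h = Sum.inl (starBlock r p)}, f h =
      ∑ᶠ k ∈ {k : Fin (2 * n) | r p k}, f (k, true) := by
  have himg : {h | starSrc r h = Sum.inl (starBlock r p)} =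
      (fun k : Fin (2 * n) => (k, true)) '' {k | r p k} := by
    ext ⟨k, _ | _⟩
    · constructor
      · intro h
        cases h
      · rintro ⟨_, -, h⟩
        cases h
    · constructor
      · intro h
        exact ⟨k, hr.symm (hr.starBlock_eq.1 (Sum.inl_injective h)), rfl⟩
      · rintro ⟨k', h, e⟩
        obtain rfl : k' = k := (Prod.ext_iff.1 e).1
        exact congrArg Sum.inl (hr.starBlock_eq.2 (hr.symm h))
  rw [himg, finsum_mem_image fun _ _ _ _ e => (Prod.ext_iff.1 e).1]

open Classical in
/-- The flow along the legs at the positions `p` and `q`. -/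
def pairFlow (p q : Fin (2 * n)) (h : Fin (2 * n) × Bool) : ZMod 2 :=
  if h.1 = p ∨ h.1 = q then 1 else 0

open Classical in
theorem finsum_pair {p q : Fin (2 * n)} (hpq : p ≠ q) (A : Set (Fin (2 * n))) :
    ∑ᶠ k ∈ A, (if k = p ∨ k = q then (1 : ZMod 2) else 0) =
      (if p ∈ A then 1 else 0) + if q ∈ A then 1 else 0 := by
  have h : ∑ᶠ k ∈ A, (if k = p ∨ k = q then (1 : ZMod 2) else 0) =
      ∑ᶠ k ∈ ({p, q} : Set (Fin (2 * n))), if k ∈ A then (1 : ZMod 2) else 0 := by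
    refine finsum_congr fun k => ?_
    by_cases h1 : k ∈ A <;> by_cases h2 : k = p ∨ k = q
    · have h2' : k ∈ ({p, q} : Set (Fin (2 * n))) := h2
      simp [h1, h2, h2']
    · have h2' : k ∉ ({p, q} : Set (Fin (2 * n))) := h2
      simp [h1, h2, h2']
    · simp [h1]
    · simp [h1]
  rw [h, finsum_mem_pair hpq]

/-- The two legs form a path through a common vertex, so every vertex meets an even number of them.
-/
theorem NCRel.pairFlow_mem (hr : NCRel (2 * n) r) {p q : Fin (2 * n)} (hne : p ≠ q)
    (hpq : r p q) : pairFlow p q ∈ hr.star.flows := by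
  classical
  refine ⟨fun h => rfl, ?_⟩
  rintro ⟨_, k, rfl⟩
  refine (hr.star_vertex_sum _ k).trans ?_
  simp only [pairFlow]
  rw [finsum_pair hne]
  have : p ∈ {x : Fin (2 * n) | r k x} ↔ q ∈ {x : Fin (2 * n) | r k x} :=
    ⟨fun h => hr.trans h hpq, fun h => hr.trans h (hr.symm hpq)⟩
  rw [if_congr this rfl rfl, CharTwo.add_self_eq_zero]

/-- If the legs ended at different vertices, the vertex at `p` would have total flow one. -/
theorem NCRel.rel_of_pairFlow_mem (hr : NCRel (2 * n) r) {p q : Fin (2 * n)} (hne : p ≠ q)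
    (h : pairFlow p q ∈ hr.star.flows) : r p q := by
  classical
  have := (hr.star_vertex_sum _ p).symm.trans (h.2 (starBlock r p))
  simp only [pairFlow] at this
  rw [finsum_pair hne, if_pos (show p ∈ {x : Fin (2 * n) | r p x} from hr.refl p.2)] at this
  by_contra hc
  rw [if_neg (show q ∉ {x : Fin (2 * n) | r p x} from hc)] at this
  exact absurd this (by decide)

/-- The boundary values of flows on the standard drawing. -/
def NCRel.bdrySpace (hr : NCRel (2 * n) r) : Submodule (ZMod 2) (Bdry n) :=
  (⊤ : Submodule (ZMod 2) hr.star.flows).map hr.star.flowBdry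

theorem NCRel.pairFlow_bdry_mem (hr : NCRel (2 * n) r) {p q : Fin (2 * n)} (hne : p ≠ q)
    (hpq : r p q) : (fun m => pairFlow p q ((markEquiv n).symm m, false)) ∈ hr.bdrySpace :=
  ⟨⟨_, hr.pairFlow_mem hne hpq⟩, trivial, rfl⟩

theorem NCRel.star_flow_ext (hr : NCRel (2 * n) r) {f g : Fin (2 * n) × Bool → ZMod 2}
    (hf : f ∈ hr.star.flows) (hg : g ∈ hr.star.flows)
    (e : ∀ m, f ((markEquiv n).symm m, false) = g ((markEquiv n).symm m, false)) : f = g := by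
  have h0 : ∀ p, f (p, false) = g (p, false) := by
    intro p
    have := e (markEquiv n p)
    rwa [Equiv.symm_apply_apply] at this
  funext ⟨p, b⟩
  rcases b with _ | _
  · exact h0 p
  · exact (hf.1 (p, false)).trans ((h0 p).trans (hg.1 (p, false)).symm)

/-- Different positions are equivalent exactly when the sum of their two unit vectors is a boundary
value, because on a standard drawing the boundary values determine the flow. -/
theorem NCRel.eq_of_bdrySpace_eq (hr : NCRel (2 * n) r) (hs : NCRel (2 * n) s)
    (e : hr.bdrySpace = hs.bdrySpace) : r = s := by
  have key : ∀ {r s : ℕ → ℕ → Prop} (hr : NCRel (2 * n) r) (hs : NCRel (2 * n) s),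
      hr.bdrySpace = hs.bdrySpace → ∀ a b, r a b → s a b := by
    intro r s hr hs e a b hab
    by_cases hne : a = b
    · subst hne
      exact hs.refl (hr.lt hab)
    · have ha := hr.lt hab
      have hb := hr.lt (hr.symm hab)
      have hne' : (⟨a, ha⟩ : Fin (2 * n)) ≠ ⟨b, hb⟩ := fun t => hne (Fin.ext_iff.1 t)
      have := hr.pairFlow_bdry_mem hne' hab
      rw [e] at this
      obtain ⟨⟨f, hf⟩, -, hfe⟩ := this
      have hfp : f = pairFlow ⟨a, ha⟩ ⟨b, hb⟩ := by
        have h0 : ∀ p, f (p, false) = pairFlow ⟨a, ha⟩ ⟨b, hb⟩ (p, false) := by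
          intro p
          have := congrFun hfe (markEquiv n p)
          change f ((markEquiv n).symm (markEquiv n p), false) = _ at this
          rwa [Equiv.symm_apply_apply] at this
        funext ⟨p, c⟩
        rcases c with _ | _
        · exact h0 p
        · exact (hf.1 (p, false)).trans (h0 p)
      rw [hfp] at hf
      exact hs.rel_of_pairFlow_mem hne' hf
  funext a b
  exact propext ⟨key hr hs e a b, key hs hr e.symm a b⟩

/-- This is where the absence of singletons enters: the path from `p` to a partner has nonzero value
at `p`. -/
theorem NCRel.exists_bdry_ne_zero (hr : NCRel (2 * n) r) (p : Fin (2 * n)) :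
    ∃ b ∈ hr.bdrySpace, b (markEquiv n p) ≠ 0 := by
  obtain ⟨q, hq, hpq⟩ := hr.partner p.2
  have hqn := hr.lt (hr.symm hpq)
  have hne : p ≠ ⟨q, hqn⟩ := fun e => hq (Fin.ext_iff.1 e).symm
  refine ⟨_, hr.pairFlow_bdry_mem hne hpq, ?_⟩
  simp [pairFlow]

-- For `S = ∅` the boundary map is injective on flows, so the term is the space `hr.bdrySpace` with
-- coefficient `Q ^ 0`. For nonempty `S` all boundary values vanish at the marked point of some leg,
-- so the boundary space differs from `hs.bdrySpace` by `exists_bdry_ne_zero`.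
open Classical in
theorem NCRel.flowSum_star_apply (hr : NCRel (2 * n) r) (hs : NCRel (2 * n) s) :
    hr.star.flowSum hs.bdrySpace = if r = s then 1 else 0 := by
  have := Fintype.ofFinite hr.star.H
  unfold Drawing.flowSum
  rw [stateSum_eq, Finsupp.finsetSum_apply, Finset.sum_eq_single ∅]
  · have h0 : vanishing hr.star.flows.subtype ∅ = ⊤ := by
      ext a
      simp [mem_vanishing]
    have hk : (⊤ : Submodule (ZMod 2) hr.star.flows) ⊓ LinearMap.ker hr.star.flowBdry = ⊥ := by
      rw [top_inf_eq, LinearMap.ker_eq_bot]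
      intro f g e
      exact Subtype.ext (hr.star_flow_ext f.2 g.2 fun m => congrFun e m)
    rw [Finset.card_empty, pow_zero, one_smul, h0, weight, hk, finrank_bot, pow_zero,
      Finsupp.single_apply]
    refine if_congr ⟨hr.eq_of_bdrySpace_eq hs, ?_⟩ rfl rfl
    rintro rfl
    rfl
  · intro S _ hS
    obtain ⟨h, hh⟩ := Finset.nonempty_iff_ne_empty.2 hS
    rw [Finsupp.smul_apply, weight, Finsupp.single_apply, if_neg, smul_zero]
    intro e
    obtain ⟨b, hb, hbne⟩ := hs.exists_bdry_ne_zero h.1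
    rw [← e] at hb
    obtain ⟨f, hf, rfl⟩ := hb
    have hz : f.1 h = 0 := hf h hh
    refine hbne ?_
    change f.1 ((markEquiv n).symm (markEquiv n h.1), false) = 0
    rw [Equiv.symm_apply_apply]
    obtain ⟨p, _ | _⟩ := h
    · exact hz
    · exact (f.2.1 (p, true)).trans hz
  · exact fun h => absurd (Finset.mem_univ _) h

end

/-- The class of a drawing in the chromatic algebra. -/
def cls {n : ℕ} (X : Drawing n) : ChromaticAlgebra n := (chromaticIdeal n).mkQ (diag X)

/-- The coefficients of the state sum at the spaces `bdrySpace` descend to the quotient, where they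
form a dual family. -/
theorem linearIndependent_star (n : ℕ) : LinearIndependent CQ
    fun r : {r | NCRel (2 * n) r} => cls (NCRel.star r.2) := by
  classical
  refine LinearIndependent.of_pairwise_dual_eq_zero_one _
    (fun s => Finsupp.lapply (NCRel.bdrySpace s.2) ∘ₗ
      (chromaticIdeal n).liftQ (flowMap n) (chromaticIdeal_le_ker n)) ?_ ?_
  · intro s r hsr
    have : flowMap n (diag (NCRel.star r.2)) (NCRel.bdrySpace s.2) = 0 := by
      rw [flowMap_diag, NCRel.flowSum_star_apply, if_neg fun e => hsr (Subtype.ext e.symm)]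
    exact this
  · intro r
    have : flowMap n (diag (NCRel.star r.2)) (NCRel.bdrySpace r.2) = 1 := by
      rw [flowMap_diag, NCRel.flowSum_star_apply, if_pos rfl]
    exact this
end

noncomputable section

/-! ### Relations between classes of drawings -/

section

variable {n : ℕ}

theorem chromaticRel_mem {x : FreeChromatic n} (h : ChromaticRel n x) : x ∈ chromaticIdeal n :=
  Submodule.mem_sInf.2 fun _ hJ => hJ.1 x h

theorem Drawing.Coarsening.cls_eq {X Y : Drawing n} (c : Drawing.Coarsening X Y) :
    cls X = cls Y := by
  have : ChromaticDiagram.mk X = ChromaticDiagram.mk Y := Quot.sound ⟨c⟩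
  unfold cls diag
  rw [this]

theorem cls_contraction_deletion (X : Drawing n) {h : X.H} (hin : X.IsInner h)
    (hl : ¬ X.IsLoop h) : cls X = cls (X.contract h hin hl) - cls (X.delete h hin) := by
  have := (Submodule.Quotient.mk_eq_zero _).2
    (chromaticRel_mem (ChromaticRel.contraction_deletion X h hin hl))
  exact sub_eq_zero.1 this

theorem cls_loop (X : Drawing n) {h : X.H} (hin : X.IsInner h) (hl : X.IsLoop h) :
    cls X = (indetQ - 1) • cls (X.delete h hin) := by
  have := (Submodule.Quotient.mk_eq_zero _).2 (chromaticRel_mem (ChromaticRel.loop X h hin hl))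
  exact sub_eq_zero.1 this

theorem cls_smoothen (X : Drawing n) (v : X.V) (hv : {h | X.src h = Sum.inl v}.ncard = 2) :
    cls X = cls (X.smoothen v hv) := by
  have := (Submodule.Quotient.mk_eq_zero _).2 (chromaticRel_mem (ChromaticRel.two_valent X v hv))
  exact sub_eq_zero.1 this

end

/-! ### Independence of the class from the choice of smooth points -/

namespace Drawing

variable {n : ℕ} (X : Drawing n)

/-- The same drawing with another set of smooth points. -/
def resmooth (T : Set X.V) (hT : ∀ v ∈ T, {h | X.src h = Sum.inl v}.ncard = 2) : Drawing n :=
  { X with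
    smooth := fun v => v ∈ T
    smooth_two := hT }

/-- Smooth points are 2-valent, so the third relation, read backwards, turns them into vertices one
at a time. Afterwards contraction-deletion applies to their edges. -/
theorem cls_resmooth (T : Set X.V) (hT : ∀ v ∈ T, {h | X.src h = Sum.inl v}.ncard = 2) :
    cls (X.resmooth T hT) = cls (X.resmooth ∅ fun _ h => h.elim) := by
  induction T, Set.toFinite T using Set.Finite.induction_on with
  | empty => rfl
  | @insert a T _ _ ih =>
    have hT' : ∀ v ∈ T, {h | X.src h = Sum.inl v}.ncard = 2 := fun v hv => hT v (Or.inr hv)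
    rw [← ih hT', cls_smoothen (X.resmooth T hT') a (hT a (Or.inl rfl))]
    have e : insert a T = {u | u ∈ T ∨ u = a} := Set.ext fun _ => or_comm
    have : ∀ (S : Set X.V) (hS : ∀ v ∈ S, {h | X.src h = Sum.inl v}.ncard = 2),
        S = {u | u ∈ T ∨ u = a} →
          X.resmooth S hS = (X.resmooth T hT').smoothen a (hT a (Or.inl rfl)) := by
      rintro _ hS rfl
      rfl
    rw [this _ hT e]

/-- The same drawing with all smooth points turned into vertices. -/
def rough : Drawing n := X.resmooth ∅ fun _ h => h.elim

theorem cls_rough : cls X.rough = cls X := (X.cls_resmooth {v | X.smooth v} X.smooth_two).symm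

/-! ### Subdivision of an edge -/

open Classical in
/-- The involution on half-edges after the edge of `h` is subdivided. -/
def subRev (h : X.H) : X.H ⊕ Bool → X.H ⊕ Bool
  | Sum.inl x => if x = h then Sum.inr false else if x = X.rev h then Sum.inr true
      else Sum.inl (X.rev x)
  | Sum.inr false => Sum.inl h
  | Sum.inr true => Sum.inl (X.rev h)

/-- The starting points of half-edges after a subdivision. -/
def subSrc : X.H ⊕ Bool → Option X.V ⊕ Mark n
  | Sum.inl x => Sum.map some id (X.src x)
  | Sum.inr _ => Sum.inl none

/-- The rotation after a subdivision. -/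
def subNext : X.H ⊕ Bool → X.H ⊕ Bool := Sum.map X.next not

/-- The faces to the left of half-edges after a subdivision. -/
def subFace (h : X.H) : X.H ⊕ Bool → X.F
  | Sum.inl x => X.face x
  | Sum.inr false => X.face (X.rev h)
  | Sum.inr true => X.face h

/-- Incidence after a subdivision. -/
def subInc (h : X.H) : Option X.V → X.F → Prop
  | none, f => f = X.face h ∨ f = X.face (X.rev h)
  | some v, f => X.inc v f

/-- Smooth points after a subdivision. -/
def subSmooth : Option X.V → Prop
  | none => True
  | some v => X.smooth v

theorem subRev_self (h : X.H) : X.subRev h (Sum.inl h) = Sum.inr false := if_pos rfl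

theorem subRev_rev (h : X.H) : X.subRev h (Sum.inl (X.rev h)) = Sum.inr true := by
  exact (if_neg (X.rev_ne h)).trans (if_pos rfl)

theorem subRev_of_ne {h x : X.H} (h1 : x ≠ h) (h2 : x ≠ X.rev h) :
    X.subRev h (Sum.inl x) = Sum.inl (X.rev x) := by
  exact (if_neg h1).trans (if_neg h2)

theorem subFace_subRev (h x : X.H) : X.subFace h (X.subRev h (Sum.inl x)) = X.face (X.rev x) := by
  by_cases h1 : x = h
  · rw [h1, subRev_self]; rfl
  · by_cases h2 : x = X.rev h
    · rw [h2, subRev_rev, X.rev_rev]; rfl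
    · rw [X.subRev_of_ne h1 h2]; rfl

theorem subSrc_some {x : X.H} {v : X.V} :
    X.subSrc (Sum.inl x) = Sum.inl (some v) ↔ X.src x = Sum.inl v := by
  change Sum.map some id (X.src x) = _ ↔ _
  rcases X.src x with a | a <;> simp

theorem subSrc_mark {x : X.H} {m : Mark n} :
    X.subSrc (Sum.inl x) = Sum.inr m ↔ X.src x = Sum.inr m := by
  change Sum.map some id (X.src x) = _ ↔ _
  rcases X.src x with a | a <;> simp

theorem subSrc_none {x : X.H} : X.subSrc (Sum.inl x) ≠ Sum.inl none := by
  change Sum.map some id (X.src x) ≠ _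
  rcases X.src x with a | a <;> simp

theorem sub_at_some (P : X.H ⊕ Bool → Prop) (v : X.V) :
    {z | P z ∧ X.subSrc z = Sum.inl (some v)} =
      Sum.inl '' {x | P (Sum.inl x) ∧ X.src x = Sum.inl v} := by
  ext z
  rcases z with z | z
  · simp only [Set.mem_ofPred_eq, X.subSrc_some, Set.mem_image, Sum.inl.injEq, exists_eq_right]
  · simp [subSrc]

theorem sub_orbit (x y : X.H ⊕ Bool) :
    X.subSrc x = X.subSrc y ↔ ∃ k : ℕ, X.subNext^[k] x = y := by
  revert x y
  rw [orbit_iff_closed]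
  obtain ⟨hX1, hX⟩ := (orbit_iff_closed X.next X.src).1 X.orbit
  constructor
  · rintro (x | b)
    · simp only [subNext, subSrc, Sum.map_inl, hX1]
    · rfl
  · rintro S hS (x | b) (y | b') hx e
    · refine hX {z | Sum.inl z ∈ S} (fun z hz => hS _ hz) x y hx ?_
      exact Sum.map_injective.2 ⟨Option.some_injective _, Function.injective_id⟩ e
    · exact absurd e.symm X.subSrc_none
    · exact absurd e X.subSrc_none
    · by_cases hb : b' = b
      · rw [hb]; exact hx
      · have := hS _ hx
        have e' : b' = !b := by
          revert hb; cases b <;> cases b' <;> simp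
        rw [e']
        exact this

/-- The drawing with a smooth point inserted on the edge of `h`. -/
def subdivide (h : X.H) : Drawing n where
  V := Option X.V
  H := X.H ⊕ Bool
  F := X.F
  finV := inferInstance
  finH := inferInstance
  finF := X.finF
  src := X.subSrc
  rev := X.subRev h
  next := X.subNext
  face := X.subFace h
  mark m := Sum.inl (X.mark m)
  gapT := X.gapT
  gapB := X.gapB
  inc := X.subInc h
  smooth := X.subSmooth
  rev_rev := by
    rintro (x | (_ | _))
    · by_cases h1 : x = h
      · rw [h1, subRev_self]; rfl
      · by_cases h2 : x = X.rev h
        · rw [h2, subRev_rev]; rfl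
        · have := X.rev_cut (h := h) ⟨h1, h2⟩
          rw [X.subRev_of_ne h1 h2, X.subRev_of_ne this.1 this.2, X.rev_rev]
    · exact X.subRev_self h
    · exact X.subRev_rev h
  rev_ne := by
    rintro (x | (_ | _))
    · by_cases h1 : x = h
      · rw [h1, subRev_self]; simp
      · by_cases h2 : x = X.rev h
        · rw [h2, subRev_rev]; simp
        · rw [X.subRev_of_ne h1 h2]
          exact fun e => X.rev_ne x (Sum.inl_injective e)
    · simp [subRev]
    · simp [subRev]
  orbit := X.sub_orbit
  src_mark := by
    rintro (x | b) m
    · rw [X.subSrc_mark, X.src_mark, Sum.inl.injEq]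
    · simp [subSrc]
  smooth_two := by
    rintro (_ | v) hv
    · have : {z | X.subSrc z = Sum.inl none} = {Sum.inr false, Sum.inr true} := by
        ext (x | (_ | _))
        · simp [X.subSrc_none]
        · simp [subSrc]
        · simp [subSrc]
      rw [this, Set.ncard_pair (by simp)]
    · have := X.sub_at_some (fun _ => True) v
      simp only [true_and] at this
      rw [this, Set.ncard_image_of_injective _ Sum.inl_injective]
      exact X.smooth_two v hv
  corner := by
    rintro (x | (_ | _)) v hv
    · rcases v with _ | v
      · exact absurd hv X.subSrc_none
      · exact (X.subFace_subRev h _).trans (X.corner x v (X.subSrc_some.1 hv))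
    · rfl
    · rfl
  face_top := X.face_top
  face_rev_top i := (X.subFace_subRev h _).trans (X.face_rev_top i)
  face_bot := X.face_bot
  face_rev_bot i := (X.subFace_subRev h _).trans (X.face_rev_bot i)
  gap_left := X.gap_left
  gap_right := X.gap_right
  inc_iff := by
    rintro z (_ | v) hz f
    · constructor
      · rintro (rfl | rfl)
        · exact ⟨Sum.inr true, rfl, rfl⟩
        · exact ⟨Sum.inr false, rfl, rfl⟩
      · rintro ⟨(x | (_ | _)), hx, rfl⟩
        · exact absurd hx X.subSrc_none
        · exact Or.inr rfl
        · exact Or.inl rfl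
    · rcases z with x | b
      · refine (X.inc_iff x v (X.subSrc_some.1 hz) f).trans ⟨?_, ?_⟩
        · rintro ⟨y, hy, rfl⟩
          exact ⟨Sum.inl y, X.subSrc_some.2 hy, rfl⟩
        · rintro ⟨y | b, hy, rfl⟩
          · exact ⟨y, X.subSrc_some.1 hy, rfl⟩
          · simp [subSrc] at hy
      · simp [subSrc] at hz
  inc_unique := by
    rintro (_ | v) hv
    · exact absurd rfl (hv (Sum.inr false))
    · exact X.inc_unique v fun x hx => hv (Sum.inl x) (X.subSrc_some.2 hx)
  jordan c hc hev := by
    -- Evenness at the new 2-valent point: `c` contains both parts of the subdivided edge or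
    -- neither, so it comes from a set of edges of the original drawing.
    have hnone : Sum.inr false ∈ c ↔ Sum.inr true ∈ c := by
      have hn := hev none
      by_contra hne
      have one : ∃ b, {z | z ∈ c ∧ X.subSrc z = Sum.inl none} = {Sum.inr b} := by
        by_cases h1 : Sum.inr false ∈ c
        · have h2 : Sum.inr true ∉ c := fun t => hne (iff_of_true h1 t)
          refine ⟨false, ?_⟩
          ext (x | (_ | _))
          · simp [X.subSrc_none]
          · simp [subSrc, h1]
          · simp [h2]
        · have h2 : Sum.inr true ∈ c := by
            by_contra t
            exact hne (iff_of_false h1 t)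
          refine ⟨true, ?_⟩
          ext (x | (_ | _))
          · simp [X.subSrc_none]
          · simp [h1]
          · simp [subSrc, h2]
      obtain ⟨b, hb⟩ := one
      rw [hb, Set.ncard_singleton] at hn
      exact absurd hn (by decide)
    have hh : Sum.inl (X.rev h) ∈ c ↔ Sum.inl h ∈ c := by
      have h1 := hc (Sum.inr false)
      have h2 := hc (Sum.inr true)
      exact h2.trans (hnone.symm.trans h1.symm)
    obtain ⟨U, hU⟩ := X.jordan {x | Sum.inl x ∈ c} (fun x => by
      by_cases h1 : x = h
      · rw [h1]; exact hh
      · by_cases h2 : x = X.rev h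
        · rw [h2, X.rev_rev]; exact hh.symm
        · have := hc (Sum.inl x)
          rwa [X.subRev_of_ne h1 h2] at this) (fun v => by
      have := hev (some v)
      rwa [X.sub_at_some (fun z => z ∈ c), Set.ncard_image_of_injective _ Sum.inl_injective] at this)
    refine ⟨U, ?_⟩
    rintro (x | (_ | _))
    · rw [X.subFace_subRev]
      exact hU x
    · refine ((hc (Sum.inr false)).symm.trans (hU h)).trans ?_
      change ¬ (X.face h ∈ U ↔ X.face (X.rev h) ∈ U) ↔ ¬ (X.face (X.rev h) ∈ U ↔ X.face h ∈ U)
      exact not_congr iff_comm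
    · refine ((hc (Sum.inr true)).symm.trans (hU (X.rev h))).trans ?_
      rw [X.rev_rev]
      change ¬ (X.face (X.rev h) ∈ U ↔ X.face h ∈ U) ↔ ¬ (X.face h ∈ U ↔ X.face (X.rev h) ∈ U)
      exact not_congr iff_comm
  dual_connected U hU := X.dual_connected U fun x => by
    have := hU (Sum.inl x)
    rwa [X.subFace_subRev] at this

/-- A subdivided drawing coarsens to the original one. -/
def subdivideCoarsening (h : X.H) : Coarsening (X.subdivide h) X where
  gone := {none}
  onH := Sum.inl
  onV := some
  onF := Equiv.refl _
  gone_smooth := by rintro _ rfl; trivial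
  gone_apart := by
    rintro (x | (_ | _)) _ rfl _ rfl e
    · exact absurd e X.subSrc_none
    · exact X.subSrc_none
    · exact X.subSrc_none
  injH := Sum.inl_injective
  rangeH := by
    rintro (x | b)
    · refine iff_of_true ⟨x, rfl⟩ ?_
      rintro _ rfl
      exact X.subSrc_none
    · refine iff_of_false (by rintro ⟨y, hy⟩; cases hy) fun t => t none rfl rfl
  injV := Option.some_injective _
  rangeV := by
    rintro (_ | v)
    · exact iff_of_false (by rintro ⟨y, hy⟩; cases hy) fun t => t rfl
    · exact iff_of_true ⟨v, rfl⟩ nofun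
  src_eq y := rfl
  next_eq y := rfl
  rev_eq y hy := by
    have h1 : y ≠ h := by
      rintro rfl
      exact hy none rfl (congrArg X.subSrc (X.subRev_self y))
    have h2 : y ≠ X.rev h := by
      rintro rfl
      exact hy none rfl (congrArg X.subSrc (X.subRev_rev h))
    exact (X.subRev_of_ne h1 h2).symm
  rev_gone y v hv e := by
    subst hv
    change X.subSrc (X.subRev h (Sum.inl y)) = _ at e
    change Sum.inl (X.rev y) = X.subRev h (X.subNext (X.subRev h (Sum.inl y)))
    by_cases h1 : y = h
    · rw [h1, subRev_self]; rfl
    · by_cases h2 : y = X.rev h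
      · rw [h2, subRev_rev, X.rev_rev]; rfl
      · rw [X.subRev_of_ne h1 h2] at e
        exact absurd e X.subSrc_none
  face_eq y := rfl
  mark_eq m := rfl
  gapT_eq j := rfl
  gapB_eq j := rfl
  inc_eq v f := Iff.rfl
  smooth_eq v := Iff.rfl

theorem cls_subdivide (h : X.H) : cls (X.subdivide h) = cls X := (X.subdivideCoarsening h).cls_eq

end Drawing
end

noncomputable section

namespace Drawing

variable {n : ℕ} (X : Drawing n)

/-! ### Joining an isolated vertex to a neighbouring one -/

/-- The starting points of half-edges after an edge is added. -/
def addSrc (p q : X.V ⊕ Mark n) : X.H ⊕ Bool → X.V ⊕ Mark n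
  | Sum.inl x => X.src x
  | Sum.inr false => p
  | Sum.inr true => q

open Classical in
/-- The rotation after a pendant edge is added in the corner which follows `h`. -/
def attachNext (h : X.H) : X.H ⊕ Bool → X.H ⊕ Bool
  | Sum.inl x => if x = h then Sum.inr false else Sum.inl (X.next x)
  | Sum.inr false => Sum.inl (X.next h)
  | Sum.inr true => Sum.inr true

theorem attachNext_self (h : X.H) : X.attachNext h (Sum.inl h) = Sum.inr false := if_pos rfl

theorem attachNext_of_ne {h x : X.H} (e : x ≠ h) :
    X.attachNext h (Sum.inl x) = Sum.inl (X.next x) := if_neg e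

/-- The faces to the left of half-edges after a pendant edge is added. -/
def attachFace (h : X.H) : X.H ⊕ Bool → X.F := Sum.elim X.face fun _ => X.face h

theorem attach_orbit {h : X.H} {v : X.V} (hv : ∀ x, X.src x ≠ Sum.inl v) (x y : X.H ⊕ Bool) :
    X.addSrc (X.src h) (Sum.inl v) x = X.addSrc (X.src h) (Sum.inl v) y ↔
      ∃ k : ℕ, (X.attachNext h)^[k] x = y := by
  revert x y
  rw [orbit_iff_closed]
  obtain ⟨hX1, hX⟩ := (orbit_iff_closed X.next X.src).1 X.orbit
  constructor
  · rintro (x | (_ | _))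
    · by_cases e : x = h
      · rw [e, attachNext_self]; rfl
      · rw [X.attachNext_of_ne e]; exact hX1 x
    · exact hX1 h
    · rfl
  · intro S hS
    have cl : ∀ z, Sum.inl z ∈ S → Sum.inl (X.next z) ∈ S := by
      intro z hz
      have := hS _ hz
      by_cases e : z = h
      · rw [e, attachNext_self] at this
        rw [e]; exact hS _ this
      · rwa [X.attachNext_of_ne e] at this
    have main : ∀ x y, Sum.inl x ∈ S → X.src y = X.src x → Sum.inl y ∈ S :=
      hX {z | Sum.inl z ∈ S} cl
    have ext : ∀ x y, Sum.inl x ∈ S → X.addSrc (X.src h) (Sum.inl v) y = X.src x → y ∈ S := by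
      rintro x (y | (_ | _)) hx e
      · exact main x y hx e
      · have := hS _ (main x h hx e)
        rwa [attachNext_self] at this
      · exact absurd e.symm (hv x)
    rintro (x | (_ | _)) y hx e
    · exact ext x y hx e
    · exact ext (X.next h) y (hS _ hx) (e.trans (hX1 h).symm)
    · rcases y with y | (_ | _)
      · exact absurd e (hv y)
      · exact absurd e (hv h)
      · exact hx

/-- The drawing with an edge added from the vertex at `h` to the isolated vertex `v`, which lies in
the face to the left of `h`. -/
def attach (h : X.H) (v w : X.V) (hv : ∀ x, X.src x ≠ Sum.inl v) (hw : X.src h = Sum.inl w)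
    (hns : ¬ X.smooth w) (hf : X.inc v (X.face h)) : Drawing n where
  V := X.V
  H := X.H ⊕ Bool
  F := X.F
  finV := X.finV
  finH := inferInstance
  finF := X.finF
  src := X.addSrc (X.src h) (Sum.inl v)
  rev := Sum.map X.rev not
  next := X.attachNext h
  face := X.attachFace h
  mark m := Sum.inl (X.mark m)
  gapT := X.gapT
  gapB := X.gapB
  inc := X.inc
  smooth := X.smooth
  rev_rev := by
    rintro (x | b)
    · exact congrArg Sum.inl (X.rev_rev x)
    · exact congrArg Sum.inr (Bool.not_not b)
  rev_ne := by
    rintro (x | b) e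
    · exact X.rev_ne x (Sum.inl_injective e)
    · exact Bool.not_ne_self b (Sum.inr_injective e)
  orbit := X.attach_orbit hv
  src_mark := by
    rintro (x | (_ | _)) m
    · rw [Sum.inl.injEq]; exact X.src_mark x m
    · exact iff_of_false (by rw [hw]; nofun) (by nofun)
    · exact iff_of_false (by nofun) (by nofun)
  smooth_two u hu := by
    have h2 := X.smooth_two u hu
    have e : {z | X.addSrc (X.src h) (Sum.inl v) z = Sum.inl u} =
        Sum.inl '' {x | X.src x = Sum.inl u} := by
      ext (x | (_ | _))
      · simp [addSrc]
      · refine iff_of_false ?_ (by simp)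
        rintro (e : X.src h = _)
        rw [hw] at e
        exact hns (Sum.inl_injective e ▸ hu)
      · refine iff_of_false ?_ (by simp)
        intro e
        cases e
        have : {x | X.src x = Sum.inl v} = ∅ := Set.eq_empty_of_forall_notMem hv
        rw [this, Set.ncard_empty] at h2
        exact absurd h2 (by decide)
    rw [e, Set.ncard_image_of_injective _ Sum.inl_injective, h2]
  corner := by
    rintro (x | (_ | _)) u hu
    · by_cases e : x = h
      · rw [e, attachNext_self]; rfl
      · rw [X.attachNext_of_ne e]; exact X.corner x u hu
    · exact X.corner h u hu
    · rfl
  face_top := X.face_top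
  face_rev_top := X.face_rev_top
  face_bot := X.face_bot
  face_rev_bot := X.face_rev_bot
  gap_left := X.gap_left
  gap_right := X.gap_right
  inc_iff := by
    have key : ∀ x u, X.src x = Sum.inl u → ∀ f, X.inc u f ↔
        ∃ y, X.addSrc (X.src h) (Sum.inl v) y = Sum.inl u ∧ X.attachFace h y = f := by
      intro x u hx f
      refine (X.inc_iff x u hx f).trans ⟨?_, ?_⟩
      · rintro ⟨y, hy, e⟩
        exact ⟨Sum.inl y, hy, e⟩
      · rintro ⟨y | (_ | _), hy, e⟩
        · exact ⟨y, hy, e⟩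
        · exact ⟨h, hy, e⟩
        · cases hy
          exact absurd hx (hv x)
    rintro (x | (_ | _)) u hx f
    · exact key x u hx f
    · exact key h u hx f
    · cases hx
      constructor
      · intro hf'
        exact ⟨Sum.inr true, rfl, (X.inc_unique v hv).unique hf hf'⟩
      · rintro ⟨y | (_ | _), hy, rfl⟩
        · exact absurd hy (hv y)
        · exact absurd hy (hv h)
        · exact hf
  inc_unique u hu := X.inc_unique u fun x => hu (Sum.inl x)
  jordan c hc hev := by
    -- The new edge is the only one at `v`, so evenness there excludes it from `c`, and the Jordan
    -- property of `X` applies to the rest.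
    have ht : Sum.inr true ∉ c := by
      intro ht
      have : {z | z ∈ c ∧ X.addSrc (X.src h) (Sum.inl v) z = Sum.inl v} = {Sum.inr true} := by
        ext (x | (_ | _))
        · exact iff_of_false (fun e => hv x e.2) (by nofun)
        · exact iff_of_false (fun e => hv h e.2) (by nofun)
        · exact iff_of_true ⟨ht, rfl⟩ rfl
      have he := hev v
      rw [this, Set.ncard_singleton] at he
      exact absurd he (by decide)
    have hf' : Sum.inr false ∉ c := fun t => ht ((hc (Sum.inr false)).2 t)
    obtain ⟨U, hU⟩ := X.jordan {x | Sum.inl x ∈ c} (fun x => hc (Sum.inl x)) (fun u => by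
      have he := hev u
      have : {z | z ∈ c ∧ X.addSrc (X.src h) (Sum.inl v) z = Sum.inl u} =
          Sum.inl '' {x | x ∈ {x | Sum.inl x ∈ c} ∧ X.src x = Sum.inl u} := by
        ext (x | (_ | _))
        · simp [addSrc]
        · exact iff_of_false (fun e => hf' e.1) (by simp)
        · exact iff_of_false (fun e => ht e.1) (by simp)
      rwa [this, Set.ncard_image_of_injective _ Sum.inl_injective] at he)
    refine ⟨U, ?_⟩
    rintro (x | (_ | _))
    · exact hU x
    · exact iff_of_false hf' (not_not.2 Iff.rfl)
    · exact iff_of_false ht (not_not.2 Iff.rfl)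
  dual_connected U hU := X.dual_connected U fun x => hU (Sum.inl x)

section attach

variable {X} {h : X.H} {v w : X.V} (hv : ∀ x, X.src x ≠ Sum.inl v) (hw : X.src h = Sum.inl w)
  (hns : ¬ X.smooth w) (hf : X.inc v (X.face h))

theorem attach_isInner (hsv : ¬ X.smooth v) :
    (X.attach h v w hv hw hns hf).IsInner (Sum.inr false) :=
  ⟨w, v, hw, rfl, hns, hsv⟩

theorem attach_not_isLoop : ¬ (X.attach h v w hv hw hns hf).IsLoop (Sum.inr false) :=
  fun e => hv h e

/-- Deleting the new edge gives the original drawing. -/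
def attachCoarsening (hsv : ¬ X.smooth v) : Coarsening
    ((X.attach h v w hv hw hns hf).delete (Sum.inr false) (attach_isInner hv hw hns hf hsv)) X where
  gone := ∅
  onH x := ⟨Sum.inl x, by nofun, by nofun⟩
  onV := id
  onF := Equiv.ofBijective (Quot.mk _) ⟨fun f g e => by
    refine congrArg (Quot.lift id ?_) e
    rintro _ _ ⟨rfl, rfl⟩
    rfl, Quot.mk_surjective⟩
  gone_smooth _ t := t.elim
  gone_apart _ _ t := t.elim
  injH _ _ e := Sum.inl_injective (congrArg Subtype.val e)
  rangeH := by
    rintro ⟨x | (_ | _), h1, h2⟩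
    · exact iff_of_true ⟨x, rfl⟩ fun _ t => t.elim
    · exact absurd rfl h1
    · exact absurd rfl h2
  injV := Function.injective_id
  rangeV u := iff_of_true ⟨u, rfl⟩ fun t => t
  src_eq y := by
    change X.src y = Sum.map id id (X.src y)
    rw [Sum.map_id_id]; rfl
  next_eq y := by
    apply Subtype.ext
    change skipTwo (X.attachNext h) (Sum.inr false) (Sum.inr true) (X.attachNext h (Sum.inl y)) =
      Sum.inl (X.next y)
    by_cases e : y = h
    · rw [e, attachNext_self, skipTwo, if_neg (by simp)]
      exact if_pos ⟨by nofun, by nofun⟩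
    · rw [X.attachNext_of_ne e, skipTwo, if_pos (by simp)]
  rev_eq y _ := rfl
  rev_gone _ _ t := t.elim
  face_eq y := rfl
  mark_eq m := rfl
  gapT_eq j := rfl
  gapB_eq j := rfl
  inc_eq u f := by
    constructor
    · rintro ⟨g, hg, e⟩
      have : g = f := by
        refine congrArg (Quot.lift id ?_) e
        rintro _ _ ⟨rfl, rfl⟩
        rfl
      exact this ▸ hg
    · exact fun t => ⟨f, t, rfl⟩
  smooth_eq u := Iff.rfl

end attach

/-! ### Doubling a pendant edge -/

open Classical in
/-- The rotation after the pendant edge of `h` is doubled. -/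
def doubleNext (h : X.H) : X.H ⊕ Bool → X.H ⊕ Bool
  | Sum.inl x => if x = h then Sum.inr false else if x = X.rev h then Sum.inr true
      else Sum.inl (X.next x)
  | Sum.inr false => Sum.inl (X.next h)
  | Sum.inr true => Sum.inl (X.next (X.rev h))

open Classical in
/-- The faces after the pendant edge of `h` is doubled; `none` is the face between the two copies. -/
def doubleFace (h : X.H) : X.H ⊕ Bool → Option X.F
  | Sum.inl x => if x = h then none else some (X.face x)
  | Sum.inr false => some (X.face h)
  | Sum.inr true => none

/-- Incidence after the pendant edge of `h` is doubled. -/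
def doubleInc (h : X.H) (v : X.V) : Option X.F → Prop
  | none => X.src h = Sum.inl v ∨ X.src (X.rev h) = Sum.inl v
  | some f => X.inc v f

theorem doubleNext_left (h : X.H) : X.doubleNext h (Sum.inl h) = Sum.inr false := if_pos rfl

theorem doubleNext_right (h : X.H) : X.doubleNext h (Sum.inl (X.rev h)) = Sum.inr true :=
  (if_neg (X.rev_ne h)).trans (if_pos rfl)

theorem doubleNext_of_ne {h x : X.H} (h1 : x ≠ h) (h2 : x ≠ X.rev h) :
    X.doubleNext h (Sum.inl x) = Sum.inl (X.next x) := (if_neg h1).trans (if_neg h2)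

theorem doubleFace_self (h : X.H) : X.doubleFace h (Sum.inl h) = none := if_pos rfl

theorem doubleFace_of_ne {h x : X.H} (h1 : x ≠ h) :
    X.doubleFace h (Sum.inl x) = some (X.face x) := if_neg h1

theorem double_orbit (h : X.H) (x y : X.H ⊕ Bool) :
    X.addSrc (X.src h) (X.src (X.rev h)) x = X.addSrc (X.src h) (X.src (X.rev h)) y ↔
      ∃ k : ℕ, (X.doubleNext h)^[k] x = y := by
  revert x y
  rw [orbit_iff_closed]
  obtain ⟨hX1, hX⟩ := (orbit_iff_closed X.next X.src).1 X.orbit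
  constructor
  · rintro (x | (_ | _))
    · by_cases e : x = h
      · rw [e, doubleNext_left]; rfl
      · by_cases e' : x = X.rev h
        · rw [e', doubleNext_right]; rfl
        · rw [X.doubleNext_of_ne e e']; exact hX1 x
    · exact hX1 h
    · exact hX1 _
  · intro S hS
    have cl : ∀ z, Sum.inl z ∈ S → Sum.inl (X.next z) ∈ S := by
      intro z hz
      have := hS _ hz
      by_cases e : z = h
      · rw [e, doubleNext_left] at this
        rw [e]; exact hS _ this
      · by_cases e' : z = X.rev h
        · rw [e', doubleNext_right] at this
          rw [e']; exact hS _ this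
        · rwa [X.doubleNext_of_ne e e'] at this
    have main : ∀ x y, Sum.inl x ∈ S → X.src y = X.src x → Sum.inl y ∈ S :=
      hX {z | Sum.inl z ∈ S} cl
    have ext : ∀ x y, Sum.inl x ∈ S → X.addSrc (X.src h) (X.src (X.rev h)) y = X.src x →
        y ∈ S := by
      rintro x (y | (_ | _)) hx e
      · exact main x y hx e
      · have := hS _ (main x h hx e)
        rwa [doubleNext_left] at this
      · have := hS _ (main x (X.rev h) hx e)
        rwa [doubleNext_right] at this
    rintro (x | (_ | _)) y hx e
    · exact ext x y hx e
    · exact ext (X.next h) y (hS _ hx) (e.trans (hX1 h).symm)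
    · exact ext (X.next (X.rev h)) y (hS _ hx) (e.trans (hX1 _).symm)

variable {X} in
theorem not_isLoop_of_fixed {h : X.H} (hfix : X.next (X.rev h) = X.rev h) : ¬ X.IsLoop h :=
  fun e => X.rev_ne h (X.eq_of_fixed hfix e).symm

/-- The drawing with the pendant inner edge of `h` doubled. -/
def double (h : X.H) (hin : X.IsInner h) (hfix : X.next (X.rev h) = X.rev h) : Drawing n where
  V := X.V
  H := X.H ⊕ Bool
  F := Option X.F
  finV := X.finV
  finH := inferInstance
  finF := inferInstance
  src := X.addSrc (X.src h) (X.src (X.rev h))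
  rev := Sum.map X.rev not
  next := X.doubleNext h
  face := X.doubleFace h
  mark m := Sum.inl (X.mark m)
  gapT j := some (X.gapT j)
  gapB j := some (X.gapB j)
  inc := X.doubleInc h
  smooth := X.smooth
  rev_rev := by
    rintro (x | b)
    · exact congrArg Sum.inl (X.rev_rev x)
    · exact congrArg Sum.inr (Bool.not_not b)
  rev_ne := by
    rintro (x | b) e
    · exact X.rev_ne x (Sum.inl_injective e)
    · exact Bool.not_ne_self b (Sum.inr_injective e)
  orbit := X.double_orbit h
  src_mark := by
    obtain ⟨v, w, hv, hw, -⟩ := hin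
    rintro (x | (_ | _)) m
    · rw [Sum.inl.injEq]; exact X.src_mark x m
    · exact iff_of_false (by rw [hv]; nofun) (by nofun)
    · exact iff_of_false (by rw [hw]; nofun) (by nofun)
  smooth_two u hu := by
    obtain ⟨v, w, hv, hw, nv, nw⟩ := hin
    have e : {z | X.addSrc (X.src h) (X.src (X.rev h)) z = Sum.inl u} =
        Sum.inl '' {x | X.src x = Sum.inl u} := by
      ext (x | (_ | _))
      · simp [addSrc]
      · refine iff_of_false ?_ (by simp)
        rintro (e : X.src h = _)
        rw [hv] at e
        exact nv (Sum.inl_injective e ▸ hu)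
      · refine iff_of_false ?_ (by simp)
        rintro (e : X.src (X.rev h) = _)
        rw [hw] at e
        exact nw (Sum.inl_injective e ▸ hu)
    rw [e, Set.ncard_image_of_injective _ Sum.inl_injective, X.smooth_two u hu]
  corner := by
    have hl := not_isLoop_of_fixed hfix
    have hff := X.face_of_fixed hin hfix
    rintro (x | (_ | _)) u hu
    · by_cases e : x = h
      · rw [e, doubleNext_left, doubleFace_self]; rfl
      · by_cases e' : x = X.rev h
        · rw [e', doubleNext_right, X.doubleFace_of_ne (X.rev_ne h), ← hff]; rfl
        · rw [X.doubleNext_of_ne e e', X.doubleFace_of_ne e]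
          have : X.rev (X.next x) ≠ h := by
            intro t
            refine e' (X.next_inj ?_)
            rw [hfix, ← t, X.rev_rev]
          exact (X.doubleFace_of_ne this).trans (congrArg some (X.corner x u hu))
    · have : X.rev (X.next h) ≠ h := by
        intro t
        refine hl ?_
        change X.src h = X.src (X.rev h)
        rw [← X.src_next h]
        nth_rewrite 2 [← t]
        rw [X.rev_rev]
      exact (X.doubleFace_of_ne this).trans (congrArg some (X.corner h u hu))
    · change X.doubleFace h (Sum.inl (X.rev (X.next (X.rev h)))) = none
      rw [hfix, X.rev_rev, doubleFace_self]
  face_top i := (X.doubleFace_of_ne fun e => by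
    obtain ⟨v, w, hv, hw, -⟩ := hin
    rw [← e, (X.src_mark _ _).2 rfl] at hv; cases hv).trans (congrArg some (X.face_top i))
  face_rev_top i := (X.doubleFace_of_ne fun e => by
    obtain ⟨v, w, hv, hw, -⟩ := hin
    rw [← e, X.rev_rev, (X.src_mark _ _).2 rfl] at hw; cases hw).trans
      (congrArg some (X.face_rev_top i))
  face_bot i := (X.doubleFace_of_ne fun e => by
    obtain ⟨v, w, hv, hw, -⟩ := hin
    rw [← e, (X.src_mark _ _).2 rfl] at hv; cases hv).trans (congrArg some (X.face_bot i))
  face_rev_bot i := (X.doubleFace_of_ne fun e => by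
    obtain ⟨v, w, hv, hw, -⟩ := hin
    rw [← e, X.rev_rev, (X.src_mark _ _).2 rfl] at hw; cases hw).trans
      (congrArg some (X.face_rev_bot i))
  gap_left := congrArg some X.gap_left
  gap_right := congrArg some X.gap_right
  inc_iff := by
    have hff := X.face_of_fixed hin hfix
    have key : ∀ x u, X.src x = Sum.inl u → ∀ f, X.doubleInc h u f ↔
        ∃ y, X.addSrc (X.src h) (X.src (X.rev h)) y = Sum.inl u ∧ X.doubleFace h y = f := by
      rintro x u hx (_ | f)
      · constructor
        · rintro (e | e)
          · exact ⟨Sum.inl h, e, X.doubleFace_self h⟩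
          · exact ⟨Sum.inr true, e, rfl⟩
        · rintro ⟨y | (_ | _), hy, e⟩
          · by_cases e' : y = h
            · rw [e'] at hy; exact Or.inl hy
            · rw [X.doubleFace_of_ne e'] at e; cases e
          · cases e
          · exact Or.inr hy
      · refine (X.inc_iff x u hx f).trans ⟨?_, ?_⟩
        · rintro ⟨y, hy, rfl⟩
          by_cases e' : y = h
          · exact ⟨Sum.inr false, e' ▸ hy, by rw [e']; rfl⟩
          · exact ⟨Sum.inl y, hy, X.doubleFace_of_ne e'⟩
        · rintro ⟨y | (_ | _), hy, e⟩
          · by_cases e' : y = h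
            · rw [e', doubleFace_self] at e; cases e
            · rw [X.doubleFace_of_ne e'] at e
              exact ⟨y, hy, Option.some_injective _ e⟩
          · exact ⟨h, hy, Option.some_injective _ e⟩
          · cases e
    rintro (x | (_ | _)) u hx f
    · exact key x u hx f
    · exact key h u hx f
    · exact key (X.rev h) u hx f
  inc_unique u hu := by
    obtain ⟨f, hf, hf'⟩ := X.inc_unique u fun x => hu (Sum.inl x)
    refine ⟨some f, hf, ?_⟩
    rintro (_ | g) hg
    · rcases hg with e | e
      · exact absurd e (hu (Sum.inl h))
      · exact absurd e (hu (Sum.inl (X.rev h)))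
    · exact congrArg some (hf' g hg)
  jordan c hc hev := by
    have hl := not_isLoop_of_fixed hfix
    have hff := X.face_of_fixed hin hfix
    obtain ⟨v, w, hv, hw, -⟩ := hin
    have hvw : v ≠ w := fun e => hl (by rw [IsLoop, hv, hw, e])
    have only : ∀ x, X.src x = Sum.inl w → x = X.rev h := fun x hx =>
      X.eq_of_fixed hfix (hx.trans hw.symm)
    have hrev : ∀ x, Sum.inl (X.rev x) ∈ c ↔ Sum.inl x ∈ c := fun x => hc (Sum.inl x)
    have hnew : Sum.inr true ∈ c ↔ Sum.inr false ∈ c := hc (Sum.inr false)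
    -- The pendant vertex `w` meets only the two copies of the edge, so evenness there puts both
    -- into `c` or neither.
    have hpair : Sum.inl (X.rev h) ∈ c ↔ Sum.inr true ∈ c := by
      have he := hev w
      by_contra hne
      have one : ∃ t, {z | z ∈ c ∧ X.addSrc (X.src h) (X.src (X.rev h)) z = Sum.inl w} = {t} := by
        by_cases h1 : Sum.inr true ∈ c
        · have h2 : Sum.inl (X.rev h) ∉ c := fun t => hne (iff_of_true t h1)
          refine ⟨Sum.inr true, ?_⟩
          ext (x | (_ | _))
          · refine iff_of_false ?_ (by nofun)
            rintro ⟨hx, e⟩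
            exact h2 (only x e ▸ hx)
          · refine iff_of_false ?_ (by nofun)
            rintro ⟨hx, e⟩
            exact hl (by rw [IsLoop, hw]; exact e)
          · exact iff_of_true ⟨h1, hw⟩ rfl
        · have h2 : Sum.inl (X.rev h) ∈ c := by
            by_contra t
            exact hne (iff_of_false t h1)
          refine ⟨Sum.inl (X.rev h), ?_⟩
          ext (x | (_ | _))
          · constructor
            · rintro ⟨hx, e⟩
              exact congrArg Sum.inl (only x e)
            · intro e
              rw [Set.mem_singleton_iff.1 e]
              exact ⟨h2, hw⟩
          · refine iff_of_false ?_ (by nofun)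
            rintro ⟨hx, e⟩
            exact hl (by rw [IsLoop, hw]; exact e)
          · exact iff_of_false (fun e => h1 e.1) (by nofun)
      obtain ⟨t, ht⟩ := one
      rw [ht, Set.ncard_singleton] at he
      exact absurd he (by decide)
    -- Dropping both copies removes zero or two half-edges of `c` at each point and so preserves
    -- parity.
    have hev0 : ∀ u, Even {x | x ∈ {x | Sum.inl x ∈ c ∧ x ≠ h ∧ x ≠ X.rev h} ∧
        X.src x = Sum.inl u}.ncard := by
      intro u
      have he := hev u
      set A := {x | x ∈ {x | Sum.inl x ∈ c ∧ x ≠ h ∧ x ≠ X.rev h} ∧ X.src x = Sum.inl u} with hA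
      have hAn : (Sum.inl '' A : Set (X.H ⊕ Bool)).ncard = A.ncard :=
        Set.ncard_image_of_injective _ Sum.inl_injective
      have hAm : ∀ x, (Sum.inl x : X.H ⊕ Bool) ∈ Sum.inl '' A ↔ x ∈ A := fun x => by simp
      by_cases hcase : Sum.inl h ∈ c ∧ (u = v ∨ u = w)
      · obtain ⟨hb, hu⟩ := hcase
        have hb2 := (hrev h).2 hb
        have hb3 := hpair.1 hb2
        have hb4 := hnew.1 hb3
        have two : ∀ a b : X.H ⊕ Bool, a ≠ b → a ∉ Sum.inl '' A → b ∉ Sum.inl '' A →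
            {z | z ∈ c ∧ X.addSrc (X.src h) (X.src (X.rev h)) z = Sum.inl u} =
              insert a (insert b (Sum.inl '' A)) → Even A.ncard := by
          intro a b hab ha hb e
          rw [e, Set.ncard_insert_of_notMem (by
            rintro (t | t)
            · exact hab t
            · exact ha t), Set.ncard_insert_of_notMem hb, hAn] at he
          rcases he with ⟨k, hk⟩
          exact ⟨k - 1, by omega⟩
        rcases hu with rfl | rfl
        · refine two (Sum.inl h) (Sum.inr false) (by nofun) ?_ (by simp) ?_
          · rw [hAm]; rintro ⟨⟨-, t, -⟩, -⟩; exact t rfl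
          · ext (x | (_ | _))
            · simp only [Set.mem_insert_iff, Sum.inl.injEq, reduceCtorEq, false_or, hAm]
              constructor
              · rintro ⟨hx, e⟩
                by_cases e1 : x = h
                · exact Or.inl e1
                · refine Or.inr ⟨⟨hx, e1, fun e2 => ?_⟩, e⟩
                  rw [e2] at e
                  exact hl (hv.trans e.symm)
              · rintro (rfl | ⟨⟨hx, -⟩, e⟩)
                · exact ⟨hb, hv⟩
                · exact ⟨hx, e⟩
            · exact iff_of_true ⟨hb4, hv⟩ (Or.inr (Or.inl rfl))
            · refine iff_of_false ?_ (by simp)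
              rintro ⟨-, e⟩
              exact hl (hv.trans e.symm)
        · refine two (Sum.inl (X.rev h)) (Sum.inr true) (by nofun) ?_ (by simp) ?_
          · rw [hAm]; rintro ⟨⟨-, -, t⟩, -⟩; exact t rfl
          · ext (x | (_ | _))
            · simp only [Set.mem_insert_iff, Sum.inl.injEq, reduceCtorEq, false_or, hAm]
              constructor
              · rintro ⟨hx, e⟩
                exact Or.inl (only x e)
              · rintro (rfl | ⟨⟨hx, -⟩, e⟩)
                · exact ⟨hb2, hw⟩
                · exact ⟨hx, e⟩
            · refine iff_of_false ?_ (by simp)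
              rintro ⟨-, e⟩
              exact hl (by rw [IsLoop, hw]; exact e)
            · exact iff_of_true ⟨hb3, hw⟩ (Or.inr (Or.inl rfl))
      · have hno : ∀ z, z ∈ c → X.addSrc (X.src h) (X.src (X.rev h)) z = Sum.inl u →
            z ∈ (Sum.inl '' A : Set (X.H ⊕ Bool)) := by
          rintro (x | (_ | _)) hx e
          · refine (hAm x).2 ⟨⟨hx, ?_, ?_⟩, e⟩
            · rintro rfl
              exact hcase ⟨hx, Or.inl (Sum.inl_injective (e.symm.trans hv))⟩
            · rintro rfl
              exact hcase ⟨(hrev h).1 hx, Or.inr (Sum.inl_injective (e.symm.trans hw))⟩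
          · exact absurd ⟨(hrev h).1 (hpair.2 (hnew.2 hx)),
              Or.inl (Sum.inl_injective (e.symm.trans hv))⟩ hcase
          · exact absurd ⟨(hrev h).1 (hpair.2 hx),
              Or.inr (Sum.inl_injective (e.symm.trans hw))⟩ hcase
        have : {z | z ∈ c ∧ X.addSrc (X.src h) (X.src (X.rev h)) z = Sum.inl u} =
            Sum.inl '' A := by
          ext z
          refine ⟨fun e => hno z e.1 e.2, ?_⟩
          rintro ⟨x, ⟨⟨hx, -⟩, e⟩, rfl⟩
          exact ⟨hx, e⟩
        rwa [this, hAn] at he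
    obtain ⟨U, hU⟩ := X.jordan {x | Sum.inl x ∈ c ∧ x ≠ h ∧ x ≠ X.rev h} (fun x => by
      constructor
      · rintro ⟨a, b⟩
        have := X.rev_cut b
        rw [X.rev_rev] at this
        exact ⟨(hrev x).1 a, this⟩
      · rintro ⟨a, b⟩
        exact ⟨(hrev x).2 a, X.rev_cut b⟩) hev0
    -- The face between the two copies lies on the side of the surrounding face `X.face h`, unless
    -- the copies belong to `c`, in which case it lies on the other side.
    refine ⟨{f | Option.elim f (X.face h ∈ U ↔ ¬ Sum.inl h ∈ c) (fun g => g ∈ U)}, ?_⟩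
    have base : Sum.inl h ∈ c ↔ ¬ ((X.face h ∈ U ↔ ¬ Sum.inl h ∈ c) ↔ X.face h ∈ U) := by tauto
    have base' : Sum.inl h ∈ c ↔ ¬ (X.face h ∈ U ↔ (X.face h ∈ U ↔ ¬ Sum.inl h ∈ c)) := by tauto
    rintro (x | (_ | _))
    · change Sum.inl x ∈ c ↔ ¬ (X.doubleFace h (Sum.inl x) ∈ _ ↔
        X.doubleFace h (Sum.inl (X.rev x)) ∈ _)
      by_cases e : x = h
      · rw [e, doubleFace_self, X.doubleFace_of_ne (X.rev_ne h), ← hff]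
        exact base
      · by_cases e' : x = X.rev h
        · rw [e', X.rev_rev, doubleFace_self, X.doubleFace_of_ne (X.rev_ne h), ← hff]
          exact (hrev h).trans base'
        · rw [X.doubleFace_of_ne e, X.doubleFace_of_ne (X.rev_cut ⟨e, e'⟩).1]
          exact Iff.trans ⟨fun t => ⟨t, e, e'⟩, fun t => t.1⟩ (hU x)
    · exact (hnew.symm.trans (hpair.symm.trans (hrev h))).trans base'
    · exact (hpair.symm.trans (hrev h)).trans base
  dual_connected U hU := by
    have hff := X.face_of_fixed hin hfix
    have h1 : none ∈ U ↔ some (X.face h) ∈ U := hU (Sum.inr true)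
    have := X.dual_connected {g | some g ∈ U} fun x => by
      by_cases e : x = h
      · rw [e, hff]
      · by_cases e' : x = X.rev h
        · rw [e', X.rev_rev, hff]
        · have := hU (Sum.inl x)
          change X.doubleFace h (Sum.inl x) ∈ _ ↔ X.doubleFace h (Sum.inl (X.rev x)) ∈ _ at this
          rwa [X.doubleFace_of_ne e, X.doubleFace_of_ne (X.rev_cut ⟨e, e'⟩).1] at this
    simp only [Set.eq_empty_iff_forall_notMem, Set.eq_univ_iff_forall, Set.mem_ofPred_eq] at this ⊢
    rcases this with t | t
    · refine Or.inl ?_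
      rintro (_ | g)
      · exact fun e => t _ (h1.1 e)
      · exact t g
    · refine Or.inr ?_
      rintro (_ | g)
      · exact h1.2 (t _)
      · exact t g

section double

variable {X} {h : X.H} (hin : X.IsInner h) (hfix : X.next (X.rev h) = X.rev h)

theorem double_isInner : (X.double h hin hfix).IsInner (Sum.inr true) := by
  obtain ⟨v, w, hv, hw, nv, nw⟩ := id hin
  exact ⟨w, v, hw, hv, nw, nv⟩

theorem double_not_isLoop : ¬ (X.double h hin hfix).IsLoop (Sum.inr true) :=
  fun e => not_isLoop_of_fixed hfix (Eq.symm e)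

theorem double_faces_injective : Function.Injective fun f : X.F =>
    (Quot.mk _ (some f) : (X.double h hin hfix).Merged (Sum.inr true)) := by
  intro f g e
  -- The default value sends the face between the copies to the surrounding face, with which the
  -- deletion unites it.
  refine congrArg (Quot.lift (fun t : Option X.F => t.getD (X.face h)) ?_) e
  rintro _ _ ⟨rfl, rfl⟩
  rfl

/-- Deleting the second copy of the edge gives the original drawing. -/
def doubleCoarsening : Coarsening
    ((X.double h hin hfix).delete (Sum.inr true) (double_isInner hin hfix)) X where
  gone := ∅
  onH x := ⟨Sum.inl x, by nofun, by nofun⟩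
  onV := id
  onF := Equiv.ofBijective (fun f => Quot.mk _ (some f))
    ⟨double_faces_injective hin hfix, by
      intro q
      induction q using Quot.ind with
      | mk f =>
        rcases f with _ | f
        · exact ⟨X.face h, ((X.double h hin hfix).merged_eq (Sum.inr true)).symm⟩
        · exact ⟨f, rfl⟩⟩
  gone_smooth _ t := t.elim
  gone_apart _ _ t := t.elim
  injH _ _ e := Sum.inl_injective (congrArg Subtype.val e)
  rangeH := by
    rintro ⟨x | (_ | _), h1, h2⟩
    · exact iff_of_true ⟨x, rfl⟩ fun _ t => t.elim
    · exact absurd rfl h2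
    · exact absurd rfl h1
  injV := Function.injective_id
  rangeV u := iff_of_true ⟨u, rfl⟩ fun t => t
  src_eq y := by
    change X.src y = Sum.map id id (X.src y)
    rw [Sum.map_id_id]; rfl
  next_eq y := by
    apply Subtype.ext
    change skipTwo (X.doubleNext h) (Sum.inr true) (Sum.inr false) (X.doubleNext h (Sum.inl y)) =
      Sum.inl (X.next y)
    by_cases e : y = h
    · rw [e, doubleNext_left, skipTwo, if_neg (by simp)]
      exact if_pos ⟨by nofun, by nofun⟩
    · by_cases e' : y = X.rev h
      · rw [e', doubleNext_right, skipTwo, if_neg (by simp)]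
        exact if_pos ⟨by nofun, by nofun⟩
      · rw [X.doubleNext_of_ne e e', skipTwo, if_pos (by simp)]
  rev_eq y _ := rfl
  rev_gone _ _ t := t.elim
  face_eq y := by
    change Quot.mk _ (X.doubleFace h (Sum.inl y)) = Quot.mk _ (some (X.face y))
    by_cases e : y = h
    · rw [e, doubleFace_self]
      exact (X.double h hin hfix).merged_eq (Sum.inr true)
    · rw [X.doubleFace_of_ne e]
  mark_eq m := rfl
  gapT_eq j := rfl
  gapB_eq j := rfl
  inc_eq u f := by
    constructor
    · rintro ⟨_ | g, hg, e⟩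
      · have : f = X.face h := double_faces_injective hin hfix
          (e.symm.trans ((X.double h hin hfix).merged_eq (Sum.inr true)))
        rw [this]
        rcases hg with e | e
        · exact (X.inc_iff h u e _).2 ⟨h, e, rfl⟩
        · exact (X.inc_iff _ u e _).2 ⟨_, e, (X.face_of_fixed hin hfix).symm⟩
      · have : g = f := double_faces_injective hin hfix e
        exact this ▸ hg
    · exact fun t => ⟨some f, t, rfl⟩
  smooth_eq u := Iff.rfl

end double
end Drawing
end

noncomputable section

namespace Drawing

variable {n : ℕ} {X : Drawing n}

/-! ### Vanishing of drawings with pendant edges -/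

open Classical in
/-- The half-edge which stands for `x` when the first edge `h` at a 2-valent vertex is kept as part of
a merged edge. -/
def mergeHalf (h : X.H) (x : Cut h (X.rev h)) : X.H := if x.1 = X.next h then X.rev h else x.1

theorem mergeHalf_next {h : X.H} {x : Cut h (X.rev h)} (e : x.1 = X.next h) :
    mergeHalf h x = X.rev h := if_pos e

theorem mergeHalf_of_ne {h : X.H} {x : Cut h (X.rev h)} (e : x.1 ≠ X.next h) :
    mergeHalf h x = x.1 := if_neg e

open Classical in
/-- The vertex which stands for a vertex of the contracted drawing if `u` is forgotten. -/
def mergeVertex {h : X.H} {u w : X.V} (hu : X.src h = Sum.inl u)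
    (hw : X.src (X.rev h) = Sum.inl w) : X.Glued h → X.V :=
  Quot.lift (fun v => if v = u then w else v) fun a b hab => by
    have ea : u = a := Sum.inl_injective (hu.symm.trans hab.1)
    have eb : w = b := Sum.inl_injective (hw.symm.trans hab.2)
    subst ea; subst eb
    simp

theorem mergeVertex_self {h : X.H} {u w : X.V} (hu : X.src h = Sum.inl u)
    (hw : X.src (X.rev h) = Sum.inl w) : mergeVertex hu hw (Quot.mk _ u) = w := if_pos rfl

theorem mergeVertex_of_ne {h : X.H} {u w v : X.V} (hu : X.src h = Sum.inl u)
    (hw : X.src (X.rev h) = Sum.inl w) (e : v ≠ u) : mergeVertex hu hw (Quot.mk _ v) = v := if_neg e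

/-- Forgetting a 2-valent vertex is the same as contracting one of its edges. -/
def smoothenCoarsening {h : X.H} {u w : X.V} (hu : X.src h = Sum.inl u)
    (hw : X.src (X.rev h) = Sum.inl w) (htwo : {x | X.src x = Sum.inl u}.ncard = 2)
    (hin : X.IsInner h) (hl : ¬ X.IsLoop h) :
    Coarsening (X.smoothen u htwo) (X.contract h hin hl) :=
  have huw : u ≠ w := fun e => hl (by rw [IsLoop, hu, hw, e])
  have hk : X.next h ≠ h := (X.fiber_eq_pair htwo hu).1
  have sk : X.src (X.next h) = Sum.inl u := (X.src_next h).trans hu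
  have hpair : ∀ x, X.src x = Sum.inl u → x = h ∨ x = X.next h := fun x hx => by
    have : x ∈ {x | X.src x = Sum.inl u} := hx
    rw [(X.fiber_eq_pair htwo hu).2] at this
    exact this
  -- At the 2-valent vertex `u` the rotation exchanges `h` and `X.next h`.
  have hkk : X.next (X.next h) = h := by
    rcases hpair _ ((X.src_next _).trans sk) with e | e
    · exact e
    · exact absurd (X.next_inj e) hk
  have hkr : X.next h ≠ X.rev h := fun e => huw (Sum.inl_injective (sk.symm.trans (e ▸ hw)))
  have skr : X.src (X.rev (X.next h)) ≠ Sum.inl u := fun e => by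
    rcases hpair _ e with e | e
    · exact hkr (by rw [← X.rev_rev (X.next h), e])
    · exact X.rev_ne _ e
  have ne_of_src : ∀ x, X.src x ≠ Sum.inl u → x ≠ X.next h := fun x hx e => hx (e ▸ sk)
  { gone := {u}
    -- In the contracted drawing `X.next h` starts at the glued vertex. In the smoothened drawing
    -- the merged edge leaves `w` along `X.rev h`, so this half-edge takes its place.
    onH := mergeHalf h
    onV := mergeVertex hu hw
    onF := Equiv.refl _
    gone_smooth := fun v hv => Or.inr hv
    gone_apart := by
      intro x v hv v' hv' hx
      rw [Set.mem_singleton_iff.1 hv] at hx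
      rw [Set.mem_singleton_iff.1 hv']
      rcases hpair x hx with e | e
      · rw [e]
        exact fun e => huw (Sum.inl_injective (Eq.trans (Eq.symm e) hw))
      · rw [e]; exact skr
    injH := by
      intro x y e
      apply Subtype.ext
      by_cases hx : x.1 = X.next h <;> by_cases hy : y.1 = X.next h
      · exact hx.trans hy.symm
      · rw [mergeHalf_next hx, mergeHalf_of_ne hy] at e
        exact absurd e.symm y.2.2
      · rw [mergeHalf_of_ne hx, mergeHalf_next hy] at e
        exact absurd e x.2.2
      · rwa [mergeHalf_of_ne hx, mergeHalf_of_ne hy] at e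
    rangeH := by
      intro x
      constructor
      · rintro ⟨y, rfl⟩ v hv e
        rw [Set.mem_singleton_iff.1 hv] at e
        change X.src _ = _ at e
        by_cases hy : y.1 = X.next h
        · rw [mergeHalf_next hy] at e
          exact huw (Sum.inl_injective (e.symm.trans hw))
        · rw [mergeHalf_of_ne hy] at e
          exact (hpair _ e).elim y.2.1 hy
      · intro hx
        have hx' : X.src x ≠ Sum.inl u := hx u rfl
        by_cases e : x = X.rev h
        · exact ⟨⟨X.next h, hk, hkr⟩, (mergeHalf_next rfl).trans e.symm⟩
        · exact ⟨⟨x, fun t => hx' (t ▸ hu), e⟩, mergeHalf_of_ne (ne_of_src x hx')⟩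
    injV := by
      intro p q e
      induction p using Quot.ind with
      | mk a =>
      induction q using Quot.ind with
      | mk b =>
      refine (X.glued_eq hu hw a b).2 ?_
      by_cases ha : a = u <;> by_cases hb : b = u
      · exact Or.inl (ha.trans hb.symm)
      · rw [ha, mergeVertex_self, mergeVertex_of_ne hu hw hb] at e
        exact Or.inr (Or.inl ⟨ha, e.symm⟩)
      · rw [hb, mergeVertex_self, mergeVertex_of_ne hu hw ha] at e
        exact Or.inr (Or.inr ⟨e, hb⟩)
      · rw [mergeVertex_of_ne hu hw ha, mergeVertex_of_ne hu hw hb] at e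
        exact Or.inl e
    rangeV := by
      intro v
      constructor
      · rintro ⟨q, rfl⟩ (e : mergeVertex hu hw q = u)
        induction q using Quot.ind with
        | mk a =>
        by_cases ha : a = u
        · rw [ha, mergeVertex_self] at e
          exact huw e.symm
        · rw [mergeVertex_of_ne hu hw ha] at e
          exact ha e
      · intro hv
        exact ⟨Quot.mk _ v, mergeVertex_of_ne hu hw hv⟩
    src_eq := by
      intro y
      change X.src (mergeHalf h y) = Sum.map (mergeVertex hu hw) id (X.gluedSrc h y.1)
      by_cases hy : y.1 = X.next h
      · rw [mergeHalf_next hy, hy, X.gluedSrc_of sk, Sum.map_inl, mergeVertex_self, hw]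
      · rw [mergeHalf_of_ne hy]
        rcases e : X.src y.1 with a | m
        · have : a ≠ u := by
            rintro rfl
            exact (hpair _ e).elim y.2.1 hy
          rw [X.gluedSrc_of e, Sum.map_inl, mergeVertex_of_ne hu hw this]
        · unfold gluedSrc
          rw [e]; rfl
    next_eq := by
      intro y
      change X.next (mergeHalf h y) = mergeHalf h
        ⟨skipTwo (X.turn h) h (X.rev h) (X.turn h y.1), _⟩
      have hval : ∀ (z : Cut h (X.rev h)) (t : X.H), z.1 = t → t ≠ X.next h →
          mergeHalf h z = t := by
        rintro z _ rfl e
        exact mergeHalf_of_ne e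
      have hty : X.turn h y.1 = X.next y.1 := X.turn_of_ne y.2.1 y.2.2
      by_cases hy : y.1 = X.next h
      · rw [mergeHalf_next hy]
        have ht : X.turn h y.1 = h := by rw [hty, hy, hkk]
        have hn : X.next (X.rev h) ≠ h := fun e => hl (by
          rw [IsLoop, ← X.src_next (X.rev h), e])
        have hn' : X.next (X.rev h) ≠ X.next h := fun e => X.rev_ne h (X.next_inj e)
        by_cases hf : X.next (X.rev h) = X.rev h
        · rw [hf, mergeHalf_next]
          change skipTwo _ _ _ _ = _
          rw [ht, skipTwo, if_neg (by simp), X.turn_left, hf, if_neg (by simp), X.turn_right]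
        · refine (hval _ _ ?_ hn').symm
          change skipTwo _ _ _ _ = _
          rw [ht, skipTwo, if_neg (by simp), X.turn_left, if_pos ⟨hn, hf⟩]
      · rw [mergeHalf_of_ne hy]
        have sy : X.src y.1 ≠ Sum.inl u := fun e => (hpair _ e).elim y.2.1 hy
        have sy' : X.src (X.next y.1) ≠ Sum.inl u := by rwa [X.src_next]
        by_cases hr : X.next y.1 = X.rev h
        · rw [mergeHalf_next]
          · exact hr
          · change skipTwo _ _ _ _ = _
            rw [hty, hr, skipTwo, if_neg (by simp), X.turn_right, if_pos ⟨hk, hkr⟩]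
        · refine (hval _ _ ?_ (ne_of_src _ sy')).symm
          change skipTwo _ _ _ _ = _
          rw [hty, skipTwo, if_pos ⟨fun e => sy' (by rw [e, hu]), hr⟩]
    rev_eq := by
      intro y hy
      have hy' : X.src (X.rev (mergeHalf h y)) ≠ Sum.inl u := hy u rfl
      change mergeHalf h ⟨X.rev y.1, _⟩ = X.rev (mergeHalf h y)
      by_cases e : y.1 = X.next h
      · rw [mergeHalf_next e, X.rev_rev] at hy'
        exact absurd hu hy'
      · rw [mergeHalf_of_ne e] at hy' ⊢
        exact mergeHalf_of_ne (ne_of_src _ hy')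
    rev_gone := by
      intro y v hv hy
      rw [Set.mem_singleton_iff.1 hv] at hy
      change X.src (X.rev (mergeHalf h y)) = Sum.inl u at hy
      change mergeHalf h ⟨X.rev y.1, _⟩ = X.rev (X.next (X.rev (mergeHalf h y)))
      by_cases e : y.1 = X.next h
      · rw [mergeHalf_next e, X.rev_rev, mergeHalf_of_ne]
        · exact congrArg X.rev e
        · change X.rev y.1 ≠ X.next h
          rw [e]; exact ne_of_src _ skr
      · rw [mergeHalf_of_ne e] at hy ⊢
        rcases hpair _ hy with t | t
        · exact absurd t (X.rev_cut y.2).1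
        · rw [mergeHalf_next t, t, hkk]
    face_eq := by
      intro y
      change X.face (mergeHalf h y) = X.face y.1
      by_cases e : y.1 = X.next h
      · have := X.corner _ _ sk
        rw [hkk] at this
        rw [mergeHalf_next e, e, this]
      · rw [mergeHalf_of_ne e]
    mark_eq := by
      intro m
      refine (mergeHalf_of_ne (x := (X.contract h hin hl).mark m)
        (ne_of_src (X.mark m) ?_)).symm
      rw [(X.src_mark _ m).2 rfl]
      nofun
    gapT_eq := fun j => rfl
    gapB_eq := fun j => rfl
    inc_eq := by
      intro q f
      change X.inc (mergeVertex hu hw q) f ↔ ∃ v, Quot.mk _ v = q ∧ X.inc v f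
      -- Both corners at `u` lie along the edge of `h`, so the faces at `u` are the two sides of
      -- this edge and also occur at `w`.
      have up : X.inc u f → X.inc w f := by
        intro hf
        obtain ⟨y, hy, rfl⟩ := (X.inc_iff h u hu f).1 hf
        rw [X.inc_iff _ w hw]
        rcases hpair y hy with rfl | rfl
        · obtain ⟨p, hp⟩ := X.next_surj (X.rev y)
          have sp : X.src p = Sum.inl w := by rw [← hw, ← hp, X.src_next]
          refine ⟨p, sp, ?_⟩
          rw [← X.corner p w sp, hp, X.rev_rev]
        · refine ⟨_, hw, ?_⟩
          have := X.corner _ _ sk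
          rwa [hkk] at this
      induction q using Quot.ind with
      | mk a =>
      by_cases ha : a = u
      · rw [ha, mergeVertex_self]
        refine ⟨fun t => ⟨w, (Quot.sound ⟨hu, hw⟩ : (Quot.mk _ u : X.Glued h) = _).symm, t⟩, ?_⟩
        rintro ⟨v, hv, t⟩
        rcases (X.glued_eq hu hw _ _).1 hv with e | ⟨-, e⟩ | ⟨e, -⟩
        · exact up (e ▸ t)
        · exact absurd e huw
        · exact e ▸ t
      · rw [mergeVertex_of_ne hu hw ha]
        refine ⟨fun t => ⟨a, rfl, t⟩, ?_⟩
        rintro ⟨v, hv, t⟩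
        rcases (X.glued_eq hu hw _ _).1 hv with e | ⟨e, e'⟩ | ⟨-, e⟩
        · exact e ▸ t
        · rw [e']; exact up (e ▸ t)
        · exact absurd e ha
    smooth_eq := by
      intro q
      change (X.smooth (mergeVertex hu hw q) ∨ mergeVertex hu hw q = u) ↔
        ∃ v, Quot.mk _ v = q ∧ X.smooth v
      obtain ⟨u', w', hu', hw', nu, nw⟩ := id hin
      obtain rfl : u' = u := Sum.inl_injective (hu'.symm.trans hu)
      obtain rfl : w' = w := Sum.inl_injective (hw'.symm.trans hw)
      induction q using Quot.ind with
      | mk a =>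
      by_cases ha : a = u'
      · rw [ha, mergeVertex_self]
        refine iff_of_false (fun t => t.elim nw fun e => huw e.symm) ?_
        rintro ⟨v, hv, t⟩
        rcases (X.glued_eq hu hw _ _).1 hv with e | ⟨-, e⟩ | ⟨e, -⟩
        · exact nu (e ▸ t)
        · exact huw e
        · exact nw (e ▸ t)
      · rw [mergeVertex_of_ne hu hw ha]
        refine ⟨fun t => ⟨a, rfl, t.resolve_right ha⟩, ?_⟩
        rintro ⟨v, hv, t⟩
        rcases (X.glued_eq hu hw _ _).1 hv with e | ⟨e, -⟩ | ⟨-, e⟩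
        · exact Or.inl (e ▸ t)
        · exact absurd (e ▸ t) nu
        · exact absurd e ha }

/-- Removing the 2-valent vertex gives the same diagram as contracting the edge, so `G = G/e`;
contraction-deletion leaves nothing but `G\e = 0`. -/
theorem cls_delete_two_valent {h : X.H} {u : X.V} (hu : X.src h = Sum.inl u)
    (htwo : {x | X.src x = Sum.inl u}.ncard = 2) (hin : X.IsInner h) (hl : ¬ X.IsLoop h) :
    cls (X.delete h hin) = 0 := by
  obtain ⟨-, w, -, hw, -⟩ := id hin
  have h1 := cls_contraction_deletion X hin hl
  rw [cls_smoothen X u htwo, (smoothenCoarsening hu hw htwo hin hl).cls_eq] at h1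
  exact sub_eq_self.1 h1.symm

/-- A drawing with a pendant inner edge is zero in the chromatic algebra. -/
theorem cls_eq_zero_of_pendant {h : X.H} (hin : X.IsInner h)
    (hfix : X.next (X.rev h) = X.rev h) : cls X = 0 := by
  -- The drawing is the deletion of one of two parallel edges; in the doubled drawing the end `w`
  -- has become 2-valent.
  rw [← (doubleCoarsening hin hfix).cls_eq]
  obtain ⟨v, w, hv, hw, -⟩ := id hin
  refine cls_delete_two_valent (X := X.double h hin hfix) (h := Sum.inr true) (u := w) hw ?_ _ (double_not_isLoop hin hfix)
  have : {z | X.addSrc (X.src h) (X.src (X.rev h)) z = Sum.inl w} =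
      {Sum.inl (X.rev h), Sum.inr true} := by
    ext (x | (_ | _))
    · constructor
      · intro e
        exact Or.inl (congrArg Sum.inl (X.eq_of_fixed hfix (Eq.trans e hw.symm)))
      · rintro (e | e)
        · rw [Sum.inl_injective e]; exact hw
        · cases e
    · refine iff_of_false ?_ (by simp)
      rintro (e : X.src h = _)
      exact not_isLoop_of_fixed hfix (e.trans hw.symm)
    · exact iff_of_true hw (Or.inr rfl)
  exact (congrArg Set.ncard this).trans (Set.ncard_pair (by nofun))

/-- An isolated vertex may be merged with a vertex of a face in which it lies. -/
theorem cls_eq_contract_attach {h : X.H} {v w : X.V} (hv : ∀ x, X.src x ≠ Sum.inl v)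
    (hw : X.src h = Sum.inl w) (hns : ¬ X.smooth w) (hf : X.inc v (X.face h))
    (hsv : ¬ X.smooth v) :
    cls X = cls ((X.attach h v w hv hw hns hf).contract (Sum.inr false)
      (attach_isInner hv hw hns hf hsv) (attach_not_isLoop hv hw hns hf)) := by
  -- The attached drawing vanishes because its new edge is pendant, and deleting that edge gives
  -- back `X`; so `X` equals the contraction.
  have h1 := cls_contraction_deletion _ (attach_isInner hv hw hns hf hsv)
    (attach_not_isLoop hv hw hns hf)
  rw [(attachCoarsening hv hw hns hf hsv).cls_eq,
    cls_eq_zero_of_pendant (attach_isInner hv hw hns hf hsv) rfl] at h1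
  exact (sub_eq_zero.1 h1.symm).symm

end Drawing
end

noncomputable section

namespace Drawing

variable {n : ℕ} {X : Drawing n}

/-! ### Drawings in which every edge joins a marked point and a vertex -/

/-- All points are vertices and every edge joins a marked point and a vertex. -/
structure IsStarlike (X : Drawing n) : Prop where
  not_smooth : ∀ v, ¬ X.smooth v
  inner_iff : ∀ x, (∃ v, X.src x = Sum.inl v) ↔ ∃ m, X.src (X.rev x) = Sum.inr m

/-- The faces along the frame of the rectangle, read clockwise from the upper left corner. -/
def gap (X : Drawing n) (a : ℕ) : X.F :=
  if h : a ≤ n then X.gapT ⟨a, by omega⟩ else X.gapB ⟨2 * n - a, by omega⟩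

theorem gapT_eq_gap (j : Fin (n + 1)) : X.gapT j = X.gap j := by
  rw [gap, dif_pos (Nat.lt_succ_iff.1 j.2)]

theorem gapB_eq_gap (j : Fin (n + 1)) : X.gapB j = X.gap (2 * n - j) := by
  unfold gap
  split_ifs with h
  · have e : j = Fin.last n := Fin.ext (by rw [Fin.val_last]; omega)
    refine (congrArg X.gapB e).trans (X.gap_right.symm.trans ?_)
    exact congrArg X.gapT (Fin.ext (by rw [Fin.val_last]; change n = 2 * n - j.1; omega))
  · exact congrArg X.gapB (Fin.ext (by simp; omega))

theorem face_mark (m : Mark n) : X.face (X.mark m) = X.gap (pos m + 1) := by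
  rcases m with i | i
  · rw [X.face_top, gapT_eq_gap]; rfl
  · rw [X.face_bot, gapB_eq_gap, pos_bot]
    congr 1
    simp
    omega

theorem face_rev_mark (m : Mark n) : X.face (X.rev (X.mark m)) = X.gap (pos m) := by
  rcases m with i | i
  · rw [X.face_rev_top, gapT_eq_gap]; rfl
  · rw [X.face_rev_bot, gapB_eq_gap, pos_bot]
    congr 1
    simp
    omega

/-- The half-edge at the marked point with number `p`. -/
def out (X : Drawing n) (p : Fin (2 * n)) : X.H := X.mark (markEquiv n p)

theorem out_injective : Function.Injective X.out := by
  intro p q e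
  have h1 := (X.src_mark (X.out p) (markEquiv n p)).2 rfl
  have h2 := (X.src_mark (X.out q) (markEquiv n q)).2 rfl
  rw [e, h2] at h1
  exact ((markEquiv n).injective (Sum.inr_injective h1)).symm

theorem src_out (p : Fin (2 * n)) : X.src (X.out p) = Sum.inr (markEquiv n p) :=
  (X.src_mark _ _).2 rfl

theorem rev_injective : Function.Injective X.rev := fun x y e => by
  rw [← X.rev_rev x, e, X.rev_rev]

theorem face_out (p : Fin (2 * n)) : X.face (X.out p) = X.gap (p + 1) := by
  rw [out, face_mark, pos_markEquiv]

theorem face_rev_out (p : Fin (2 * n)) : X.face (X.rev (X.out p)) = X.gap p := by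
  rw [out, face_rev_mark, pos_markEquiv]

/-- The marked points with the numbers `i` and `j` are joined to the same vertex. -/
def blockRel (X : Drawing n) (i j : ℕ) : Prop :=
  ∃ (hi : i < 2 * n) (hj : j < 2 * n),
    X.src (X.rev (X.out ⟨i, hi⟩)) = X.src (X.rev (X.out ⟨j, hj⟩))

theorem blockRel_iff (i j : Fin (2 * n)) :
    X.blockRel i j ↔ X.src (X.rev (X.out i)) = X.src (X.rev (X.out j)) :=
  ⟨fun ⟨_, _, e⟩ => e, fun e => ⟨i.2, j.2, e⟩⟩

/-- A predicate which changes exactly between `i` and `i + 1` and between `j` and `j + 1` differs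
from its initial value just in between. It is used for the side of the gaps with respect to a path
through two legs. -/
theorem not_iff_zero_iff {P : ℕ → Prop} {i j N : ℕ} (hij : i < j)
    (h : ∀ a < N, (a = i ∨ a = j) ↔ ¬ (P (a + 1) ↔ P a)) :
    ∀ a ≤ N, ¬ (P a ↔ P 0) ↔ i < a ∧ a ≤ j := by
  intro a
  induction a with
  | zero => simp
  | succ a ih =>
    intro ha
    have h1 := h a ha
    have h2 := ih (by omega)
    by_cases p1 : P (a + 1) <;> by_cases p2 : P a <;> by_cases p3 : P 0 <;>
      simp only [p1, p2, p3, not_true, not_false_iff, iff_true, true_iff, iff_false,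
        false_iff] at h1 h2 ⊢ <;> omega

namespace IsStarlike

theorem exists_src (hX : X.IsStarlike) (p : Fin (2 * n)) :
    ∃ v, X.src (X.rev (X.out p)) = Sum.inl v :=
  (hX.inner_iff _).2 ⟨markEquiv n p, by rw [X.rev_rev, src_out]⟩

/-- The vertex joined to the marked point with number `p`. -/
def block (hX : X.IsStarlike) (p : Fin (2 * n)) : X.V := (hX.exists_src p).choose

theorem src_rev_out (hX : X.IsStarlike) (p : Fin (2 * n)) :
    X.src (X.rev (X.out p)) = Sum.inl (hX.block p) := (hX.exists_src p).choose_spec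

theorem blockRel_iff_block (hX : X.IsStarlike) (i j : Fin (2 * n)) :
    X.blockRel i j ↔ hX.block i = hX.block j := by
  rw [blockRel_iff, hX.src_rev_out, hX.src_rev_out, Sum.inl.injEq]

theorem exists_out_of_src (hX : X.IsStarlike) {x : X.H} {v : X.V} (hx : X.src x = Sum.inl v) :
    ∃ p, x = X.rev (X.out p) := by
  obtain ⟨m, hm⟩ := (hX.inner_iff x).1 ⟨v, hx⟩
  refine ⟨(markEquiv n).symm m, ?_⟩
  rw [out, Equiv.apply_symm_apply, ← (X.src_mark _ m).1 hm, X.rev_rev]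

theorem exists_out (hX : X.IsStarlike) (x : X.H) : ∃ p, x = X.out p ∨ x = X.rev (X.out p) := by
  rcases hx : X.src x with v | m
  · obtain ⟨p, hp⟩ := hX.exists_out_of_src hx
    exact ⟨p, Or.inr hp⟩
  · exact ⟨(markEquiv n).symm m, Or.inl (by
      rw [out, Equiv.apply_symm_apply]; exact (X.src_mark _ m).1 hx)⟩

/-- Every edge is a leg and has faces of the frame on both sides. So these faces form a nonempty set
which is closed under crossing edges, and dual connectedness makes it everything. -/
theorem exists_gap (hX : X.IsStarlike) (f : X.F) : ∃ a : Fin (2 * n + 1), f = X.gap a := by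
  have key : ∀ x, ∃ a : Fin (2 * n + 1), X.face x = X.gap a := by
    intro x
    obtain ⟨p, rfl | rfl⟩ := hX.exists_out x
    · exact ⟨p.succ, by rw [face_out]; simp⟩
    · exact ⟨p.castSucc, by rw [face_rev_out]; simp⟩
  rcases X.dual_connected {f | ∃ a : Fin (2 * n + 1), f = X.gap a}
    (fun x => iff_of_true (key x) (key _)) with h | h
  · exact absurd (show X.gap 0 ∈ {f | ∃ a : Fin (2 * n + 1), f = X.gap a} from ⟨0, rfl⟩)
      (by rw [h]; exact fun t => t)
  · have : f ∈ (Set.univ : Set X.F) := trivial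
    rwa [← h] at this

/-- Two marked points joined to the same vertex separate the frame of the rectangle. -/
theorem exists_separation (hX : X.IsStarlike) {i j : Fin (2 * n)} (hij : i < j)
    (h : hX.block i = hX.block j) :
    ∃ U : Set X.F, (∀ a ≤ 2 * n, X.gap a ∈ U ↔ i.1 < a ∧ a ≤ j) ∧
      ∀ p, p ≠ i → p ≠ j → (X.face (X.rev (X.out p)) ∈ U ↔ X.face (X.out p) ∈ U) := by
  have hne : i ≠ j := hij.ne
  -- The two legs form a path from frame to frame, which meets the common vertex twice and no other
  -- vertex.
  let c : Set X.H := {x | ∃ p, (p = i ∨ p = j) ∧ (x = X.out p ∨ x = X.rev (X.out p))}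
  have hcm : ∀ p, X.out p ∈ c ↔ p = i ∨ p = j := by
    intro p
    constructor
    · rintro ⟨q, hq, e | e⟩
      · rwa [out_injective e]
      · have := src_out (X := X) p
        rw [e, hX.src_rev_out] at this
        cases this
    · exact fun hp => ⟨p, hp, Or.inl rfl⟩
  have hcr : ∀ x, X.rev x ∈ c ↔ x ∈ c := by
    intro x
    constructor
    · rintro ⟨p, hp, e | e⟩
      · exact ⟨p, hp, Or.inr (by rw [← e, X.rev_rev])⟩
      · exact ⟨p, hp, Or.inl (rev_injective e)⟩
    · rintro ⟨p, hp, e | e⟩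
      · exact ⟨p, hp, Or.inr (by rw [← e])⟩
      · exact ⟨p, hp, Or.inl (by rw [e, X.rev_rev])⟩
  have hev : ∀ v, Even {x | x ∈ c ∧ X.src x = Sum.inl v}.ncard := by
    intro v
    by_cases hv : v = hX.block i
    · have : {x | x ∈ c ∧ X.src x = Sum.inl v} = {X.rev (X.out i), X.rev (X.out j)} := by
        ext x
        constructor
        · rintro ⟨⟨p, hp, e | e⟩, hx⟩
          · rw [e, src_out] at hx; cases hx
          · rcases hp with rfl | rfl
            · exact Or.inl e
            · exact Or.inr e
        · rintro (rfl | rfl)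
          · exact ⟨⟨i, Or.inl rfl, Or.inr rfl⟩, by rw [hX.src_rev_out, hv]⟩
          · exact ⟨⟨j, Or.inr rfl, Or.inr rfl⟩, by rw [hX.src_rev_out, hv, h]⟩
      rw [this, Set.ncard_pair fun e => hne (out_injective (rev_injective e))]
      decide
    · have : {x | x ∈ c ∧ X.src x = Sum.inl v} = ∅ := by
        refine Set.eq_empty_of_forall_notMem ?_
        rintro x ⟨⟨p, hp, e | e⟩, hx⟩
        · rw [e, src_out] at hx; cases hx
        · rw [e, hX.src_rev_out] at hx
          rcases hp with rfl | rfl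
          · exact hv (Sum.inl_injective hx).symm
          · exact hv ((Sum.inl_injective hx).symm.trans h.symm)
      rw [this, Set.ncard_empty]
      decide
  obtain ⟨U, hU⟩ := X.jordan c hcr hev
  have hstep : ∀ p : Fin (2 * n), (p = i ∨ p = j) ↔ ¬ (X.gap (p + 1) ∈ U ↔ X.gap p ∈ U) := by
    intro p
    rw [← hcm, hU, face_out, face_rev_out]
  -- The Jordan property gives the set only up to complement; this choice puts the face at gap `0`
  -- outside.
  refine ⟨{f | ¬ (f ∈ U ↔ X.gap 0 ∈ U)}, ?_, ?_⟩
  · exact not_iff_zero_iff (P := fun a => X.gap a ∈ U) hij fun a ha => by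
      have := hstep ⟨a, ha⟩
      rwa [Fin.ext_iff, Fin.ext_iff] at this
  · intro p h1 h2
    have : ¬ X.out p ∈ c := fun t => ((hcm p).1 t).elim h1 h2
    rw [hU] at this
    change ¬ (X.face (X.rev (X.out p)) ∈ U ↔ _) ↔ ¬ (X.face (X.out p) ∈ U ↔ _)
    tauto

/-- The equality of the two gaps is the corner condition between consecutive legs at a vertex. -/
theorem next_rev_out (hX : X.IsStarlike) (p : Fin (2 * n)) :
    ∃ q, X.next (X.rev (X.out p)) = X.rev (X.out q) ∧ hX.block p = hX.block q ∧
      X.gap (q + 1) = X.gap p := by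
  have hs : X.src (X.next (X.rev (X.out p))) = Sum.inl (hX.block p) :=
    (X.src_next _).trans (hX.src_rev_out p)
  obtain ⟨q, hq⟩ := hX.exists_out_of_src hs
  refine ⟨q, hq, ?_, ?_⟩
  · rw [hq, hX.src_rev_out] at hs
    exact (Sum.inl_injective hs).symm
  · have := X.corner _ _ (hX.src_rev_out p)
    rwa [hq, X.rev_rev, face_out, face_rev_out] at this

/-- For the noncrossing property, the legs at `a` and `c` separate the gaps at `b` and `d`. If `b`
belonged to another vertex, turning around that vertex would never cross these two legs, so its legs
at `b` and `d` would lie on the same side. A partner is given by the next leg at the vertex, which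
is different because no vertex is univalent. -/
theorem ncRel (hX : X.IsStarlike) (hpend : ∀ x v, X.src x = Sum.inl v → X.next x ≠ x) :
    NCRel (2 * n) X.blockRel where
  lt := fun ⟨hi, _, _⟩ => hi
  refl := fun hi => ⟨hi, hi, rfl⟩
  symm := fun ⟨hi, hj, e⟩ => ⟨hj, hi, e.symm⟩
  trans := fun ⟨hi, _, e⟩ ⟨_, hk, e'⟩ => ⟨hi, hk, e.trans e'⟩
  nc := by
    rintro a b c d hab hbc hcd ⟨ha, hc, hac⟩ ⟨hb, hd, hbd⟩
    by_contra hno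
    have hac' := (hX.blockRel_iff_block ⟨a, ha⟩ ⟨c, hc⟩).1 ⟨ha, hc, hac⟩
    obtain ⟨U, hU, hU'⟩ := hX.exists_separation (i := ⟨a, ha⟩) (j := ⟨c, hc⟩)
      (by rw [Fin.lt_def]; simp; omega) hac'
    have hba : hX.block ⟨b, hb⟩ ≠ hX.block ⟨a, ha⟩ := fun e =>
      hno ((hX.blockRel_iff_block ⟨a, ha⟩ ⟨b, hb⟩).2 e.symm)
    have key := ((orbit_iff_closed X.next X.src).1 X.orbit).2
      {x | X.src x = Sum.inl (hX.block ⟨b, hb⟩) ∧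
        (X.face x ∈ U ↔ X.face (X.rev (X.out ⟨b, hb⟩)) ∈ U)} ?_
      (X.rev (X.out ⟨b, hb⟩)) (X.rev (X.out ⟨d, hd⟩)) ⟨hX.src_rev_out _, Iff.rfl⟩ hbd.symm
    · have h2 := key.2
      rw [face_rev_out, face_rev_out, hU _ (by simp; omega), hU _ (by simp; omega)] at h2
      simp only at h2
      omega
    · rintro x ⟨hx, hxU⟩
      obtain ⟨p, rfl⟩ := hX.exists_out_of_src hx
      obtain ⟨q, hq, hpq, hg⟩ := hX.next_rev_out p
      have hp : hX.block p = hX.block ⟨b, hb⟩ := by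
        rw [hX.src_rev_out] at hx; exact Sum.inl_injective hx
      have hqb := hpq.symm.trans hp
      refine ⟨by rw [X.src_next, hx], ?_⟩
      rw [hq, hU' q, face_out, hg, ← face_rev_out p, hxU]
      · rintro rfl
        exact hba hqb.symm
      · rintro rfl
        exact hba (hqb.symm.trans hac'.symm)
  partner := by
    intro a ha
    obtain ⟨q, hq, hpq, -⟩ := hX.next_rev_out ⟨a, ha⟩
    refine ⟨q, fun e => ?_, (hX.blockRel_iff_block ⟨a, ha⟩ q).2 hpq⟩
    have : q = ⟨a, ha⟩ := Fin.ext e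
    rw [this] at hq
    exact hpend _ _ (hX.src_rev_out _) hq

/-- A pair of equivalent points which separates two gaps also separates their faces, by
`exists_separation`. -/
theorem gapType_eq_of_gap_eq (hX : X.IsStarlike) {a b : ℕ} (ha : a ≤ 2 * n) (hb : b ≤ 2 * n)
    (e : X.gap a = X.gap b) : gapType X.blockRel a = gapType X.blockRel b := by
  have key : ∀ i j : ℕ, i < j → X.blockRel i j → ((i < a ↔ j < a) ↔ (i < b ↔ j < b)) := by
    rintro i j hij ⟨hi, hj, h⟩
    obtain ⟨U, hU, -⟩ := hX.exists_separation (i := ⟨i, hi⟩) (j := ⟨j, hj⟩) hij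
      ((hX.blockRel_iff_block ⟨i, hi⟩ ⟨j, hj⟩).1 ⟨hi, hj, h⟩)
    have h1 := hU a ha
    have h2 := hU b hb
    rw [e, h2] at h1
    simp only at h1
    omega
  funext i j
  refine propext (forall_congr' fun h => ?_)
  rcases lt_trichotomy i j with t | t | t
  · exact key i j t h
  · rw [t]
    simp
  · have := key j i t (by obtain ⟨hi, hj, h⟩ := h; exact ⟨hj, hi, h.symm⟩)
    omega

/-- Let `δ` be the indicator of the face at gap `a`. Its changes across the legs have sum zero on
each block, since going around the vertex every corner face is counted once as the left and once as
the right side of a leg. By `sum_range_eq` their partial sums, which telescope to the values of `δ`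
at the gaps, depend only on the gap type; so `δ` also equals `1` at gap `b`. -/
theorem gap_eq_of_gapType_eq (hX : X.IsStarlike) (hr : NCRel (2 * n) X.blockRel) {a b : ℕ}
    (ha : a ≤ 2 * n) (hb : b ≤ 2 * n) (e : gapType X.blockRel a = gapType X.blockRel b) :
    X.gap a = X.gap b := by
  classical
  have := Fintype.ofFinite X.H
  let δ : X.F → ZMod 2 := fun f => if f = X.gap a then 1 else 0
  have htel : ∀ k, ∑ i ∈ Finset.range k, (δ (X.gap (i + 1)) + δ (X.gap i)) =
      δ (X.gap k) + δ (X.gap 0) := by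
    intro k
    induction k with
    | zero => simp [CharTwo.add_self_eq_zero]
    | succ k ih =>
      rw [Finset.sum_range_succ, ih]
      have := CharTwo.add_self_eq_zero (δ (X.gap k))
      linear_combination this
  have hsum := hr.sum_range_eq (t := fun i => δ (X.gap (i + 1)) + δ (X.gap i)) ?_ ha hb e
  · rw [htel, htel] at hsum
    have h1 := add_right_cancel hsum
    by_contra hne
    simp only [δ, if_true, if_neg (Ne.symm hne)] at h1
    exact absurd h1 (by decide)
  · intro p hp
    have hbij : ∑ i ∈ (Finset.range (2 * n)).filter (X.blockRel p),
        (δ (X.gap (i + 1)) + δ (X.gap i)) =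
        ∑ x ∈ Finset.univ.filter fun x => X.src x = Sum.inl (hX.block ⟨p, hp⟩),
          (δ (X.face (X.rev x)) + δ (X.face x)) := by
      refine Finset.sum_bij (fun i hi => X.rev (X.out ⟨i, by simpa using (Finset.mem_filter.1 hi).1⟩))
        ?_ ?_ ?_ ?_
      · intro i hi
        rw [Finset.mem_filter] at hi ⊢
        refine ⟨Finset.mem_univ _, ?_⟩
        have h := hi.2.2.2
        exact h.symm.trans (hX.src_rev_out _)
      · intro i hi j hj h
        exact Fin.mk.inj_iff.1 (out_injective (rev_injective h))
      · intro x hx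
        rw [Finset.mem_filter] at hx
        obtain ⟨q, rfl⟩ := hX.exists_out_of_src hx.2
        refine ⟨q, ?_, rfl⟩
        rw [Finset.mem_filter, Finset.mem_range]
        refine ⟨q.2, hp, q.2, ?_⟩
        rw [hX.src_rev_out, hx.2]
      · intro i hi
        rw [X.rev_rev, face_out, face_rev_out]
    rw [hbij, Finset.sum_add_distrib]
    -- The rotation permutes the half-edges at the vertex and, by the corner condition, matches the
    -- left face of each with the right face of the next.
    have hshift : ∑ x ∈ Finset.univ.filter fun x => X.src x = Sum.inl (hX.block ⟨p, hp⟩),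
        δ (X.face x) = ∑ x ∈ Finset.univ.filter fun x => X.src x = Sum.inl (hX.block ⟨p, hp⟩),
          δ (X.face (X.rev x)) := by
      refine Finset.sum_bij (fun x _ => X.next x) ?_ ?_ ?_ ?_
      · intro x hx
        rw [Finset.mem_filter] at hx ⊢
        exact ⟨Finset.mem_univ _, by rw [X.src_next, hx.2]⟩
      · intro x _ y _ h
        exact X.next_inj h
      · intro y hy
        obtain ⟨x, rfl⟩ := X.next_surj y
        rw [Finset.mem_filter, X.src_next] at hy
        exact ⟨x, by rw [Finset.mem_filter]; exact ⟨Finset.mem_univ _, hy.2⟩, rfl⟩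
      · intro x hx
        rw [Finset.mem_filter] at hx
        rw [X.corner x _ hx.2]
    rw [hshift]
    exact CharTwo.add_self_eq_zero _

/-- A starlike drawing whose vertices have at least two edges is the standard drawing of its
noncrossing partition. -/
def starCoarsening (hX : X.IsStarlike) (hr : NCRel (2 * n) X.blockRel)
    (hiso : ∀ v, ∃ x, X.src x = Sum.inl v) : Coarsening X hr.star :=
  have hV : ∀ p q : Fin (2 * n), starBlock X.blockRel p = starBlock X.blockRel q ↔
      hX.block p = hX.block q := fun p q => (hr.starBlock_eq).trans (hX.blockRel_iff_block p q)
  have hF : ∀ a b : Fin (2 * n + 1), starGap X.blockRel a = starGap X.blockRel b ↔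
      X.gap a = X.gap b := fun a b => starGap_eq.trans
    ⟨hX.gap_eq_of_gapType_eq hr (by omega) (by omega), hX.gapType_eq_of_gap_eq (by omega) (by omega)⟩
  have hVs : ∀ v : StarV n X.blockRel, ∃ p, v = starBlock X.blockRel p :=
    fun v => v.2.imp fun _ h => Subtype.ext h.symm
  have hFs : ∀ f : StarF n X.blockRel, ∃ a, f = starGap X.blockRel a :=
    fun f => f.2.imp fun _ h => Subtype.ext h.symm
  let onV : StarV n X.blockRel → X.V := fun v => hX.block (hVs v).choose
  let onF : StarF n X.blockRel → X.F := fun f => X.gap (hFs f).choose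
  have onV_block : ∀ p, onV (starBlock X.blockRel p) = hX.block p := fun p =>
    ((hV _ _).1 (hVs (starBlock X.blockRel p)).choose_spec).symm
  have onF_gap : ∀ a, onF (starGap X.blockRel a) = X.gap a := fun a =>
    ((hF _ _).1 (hFs (starGap X.blockRel a)).choose_spec).symm
  have onV_inj : Function.Injective onV := by
    intro v w e
    obtain ⟨p, rfl⟩ := hVs v
    obtain ⟨q, rfl⟩ := hVs w
    rw [onV_block, onV_block] at e
    exact (hV p q).2 e
  have onF_bij : Function.Bijective onF := by
    constructor
    · intro f g e
      obtain ⟨a, rfl⟩ := hFs f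
      obtain ⟨b, rfl⟩ := hFs g
      rw [onF_gap, onF_gap] at e
      exact (hF a b).2 e
    · intro f
      obtain ⟨a, rfl⟩ := hX.exists_gap f
      exact ⟨starGap X.blockRel a, onF_gap a⟩
  let onH : Fin (2 * n) × Bool → X.H := fun h => if h.2 then X.rev (X.out h.1) else X.out h.1
  have onH_face : ∀ y, X.face (onH y) = onF (starFace X.blockRel y) := by
    rintro ⟨p, _ | _⟩
    · refine Eq.trans ?_ (onF_gap p.succ).symm
      exact (face_out p).trans (by simp)
    · refine Eq.trans ?_ (onF_gap p.castSucc).symm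
      exact (face_rev_out p).trans (by simp)
  have onH_src : ∀ y, X.src (onH y) = Sum.map onV id (starSrc X.blockRel y) := by
    rintro ⟨p, _ | _⟩
    · exact src_out p
    · refine (hX.src_rev_out p).trans ?_
      exact congrArg Sum.inl (onV_block p).symm
  have onH_surj : Function.Surjective onH := by
    intro x
    obtain ⟨p, rfl | rfl⟩ := hX.exists_out x
    · exact ⟨(p, false), rfl⟩
    · exact ⟨(p, true), rfl⟩
  { gone := ∅
    onH := onH
    onV := onV
    onF := Equiv.ofBijective onF onF_bij
    gone_smooth := fun _ t => t.elim
    gone_apart := fun _ _ t => t.elim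
    injH := by
      rintro ⟨p, _ | _⟩ ⟨q, _ | _⟩ e
      · rw [out_injective (X := X) (a₁ := p) (a₂ := q) e]
      · have h1 := src_out (X := X) p
        rw [show X.out p = X.rev (X.out q) from e, hX.src_rev_out] at h1
        cases h1
      · have h1 := src_out (X := X) q
        rw [← show X.rev (X.out p) = X.out q from e, hX.src_rev_out] at h1
        cases h1
      · rw [out_injective (rev_injective (X := X) (a₁ := X.out p) (a₂ := X.out q) e)]
    rangeH := fun x => iff_of_true (onH_surj x) fun _ t => t.elim
    injV := onV_inj
    rangeV := by
      intro v
      refine iff_of_true ?_ fun t => t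
      obtain ⟨x, hx⟩ := hiso v
      obtain ⟨p, rfl⟩ := hX.exists_out_of_src hx
      rw [hX.src_rev_out] at hx
      exact ⟨starBlock X.blockRel p, (onV_block p).trans (Sum.inl_injective hx)⟩
    src_eq := onH_src
    next_eq := by
      rintro ⟨p, _ | _⟩
      · exact X.next_mark _
      · change X.next (X.rev (X.out p)) = X.rev (X.out (hr.pred p))
        obtain ⟨q, hq, hpq, hg⟩ := hX.next_rev_out p
        rw [hq]
        -- The rotation is forced by the partition: the next leg belongs to the same block and
        -- shares a gap type with `p`, which characterizes the cyclic predecessor.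
        have h1 : IsPred X.blockRel p q :=
          isPred_of_gapType_eq ((hX.blockRel_iff_block p q).2 hpq)
            (hX.gapType_eq_of_gap_eq (by omega) (by omega) hg.symm)
        rw [Fin.ext (h1.unique (hr.isPred_pred p))]
    rev_eq := by
      rintro ⟨p, _ | _⟩ _
      · rfl
      · exact (X.rev_rev _).symm
    rev_gone := fun _ _ t => t.elim
    face_eq := onH_face
    mark_eq := fun m => by
      change X.mark m = X.mark (markEquiv n ((markEquiv n).symm m))
      rw [Equiv.apply_symm_apply]
    gapT_eq := fun j => (gapT_eq_gap j).trans (onF_gap ⟨j, by omega⟩).symm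
    gapB_eq := fun j => (gapB_eq_gap j).trans (onF_gap ⟨2 * n - j, by omega⟩).symm
    inc_eq := by
      intro v f
      obtain ⟨p, rfl⟩ := hVs v
      change X.inc (onV (starBlock X.blockRel p)) (onF f) ↔
        ∃ h, starSrc X.blockRel h = Sum.inl (starBlock X.blockRel p) ∧ starFace X.blockRel h = f
      rw [onV_block, X.inc_iff _ _ (hX.src_rev_out p)]
      constructor
      · rintro ⟨x, hx, hf⟩
        obtain ⟨y, rfl⟩ := onH_surj x
        refine ⟨y, ?_, onF_bij.1 ((onH_face y).symm.trans hf)⟩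
        rw [onH_src, ← onV_block] at hx
        exact Sum.map_injective.2 ⟨onV_inj, Function.injective_id⟩ hx
      · rintro ⟨y, hy, rfl⟩
        refine ⟨onH y, ?_, onH_face y⟩
        rw [onH_src, hy, Sum.map_inl, onV_block]
    smooth_eq := fun v => iff_of_false (hX.not_smooth _) fun t => t }

end IsStarlike
end Drawing
end

noncomputable section

/-! ### The standard drawings span -/

/-- The span of the classes of the standard drawings. -/
def starSpan (n : ℕ) : Submodule CQ (ChromaticAlgebra n) :=
  Submodule.span CQ (Set.range fun r : {r | NCRel (2 * n) r} => cls (NCRel.star r.2))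

namespace Drawing

variable {n : ℕ} {X : Drawing n}

theorem map_src_inl {A B : Type} {g : A → B} {p : A ⊕ Mark n} :
    (∃ b, Sum.map g id p = Sum.inl b) ↔ ∃ a, p = Sum.inl a := by
  rcases p with a | m <;> simp

theorem map_src_inr {A B : Type} {g : A → B} {p : A ⊕ Mark n} :
    (∃ m, Sum.map g id p = Sum.inr m) ↔ ∃ m, p = Sum.inr m := by
  rcases p with a | m <;> simp

/-- A drawing with a univalent vertex is zero in the chromatic algebra. -/
theorem cls_eq_zero_of_univalent {x : X.H} {v : X.V} (hx : X.src x = Sum.inl v)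
    (hfix : X.next x = x) : cls X = 0 := by
  have hrev : (X.subdivide x).rough.rev (Sum.inr false) = Sum.inl x := rfl
  -- The edge at `v` may lead to a marked point and need not be inner. Subdividing it and counting
  -- the new point as a vertex produces a pendant inner edge.
  rw [← X.cls_subdivide x, ← (X.subdivide x).cls_rough]
  refine cls_eq_zero_of_pendant (X := (X.subdivide x).rough) (h := Sum.inr false)
    ⟨none, some v, rfl, X.subSrc_some.2 hx, fun t => t, fun t => t⟩ ?_
  rw [hrev]
  exact congrArg Sum.inl hfix

theorem IsStarlike.cls_mem_of_no_isolated (hX : X.IsStarlike)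
    (hiso : ∀ v, ∃ x, X.src x = Sum.inl v) : cls X ∈ starSpan n := by
  by_cases hp : ∀ x v, X.src x = Sum.inl v → X.next x ≠ x
  · rw [(hX.starCoarsening (hX.ncRel hp) hiso).cls_eq]
    exact Submodule.subset_span ⟨⟨_, hX.ncRel hp⟩, rfl⟩
  · push Not at hp
    obtain ⟨x, v, hx, hfix⟩ := hp
    rw [cls_eq_zero_of_univalent hx hfix]
    exact Submodule.zero_mem _

/-- Every face of a starlike drawing touches a half-edge at a vertex. -/
theorem IsStarlike.exists_face (hX : X.IsStarlike) (hn : 1 ≤ n) (f : X.F) :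
    ∃ x w, X.src x = Sum.inl w ∧ X.face x = f := by
  have key : ∃ x, X.face x = f := by
    by_contra hno
    push Not at hno
    -- A face that touches no half-edge would be the only face; but the half-edge at a marked point,
    -- which exists because `n ≥ 1`, has a face.
    rcases X.dual_connected {f} fun x => iff_of_false (hno x) (hno _) with h | h
    · exact Set.singleton_ne_empty f h
    · have : X.face (X.mark (Mark.top ⟨0, hn⟩)) ∈ ({f} : Set X.F) := by rw [h]; trivial
      exact hno _ this
  obtain ⟨x, hx⟩ := key
  rcases hs : X.src x with w | m
  · exact ⟨x, w, hs, hx⟩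
  · obtain ⟨w, hw⟩ := (hX.inner_iff (X.rev x)).2 ⟨m, by rw [X.rev_rev, hs]⟩
    obtain ⟨p, hp⟩ := X.next_surj (X.rev x)
    have sp : X.src p = Sum.inl w := by rw [← hw, ← hp, X.src_next]
    refine ⟨p, w, sp, ?_⟩
    rw [← X.corner p w sp, hp, X.rev_rev, hx]

theorem card_glued_lt {h : X.H} {v w : X.V} (hv : X.src h = Sum.inl v)
    (hw : X.src (X.rev h) = Sum.inl w) (hne : v ≠ w) : Nat.card (X.Glued h) < Nat.card X.V := by
  have := Fintype.ofFinite X.V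
  have := Fintype.ofFinite (X.Glued h)
  rw [Nat.card_eq_fintype_card, Nat.card_eq_fintype_card]
  exact Fintype.card_lt_of_surjective_not_injective _ Quot.mk_surjective fun hinj =>
    hne (hinj (Quot.sound ⟨hv, hw⟩))

/-- Induction on the number of vertices. An isolated vertex is absorbed by a vertex on the boundary
of its face, which leaves a starlike drawing with fewer vertices. -/
theorem IsStarlike.cls_mem (hn : 1 ≤ n) : ∀ (k : ℕ) (X : Drawing n), Nat.card X.V = k →
    X.IsStarlike → cls X ∈ starSpan n := by
  intro k
  induction k using Nat.strong_induction_on with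
  | _ k ih =>
    intro X hk hX
    by_cases hiso : ∀ v, ∃ x, X.src x = Sum.inl v
    · exact hX.cls_mem_of_no_isolated hiso
    · push Not at hiso
      obtain ⟨v, hv⟩ := hiso
      obtain ⟨f, hf, -⟩ := X.inc_unique v hv
      obtain ⟨h, w, hw, rfl⟩ := hX.exists_face hn f
      rw [cls_eq_contract_attach hv hw (hX.not_smooth w) hf (hX.not_smooth v)]
      refine ih _ ?_ _ rfl ⟨?_, ?_⟩
      · rw [← hk]
        exact card_glued_lt (X := X.attach h v w hv hw (hX.not_smooth w) hf) (h := Sum.inr false)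
          (v := w) (w := v) hw rfl fun e => hv h (e ▸ hw)
      · rintro q ⟨u, -, hu⟩
        exact hX.not_smooth u hu
      · rintro ⟨x | (_ | _), h1, h2⟩
        · exact map_src_inl.trans ((hX.inner_iff x).trans map_src_inr.symm)
        · exact absurd rfl h1
        · exact absurd rfl h2

/-- All points are vertices and no edge joins two marked points. -/
structure IsRough (X : Drawing n) : Prop where
  not_smooth : ∀ v, ¬ X.smooth v
  exists_inner : ∀ x m, X.src x = Sum.inr m → ∃ v, X.src (X.rev x) = Sum.inl v

theorem IsRough.delete (hX : X.IsRough) {h : X.H} (hin : X.IsInner h) :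
    (X.delete h hin).IsRough where
  not_smooth := hX.not_smooth
  exists_inner x := hX.exists_inner x.1

theorem IsRough.contract (hX : X.IsRough) {h : X.H} (hin : X.IsInner h) (hl : ¬ X.IsLoop h) :
    (X.contract h hin hl).IsRough where
  not_smooth := by
    rintro q ⟨u, -, hu⟩
    exact hX.not_smooth u hu
  exists_inner x m hx := by
    obtain ⟨m', hm'⟩ := map_src_inr.1 ⟨m, hx⟩
    exact map_src_inl.2 (hX.exists_inner x.1 m' hm')

theorem card_cut_lt (h : X.H) : Nat.card (Cut h (X.rev h)) < Nat.card X.H :=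
  Finite.card_subtype_lt (x := h) fun t => t.1 rfl

/-- Induction on the number of half-edges: the edge relations remove any inner edge, and contraction
and deletion keep the drawing rough. A rough drawing without inner edges is starlike. -/
theorem IsRough.cls_mem (hn : 1 ≤ n) : ∀ (k : ℕ) (X : Drawing n), Nat.card X.H = k →
    X.IsRough → cls X ∈ starSpan n := by
  intro k
  induction k using Nat.strong_induction_on with
  | _ k ih =>
    intro X hk hX
    by_cases hin : ∃ h, X.IsInner h
    · obtain ⟨h, hin⟩ := hin
      have hdel := ih _ (hk ▸ X.card_cut_lt h) (X.delete h hin) rfl (hX.delete hin)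
      by_cases hl : X.IsLoop h
      · rw [cls_loop X hin hl]
        exact Submodule.smul_mem _ _ hdel
      · rw [cls_contraction_deletion X hin hl]
        exact Submodule.sub_mem _
          (ih _ (hk ▸ X.card_cut_lt h) (X.contract h hin hl) rfl (hX.contract hin hl)) hdel
    · push Not at hin
      refine IsStarlike.cls_mem hn _ X rfl ⟨hX.not_smooth, fun x => ⟨?_, ?_⟩⟩
      · rintro ⟨v, hv⟩
        rcases hw : X.src (X.rev x) with w | m
        · exact absurd ⟨v, w, hv, hw, hX.not_smooth v, hX.not_smooth w⟩ (hin x)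
        · exact ⟨m, rfl⟩
      · rintro ⟨m, hm⟩
        have := hX.exists_inner _ m hm
        rwa [X.rev_rev] at this

/-- The half-edges of edges which join two marked points. -/
def direct (X : Drawing n) : Set X.H :=
  {x | (∃ m, X.src x = Sum.inr m) ∧ ∃ m, X.src (X.rev x) = Sum.inr m}

/-- Both parts of the subdivided edge end at the new point, so no edge becomes direct and this one
ceases to be. -/
theorem direct_subdivide {x : X.H} : (X.subdivide x).direct ⊆ Sum.inl '' (X.direct \ {x}) := by
  rintro (y | b) ⟨⟨m, hm⟩, m', hm'⟩
  · change X.subSrc (X.subRev x (Sum.inl y)) = _ at hm'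
    by_cases e : y = x
    · rw [e, subRev_self] at hm'; cases hm'
    · by_cases e' : y = X.rev x
      · rw [e', subRev_rev] at hm'; cases hm'
      · rw [X.subRev_of_ne e e'] at hm'
        exact ⟨y, ⟨⟨⟨m, X.subSrc_mark.1 hm⟩, m', X.subSrc_mark.1 hm'⟩, e⟩, rfl⟩
  · cases hm

/-- Edges between two marked points are never inner, so the edge relations cannot reach them.
Subdividing them one by one leaves a drawing which is rough as soon as its smooth points count as
vertices. -/
theorem cls_mem_starSpan (hn : 1 ≤ n) : ∀ (k : ℕ) (X : Drawing n), X.direct.ncard = k →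
    cls X ∈ starSpan n := by
  intro k
  induction k using Nat.strong_induction_on with
  | _ k ih =>
    intro X hk
    rcases X.direct.eq_empty_or_nonempty with he | ⟨x, hx⟩
    · rw [← X.cls_rough]
      refine IsRough.cls_mem hn _ X.rough rfl ⟨fun _ t => t, fun x m hm => ?_⟩
      rcases hs : X.src (X.rev x) with v | m'
      · exact ⟨v, hs⟩
      · exact absurd (show x ∈ X.direct from ⟨⟨m, hm⟩, m', hs⟩) (by rw [he]; exact fun t => t)
    · rw [← X.cls_subdivide x]
      refine ih _ ?_ _ rfl
      calc (X.subdivide x).direct.ncard ≤ (Sum.inl '' (X.direct \ {x}) : Set (X.H ⊕ Bool)).ncard :=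
            Set.ncard_le_ncard direct_subdivide (Set.toFinite _)
        _ ≤ (X.direct \ {x}).ncard := Set.ncard_image_le (Set.toFinite _)
        _ < X.direct.ncard := Set.ncard_sdiff_singleton_lt_of_mem hx (Set.toFinite _)
        _ = k := hk

end Drawing

theorem starSpan_eq_top {n : ℕ} (hn : 1 ≤ n) : starSpan n = ⊤ := by
  rw [eq_top_iff]
  rintro q -
  induction q using Submodule.Quotient.induction_on with
  | H x =>
    change (chromaticIdeal n).mkQ x ∈ starSpan n
    induction x using MonoidAlgebra.induction_linear with
    | zero => rw [map_zero]; exact Submodule.zero_mem _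
    | add x y hx hy => rw [map_add]; exact Submodule.add_mem _ hx hy
    | single d c =>
      induction d using Quot.ind with
      | mk X =>
        have : (MonoidAlgebra.single (Quot.mk _ X) c : FreeChromatic n) = c • diag X := by
          unfold diag
          rw [MonoidAlgebra.smul_single, smul_eq_mul, mul_one]
          rfl
        rw [this, map_smul]
        exact Submodule.smul_mem _ _ (Drawing.cls_mem_starSpan hn _ X rfl)

theorem theorem1 (n : ℕ) (hn : 1 ≤ n) :
    Module.Finite CQ (ChromaticAlgebra n) ∧
      (Module.finrank CQ (ChromaticAlgebra n) : ℚ) = riordan (2 * n) := by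
  have : Finite {r | NCRel (2 * n) r} := finite_ncRel (2 * n)
  have := Fintype.ofFinite {r | NCRel (2 * n) r}
  let b := Module.Basis.mk (linearIndependent_star n) (starSpan_eq_top hn).ge
  refine ⟨Module.Finite.of_basis b, ?_⟩
  rw [Module.finrank_eq_card_basis b, ← Nat.card_eq_fintype_card, Nat.card_coe_set_eq,
    ncard_ncRel]
end
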